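/- **Theorem (Diagonalization for $\mathrm g=1$).** Let $n,m\ge 1$ be integers, $-1<p<1$, and let $\mathrm g_r,\mathrm g'_r\in\mathbb R$ ($1\le r\le4$) satisfy $\mathrm g_r>0$ and $|\mathrm g'_r|<\mathrm g_r+\frac12$ for $r=1,2$. For $\mathrm g>0$ put $\alpha=\pi/(m+(n-1)\mathrm g+\mathrm g_1+\mathrm g_2)$, $\rho_j=(n-j)\mathrm g+\mathrm g_1$, and $$[z]_1=\frac{\vartheta_1(\frac\alpha2 z;p)}{\sin(\frac\alpha2)\,\vartheta_1'(0;p)},\qquad [z]_r=\frac{\vartheta_r(\frac\alpha2 z;p)}{\vartheta_r(0;p)}\ (r=2,3,4),\qquad [z]_{r,l}=\prod_{0\le k<l}[z+k]_r,\qquad [z_1,\dots,z_N]_{r,l}=\prod_i[z_i]_{r,l},$$ with the Jacobi theta functions $\vartheta_r(\cdot;p)$ of nome $p$ (the quotients extend analytically from $0<p<1$ to $-1<p<1$); $[z_1,\dots,z_N]_r$ means $\prod_i [z_i]_r$ and a prime on $[z]_r$ denotes $d/dz$. Let $\Lambda=\Lambda^{(n,m)}=\{\lambda\in\mathbb Z^n: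 m\ge\lambda_1\ge\dots\ge\lambda_n\ge0\}$ and let $H$ act on functions $f:\Lambda\to\mathbb C$ by $$(Hf)_\lambda=A_\lambda f_\lambda+\sum_{1\le j\le n,\ \varepsilon=\pm1,\ \lambda+\varepsilon e_j\in\Lambda}B_{\lambda,\varepsilon j}f_{\lambda+\varepsilon e_j},$$ $$A_\lambda=\sum_{r=1}^4 \mathrm c_r\Bigl(\prod_{j=1}^n\tfrac{[\rho_j+\lambda_j+\frac12-\mathrm g]_r[\rho_j+\lambda_j-\frac12+\mathrm g]_r}{[\rho_j+\lambda_j+\frac12]_r[\rho_j+\lambda_j-\frac12]_r}-1\Bigr),\qquad \mathrm c_r=\tfrac{2}{[\mathrm g]_1[\mathrm g-1]_1}\prod_{s=1}^4[\mathrm g_{\pi_r(s)}-\tfrac12]_s[\mathrm g'_{\pi_r(s)}]_s,$$ $$B_{\lambda,\varepsilon j}=\prod_{r=1}^4\tfrac{[\rho_j+\lambda_j+\varepsilon\mathrm g_r]_r[\rho_j+\lambda_j+\varepsilon(\mathrm g'_r+\frac12)]_r}{[\rho_j+\lambda_j]_r[\rho_j+\lambda_j+\frac\varepsilon2]_r}\prod_{k\ne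 j,\ \delta=\pm1}\tfrac{[\rho_j+\delta\rho_k+\lambda_j+\delta\lambda_k+\varepsilon\mathrm g]_1}{[\rho_j+\delta\rho_k+\lambda_j+\delta\lambda_k]_1},$$ where $\pi_1=\mathrm{id}$, $\pi_2=(12)(34)$, $\pi_3=(13)(24)$, $\pi_4=(14)(23)$. Let $$\Delta_\lambda=\Delta^{(n,m)}_\lambda=\prod_{j,r}\tfrac{[\rho_j+1,\rho_j+\mathrm g_r,\rho_j+\mathrm g_r'+\frac12]_{r,\lambda_j}}{[\rho_j,\rho_j+1-\mathrm g_r,\rho_j-\mathrm g_r'+\frac12]_{r,\lambda_j}}\prod_{j<k,\ \delta=\pm1}\tfrac{[\rho_j+\delta\rho_k+\mathrm g,\rho_j+\delta\rho_k+1]_{1,\lambda_j+\delta\lambda_k}}{[\rho_j+\delta\rho_k,\rho_j+\delta\rho_k+1-\mathrm g]_{1,\lambda_j+\delta\lambda_k}},\qquad \langle f,h\rangle_\Delta=\sum_{\lambda\in\Lambda} f_\lambda\overline{h_\lambda}\Delta_\lambda .$$ From here on $\rho_j,\alpha,\Delta,\langle\cdot,\cdot\rangle_\Delta$ are taken at $\mathrm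 g=1$. For $0\le k<n+m$ put $$a_k=\sum_{r=1}^4\tfrac{2\prod_s[\mathrm g_{\pi_r(s)}-\frac12]_s[\mathrm g'_{\pi_r(s)}]_s}{[1]_1\,[0]'_1}\Bigl(\tfrac{[\mathrm g_1+k+\frac12]_r'}{[\mathrm g_1+k+\frac12]_r}-\tfrac{[\mathrm g_1+k-\frac12]_r'}{[\mathrm g_1+k-\frac12]_r}\Bigr),$$ $$b_k^{+}=\prod_r\tfrac{[\mathrm g_1+\mathrm g_r+k]_r[\mathrm g_1+\mathrm g'_r+\frac12+k]_r}{[\mathrm g_1+k]_r[\mathrm g_1+\frac12+k]_r},\qquad b_k^{-}=\prod_r\tfrac{[\mathrm g_1-\mathrm g_r+k]_r[\mathrm g_1-\mathrm g'_r-\frac12+k]_r}{[\mathrm g_1+k]_r[\mathrm g_1-\frac12+k]_r}$$ (here and in $A_\lambda$ the singularities at $\mathrm g_1=\frac12$ and at $\mathrm g_2=\frac12$ are removable, and the expressions are understood as the limits there). For $0\le k\le n+m$ let $P_k(E)=\det(E\,I-J_k)$, with $J_k$ the $k\times k$ tridiagonal matrix with diagonal $a_0,\dots,a_{k-1}$,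 superdiagonal $b_0^+,\dots,b_{k-2}^+$ and subdiagonal $b_1^-,\dots,b_{k-1}^-$. *Then, as $\mathrm g\to1$, $H$ converges to a linear operator $H|_{\mathrm g\to1}$ (also when the $\mathrm g_r,\mathrm g_r'$ vary simultaneously towards their given values), the weights $\Delta_\lambda$ are positive, and $P_{n+m}$ has $n+m$ real simple roots $E_0>E_1>\dots>E_{n+m-1}$. Moreover:* (i) *The eigenvalues of $H|_{\mathrm g\to 1}$, counted with multiplicity, are* $$E_\nu=\sum_{1\le j\le n}E_{n-j+\nu_j}\qquad(\nu\in\Lambda);$$ *each $E_\nu$ is a real-analytic function of $p\in(-1,1)$, with value $2\sum_{j}\cos\bigl(\alpha(n-j+\tfrac12(\mathrm g_1+\mathrm g_2+\mathrm g_1'+\mathrm g_2')+\nu_j)\bigr)$ at $p=0$.* (ii) *Put* $$\mathrm a^{(\nu)}_\lambda=\det\bigl[P_{n-i+\lambda_i}(E_{n-j+\nu_j})\bigr]_{1\le i,j\le n},\qquad \mathrm s_\lambda^{(\nu)}=\mathrm a_\lambda^{(\nu)}/\mathrm a_0^{(\nu)},\qquad V_\lambda=\prod_{j<k,\ \delta=\pm1}\tfrac{[\rho_j+\delta\rho_k+\lambda_j+\delta\lambda_k]_1}{[\rho_j+\delta\rho_k]_1},$$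 $$\mathrm c_\lambda=\tfrac1{V_\lambda}\prod_{j,r}\tfrac{[\rho_j,\rho_j+\frac12]_{r,\lambda_j}}{[\rho_j+\mathrm g_r,\rho_j+\mathrm g_r'+\frac12]_{r,\lambda_j}},\qquad \mathrm n_\nu=\sum_{\lambda\in\Lambda}\mathrm c_\lambda^2(\mathrm s_\lambda^{(\nu)})^2\Delta_\lambda .$$ *Then $\mathrm a_0^{(\nu)}\ne0$, $\mathrm n_\nu>0$, and the functions $h^{(\nu)}_\lambda=\frac{\mathrm c_\lambda}{\mathrm n_\nu}\mathrm s^{(\nu)}_\lambda$, $\nu\in\Lambda$, form a basis of the space of functions $\Lambda\to\mathbb C$, orthogonal for $\langle\cdot,\cdot\rangle_\Delta$, with $H|_{\mathrm g\to1}h^{(\nu)}=E_\nu h^{(\nu)}$ and $h_0^{(\nu)}=\langle h^{(\nu)},h^{(\nu)}\rangle_\Delta$. The normalization has the product form* $$\mathrm n_\nu=\frac1{(\mathrm a_0^{(\nu)})^2}\prod_{1\le j\le n}\frac{\mathrm n_{n-j+\nu_j}}{\Delta^{(1,n+m-1)}_{n-j}\,\mathrm c_{n-j}^2},\qquad \mathrm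 c_k=\prod_{0\le j<k}\frac1{b_j^+},\qquad \mathrm n_l=\frac{P_{n+m-1}(E_l)}{\prod_{1\le k<n+m}b^+_{k-1}b^-_k}\prod_{0\le j<n+m,\ j\ne l}(E_l-E_j),$$ *where $\Delta_k^{(1,n+m-1)}$ is the above weight for $(n,m)$ replaced by $(1,n+m-1)$, at the partition $(k)$.* -/

import Mathlib

open Filter Topology Polynomial
open scoped BigOperators

namespace EllipticRacah

noncomputable section

/-! ### Theta functions

`theta p r` is the Jacobi theta function `ϑ_{r+1}(·;p)` in its product form. For `r = 0, 1` the
constant prefactor `2 p^{1/4}`, which cancels in the quotients below, is left out; this is what makes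
the rescaled functions `[z;p]_r` available on the whole interval `-1 < p < 1`. -/

def theta (p : ℝ) : Fin 4 → ℝ → ℝ :=
  ![fun z => Real.sin z * ∏' l : ℕ, ((1 - p ^ (2 * (l + 1))) *
      (1 - 2 * p ^ (2 * (l + 1)) * Real.cos (2 * z) + p ^ (4 * (l + 1)))),
    fun z => Real.cos z * ∏' l : ℕ, ((1 - p ^ (2 * (l + 1))) *
      (1 + 2 * p ^ (2 * (l + 1)) * Real.cos (2 * z) + p ^ (4 * (l + 1)))),
    fun z => ∏' l : ℕ, ((1 - p ^ (2 * (l + 1))) *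
      (1 + 2 * p ^ (2 * l + 1) * Real.cos (2 * z) + p ^ (4 * l + 2))),
    fun z => ∏' l : ℕ, ((1 - p ^ (2 * (l + 1))) *
      (1 - 2 * p ^ (2 * l + 1) * Real.cos (2 * z) + p ^ (4 * l + 2)))]

/-- The rescaled theta functions `[z;p]_{r+1}`:
`ϑ₁(αz/2) / (sin(α/2) ϑ₁'(0))` and `ϑ_r(αz/2) / ϑ_r(0)` for `r = 2, 3, 4`. -/
def br (α p : ℝ) (r : Fin 4) (z : ℝ) : ℝ :=
  if r = 0 then theta p 0 (α / 2 * z) / (Real.sin (α / 2) * deriv (theta p 0) 0)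
  else theta p r (α / 2 * z) / theta p r 0

/-- Elliptic shifted factorial `[z]_{r,l} = ∏_{0 ≤ k < l} [z+k]_r`. -/
def brFact (α p : ℝ) (r : Fin 4) (z : ℝ) (l : ℕ) : ℝ :=
  ∏ k ∈ Finset.range l, br α p r (z + k)

/-! ### The difference operator

The couplings `g_1,…,g_4` and `g'_1,…,g'_4` are `G 0,…,G 3` and `G' 0,…,G' 3`; particle indices
`j = 1,…,n` become `j : Fin n` (shifted by one). -/

/-- The truncation condition `α = π / (m + (n-1) g + g_1 + g_2)`. -/
def alpha (n m : ℕ) (g : ℝ) (G : Fin 4 → ℝ) : ℝ :=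
  Real.pi / (m + ((n : ℝ) - 1) * g + G 0 + G 1)

/-- `ρ_j = (n-j) g + g_1`. -/
def rho (n : ℕ) (g : ℝ) (G : Fin 4 → ℝ) (j : Fin n) : ℝ :=
  ((n : ℝ) - 1 - (j : ℕ)) * g + G 0

/-- The permutations `id, (12)(34), (13)(24), (14)(23)`. -/
def klein : Fin 4 → Equiv.Perm (Fin 4) :=
  ![1, Equiv.swap 0 1 * Equiv.swap 2 3, Equiv.swap 0 2 * Equiv.swap 1 3,
    Equiv.swap 0 3 * Equiv.swap 1 2]

/-- `∏_s [g_{π_r(s)} - 1/2]_s [g'_{π_r(s)}]_s`. -/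
def cNum (α p : ℝ) (G G' : Fin 4 → ℝ) (r : Fin 4) : ℝ :=
  ∏ s : Fin 4, br α p s (G (klein r s) - 1 / 2) * br α p s (G' (klein r s))

/-- The constants `c_r`. -/
def cCoeff (α p g : ℝ) (G G' : Fin 4 → ℝ) (r : Fin 4) : ℝ :=
  2 / (br α p 0 g * br α p 0 (g - 1)) * cNum α p G G' r

/-- The diagonal coefficient `A_λ`. -/
def coeffA (n m : ℕ) (p g : ℝ) (G G' : Fin 4 → ℝ) (l : Fin n → ℤ) : ℝ :=
  let α := alpha n m g G
  ∑ r : Fin 4, cCoeff α p g G G' r *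
    ((∏ j : Fin n,
        br α p r (rho n g G j + l j + 1 / 2 - g) / br α p r (rho n g G j + l j + 1 / 2) *
        (br α p r (rho n g G j + l j - 1 / 2 + g) / br α p r (rho n g G j + l j - 1 / 2))) - 1)

/-- The off-diagonal coefficient `B_{λ, εj}`, `ε = ±1`. -/
def coeffB (n m : ℕ) (p g : ℝ) (G G' : Fin 4 → ℝ) (l : Fin n → ℤ) (ε : ℤ) (j : Fin n) : ℝ :=
  let α := alpha n m g G
  let x : Fin n → ℝ := fun i => rho n g G i + l i
  (∏ r : Fin 4, br α p r (x j + ε * G r) * br α p r (x j + ε * (G' r + 1 / 2)) /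
      (br α p r (x j) * br α p r (x j + ε / 2))) *
    ∏ k ∈ Finset.univ.erase j, ∏ δ ∈ ({1, -1} : Finset ℤ),
      br α p 0 (x j + δ * x k + ε * g) / br α p 0 (x j + δ * x k)

open Classical in
/-- The partitions `m ≥ λ_1 ≥ ⋯ ≥ λ_n ≥ 0`. -/
def Lam (n m : ℕ) : Finset (Fin n → ℤ) :=
  (Finset.Icc (0 : Fin n → ℤ) (fun _ => (m : ℤ))).filter Antitone

theorem zero_mem_Lam (n m : ℕ) : (0 : Fin n → ℤ) ∈ Lam n m := by
  simp only [Lam, Finset.mem_filter, Finset.mem_Icc, le_refl, true_and]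
  exact ⟨fun _ => by simp, fun _ _ _ => le_refl _⟩

/-- The zero partition. -/
def zeroPart (n m : ℕ) : ↥(Lam n m) := ⟨0, zero_mem_Lam n m⟩

open Classical in
/-- Extension of a function on `Λ^{(n,m)}` by zero. -/
def extendZero {n m : ℕ} (f : ↥(Lam n m) → ℂ) (μ : Fin n → ℤ) : ℂ :=
  if h : μ ∈ Lam n m then f ⟨μ, h⟩ else 0

/-- The truncated difference operator `H` acting on complex functions on `Λ^{(n,m)}`; the terms with
`λ + ε e_j ∉ Λ^{(n,m)}` are absent. -/
def hamiltonian (n m : ℕ) (p g : ℝ) (G G' : Fin 4 → ℝ) (f : ↥(Lam n m) → ℂ)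
    (l : ↥(Lam n m)) : ℂ :=
  (coeffA n m p g G G' l.1 : ℂ) * f l +
    ∑ j : Fin n, ∑ ε ∈ ({1, -1} : Finset ℤ),
      (coeffB n m p g G G' l.1 ε j : ℂ) * extendZero f (l.1 + Pi.single j ε)

/-- The elliptic weights `Δ_λ`. -/
def weight (n m : ℕ) (p g : ℝ) (G G' : Fin 4 → ℝ) (l : Fin n → ℤ) : ℝ :=
  let α := alpha n m g G
  (∏ j : Fin n, ∏ r : Fin 4,
    (brFact α p r (rho n g G j + 1) (l j).toNat *
      brFact α p r (rho n g G j + G r) (l j).toNat *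
      brFact α p r (rho n g G j + G' r + 1 / 2) (l j).toNat) /
    (brFact α p r (rho n g G j) (l j).toNat *
      brFact α p r (rho n g G j + 1 - G r) (l j).toNat *
      brFact α p r (rho n g G j - G' r + 1 / 2) (l j).toNat)) *
  ∏ j : Fin n, ∏ k ∈ Finset.Ioi j, ∏ δ ∈ ({1, -1} : Finset ℤ),
    (brFact α p 0 (rho n g G j + δ * rho n g G k + g) (l j + δ * l k).toNat *
      brFact α p 0 (rho n g G j + δ * rho n g G k + 1) (l j + δ * l k).toNat) /
    (brFact α p 0 (rho n g G j + δ * rho n g G k) (l j + δ * l k).toNat *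
      brFact α p 0 (rho n g G j + δ * rho n g G k + 1 - g) (l j + δ * l k).toNat)

/-- The inner product `⟨f, h⟩_Δ = ∑_λ f_λ conj(h_λ) Δ_λ` with the weights at `g = 1`. -/
def innerDelta (n m : ℕ) (p : ℝ) (G G' : Fin 4 → ℝ) (f h : ↥(Lam n m) → ℂ) : ℂ :=
  ∑ l : ↥(Lam n m), f l * (starRingEnd ℂ) (h l) * (weight n m p 1 G G' l : ℂ)

/-! ### Elliptic Racah polynomials (`g = 1`) -/

/-- The residue of `c_r` at `g = 1` for fixed `α`: `c_r` has the denominator `[g]_1 [g-1]_1`, and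
`[g-1]_1` has derivative `[·]'_1(0)` there. -/
def resC (α p : ℝ) (G G' : Fin 4 → ℝ) (r : Fin 4) : ℝ :=
  2 / (br α p 0 1 * deriv (br α p 0) 0) * cNum α p G G' r

/-- `∑_r Res(c_r) ([g_1+k+1/2]_r'/[g_1+k+1/2]_r - [g_1+k-1/2]_r'/[g_1+k-1/2]_r)`. -/
def racahAFormula (n m : ℕ) (p : ℝ) (G G' : Fin 4 → ℝ) (k : ℕ) : ℝ :=
  let α := alpha n m 1 G
  ∑ r : Fin 4, resC α p G G' r *
    (deriv (br α p r) (G 0 + k + 1 / 2) / br α p r (G 0 + k + 1 / 2) -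
      deriv (br α p r) (G 0 + k - 1 / 2) / br α p r (G 0 + k - 1 / 2))

/-- The coefficient `a_k`. The formula has removable singularities at `g_1 = 1/2` and `g_2 = 1/2`,
where it takes the form `0/0`; there its value is the limit (elsewhere the limit is the value). -/
def racahA (n m : ℕ) (p : ℝ) (G G' : Fin 4 → ℝ) (k : ℕ) : ℝ :=
  limUnder (𝓝[{H : Fin 4 → ℝ | H 0 ≠ 1 / 2 ∧ H 1 ≠ 1 / 2}] G)
    (fun H => racahAFormula n m p H G' k)

/-- The coefficient `b_k^+`. -/
def racahBplus (n m : ℕ) (p : ℝ) (G G' : Fin 4 → ℝ) (k : ℕ) : ℝ :=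
  let α := alpha n m 1 G
  ∏ r : Fin 4, br α p r (G 0 + G r + k) * br α p r (G 0 + G' r + 1 / 2 + k) /
    (br α p r (G 0 + k) * br α p r (G 0 + 1 / 2 + k))

/-- The coefficient `b_k^-`. -/
def racahBminus (n m : ℕ) (p : ℝ) (G G' : Fin 4 → ℝ) (k : ℕ) : ℝ :=
  let α := alpha n m 1 G
  ∏ r : Fin 4, br α p r (G 0 - G r + k) * br α p r (G 0 - G' r - 1 / 2 + k) /
    (br α p r (G 0 + k) * br α p r (G 0 - 1 / 2 + k))

/-- The `k × k` tridiagonal matrix with diagonal `a_0,…,a_{k-1}`, superdiagonal `b_0^+,…,b_{k-2}^+`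
and subdiagonal `b_1^-,…,b_{k-1}^-`. -/
def jacobiMatrix (n m : ℕ) (p : ℝ) (G G' : Fin 4 → ℝ) (k : ℕ) : Matrix (Fin k) (Fin k) ℝ :=
  fun i j =>
    if i = j then racahA n m p G G' i
    else if (i : ℕ) + 1 = j then racahBplus n m p G G' i
    else if (j : ℕ) + 1 = i then racahBminus n m p G G' i
    else 0

/-- The elliptic Racah polynomial `P_k(E) = det(E - J_k)`. -/
def racahP (n m : ℕ) (p : ℝ) (G G' : Fin 4 → ℝ) (k : ℕ) : ℝ[X] :=
  (jacobiMatrix n m p G G' k).charpoly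

/-- The roots `E_0 ≥ E_1 ≥ ⋯` of `P_{n+m}`, with multiplicity, in decreasing order. -/
def racahRoot (n m : ℕ) (p : ℝ) (G G' : Fin 4 → ℝ) (l : ℕ) : ℝ :=
  ((racahP n m p G G' (n + m)).roots.sort (· ≥ ·)).getD l 0

/-- `c_k = ∏_{0 ≤ j < k} (b_j^+)⁻¹`. -/
def racahC (n m : ℕ) (p : ℝ) (G G' : Fin 4 → ℝ) (k : ℕ) : ℝ :=
  ∏ j ∈ Finset.range k, (racahBplus n m p G G' j)⁻¹

/-- `n_l = P_{n+m-1}(E_l) / ∏_{1 ≤ k < n+m} b_{k-1}^+ b_k^- · ∏_{j ≠ l} (E_l - E_j)`. -/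
def racahN (n m : ℕ) (p : ℝ) (G G' : Fin 4 → ℝ) (l : ℕ) : ℝ :=
  (racahP n m p G G' (n + m - 1)).eval (racahRoot n m p G G' l) /
      (∏ k ∈ Finset.Ico 1 (n + m), racahBplus n m p G G' (k - 1) * racahBminus n m p G G' k) *
    ∏ j ∈ (Finset.range (n + m)).erase l, (racahRoot n m p G G' l - racahRoot n m p G G' j)

/-- The one-particle weight `Δ_k^{(1,n+m-1)}`. -/
def weightOne (n m : ℕ) (p : ℝ) (G G' : Fin 4 → ℝ) (k : ℕ) : ℝ :=
  weight 1 (n + m - 1) p 1 G G' (fun _ => (k : ℤ))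

/-! ### Generalized Schur polynomials and eigenfunctions (`g = 1`) -/

/-- The index `n - j + λ_j`. -/
def node (n : ℕ) (l : Fin n → ℤ) (j : Fin n) : ℕ := n - 1 - (j : ℕ) + (l j).toNat

/-- `E_ν = ∑_j E_{n-j+ν_j}`. -/
def eigenvalue (n m : ℕ) (p : ℝ) (G G' : Fin 4 → ℝ) (ν : Fin n → ℤ) : ℝ :=
  ∑ j : Fin n, racahRoot n m p G G' (node n ν j)

/-- `a_λ^{(ν)} = det [P_{n-i+λ_i}(E_{n-j+ν_j})]`. -/
def altA (n m : ℕ) (p : ℝ) (G G' : Fin 4 → ℝ) (ν l : Fin n → ℤ) : ℝ :=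
  Matrix.det (Matrix.of fun i j : Fin n =>
    (racahP n m p G G' (node n l i)).eval (racahRoot n m p G G' (node n ν j)))

/-- The generalized Schur polynomial `s_λ^{(ν)} = a_λ^{(ν)} / a_0^{(ν)}`. -/
def schurS (n m : ℕ) (p : ℝ) (G G' : Fin 4 → ℝ) (ν l : Fin n → ℤ) : ℝ :=
  altA n m p G G' ν l / altA n m p G G' ν 0

/-- `V_λ` at `g = 1`. -/
def vand (n m : ℕ) (p : ℝ) (G : Fin 4 → ℝ) (l : Fin n → ℤ) : ℝ :=
  let α := alpha n m 1 G
  ∏ j : Fin n, ∏ k ∈ Finset.Ioi j, ∏ δ ∈ ({1, -1} : Finset ℤ),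
    br α p 0 (rho n 1 G j + δ * rho n 1 G k + l j + δ * l k) /
      br α p 0 (rho n 1 G j + δ * rho n 1 G k)

/-- The prefactor `c_λ` at `g = 1`. -/
def prefC (n m : ℕ) (p : ℝ) (G G' : Fin 4 → ℝ) (l : Fin n → ℤ) : ℝ :=
  let α := alpha n m 1 G
  1 / vand n m p G l * ∏ j : Fin n, ∏ r : Fin 4,
    (brFact α p r (rho n 1 G j) (l j).toNat * brFact α p r (rho n 1 G j + 1 / 2) (l j).toNat) /
    (brFact α p r (rho n 1 G j + G r) (l j).toNat *
      brFact α p r (rho n 1 G j + G' r + 1 / 2) (l j).toNat)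

/-- The normalization `n_ν = ∑_λ c_λ² (s_λ^{(ν)})² Δ_λ`. -/
def normN (n m : ℕ) (p : ℝ) (G G' : Fin 4 → ℝ) (ν : Fin n → ℤ) : ℝ :=
  ∑ l ∈ Lam n m, prefC n m p G G' l ^ 2 * schurS n m p G G' ν l ^ 2 * weight n m p 1 G G' l

/-- The eigenfunction `h_λ^{(ν)} = (c_λ / n_ν) s_λ^{(ν)}`. -/
def eigenfun (n m : ℕ) (p : ℝ) (G G' : Fin 4 → ℝ) (ν : Fin n → ℤ) (l : ↥(Lam n m)) : ℂ :=
  ((prefC n m p G G' l / normN n m p G G' ν * schurS n m p G G' ν l : ℝ) : ℂ)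

end

end EllipticRacah

open EllipticRacah

namespace EllipticRacah
noncomputable section

/-! ### The infinite products behind the theta functions -/

/-! At `g = 1` the model is a system of free fermions on a chain of `N = n + m` sites. A partition
is recorded by its strictly decreasing occupied sites `n - j + λ_j` (`node`) in `{0, …, N - 1}`. In
`B_λ` the interaction becomes the quotient `V_{λ+εe_j} / V_λ` of elliptic Vandermonde products
(`coeffB_eq`). In `A_λ` the constants `c_r` have a pole at `g = 1` while the factors of the product
generically tend to one, so the product linearizes into a sum of one-particle coefficients `a_k`
(`tendsto_coeffA`). After conjugation by `V_λ` the limit is a sum, over the particles, of one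
tridiagonal operator acting on antisymmetric functions. Slater determinants of its eigenfunctions
`c_k P_k(E_l)` diagonalize it and the eigenvalues add (`slaterDet_eigen`). Forbidden moves drop out
because `b_0^- = b_{N-1}^+ = 0` and because a determinant with two equal rows vanishes.

Since `b_k^+ b_{k+1}^- > 0`, the tridiagonal matrix has the characteristic polynomial of a real
symmetric one. The Christoffel–Darboux identities give simplicity of its roots, one-particle
orthogonality and the formula for `n_l`. The weight is `V_λ ^ 2` times one-particle weights
(`weight_eq`), so inner products of determinants reduce to one-particle ones by Cauchy–Binet
(`sum_prefC_altA`). As the `P_k` are monic, `a_0^{(ν)}` is a Vandermonde determinant in distinct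
nodes.

Analyticity in `p` follows from the implicit function theorem at simple roots, the theta products
being holomorphic in the nome. At `p = 0` the one-particle operator is bidiagonal in an Askey–Wilson
basis and the roots are its diagonal entries (`exists_bidiagonal`).

The delicate point is the removable singularities: at `g_1 = 1/2` (site `0`) and `g_2 = 1/2` (site
`N - 1`) a vanishing denominator cancels a factor of `c_1` or `c_2` (`exists_regular_coeff`). At
most one particle sits on such a site, so at most one factor of the product can fail to tend to one.
-/

/-- The quadratic factor `1 - 2 q cos(2z) + q²`. -/
def quadFactor (q z : ℝ) : ℝ := 1 - 2 * q * Real.cos (2 * z) + q ^ 2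

/-- `∏ (1 - p^{2(l+1)}) (1 - 2 p^{e l} cos(2z) + p^{2 e l})`. -/
def qprod (e : ℕ → ℕ) (p z : ℝ) : ℝ :=
  ∏' l : ℕ, ((1 - p ^ (2 * (l + 1))) * quadFactor (p ^ e l) z)

/-- The logarithmic derivative of `qprod` in `z`. -/
def qsum (e : ℕ → ℕ) (p z : ℝ) : ℝ :=
  ∑' l : ℕ, 4 * p ^ e l * Real.sin (2 * z) / quadFactor (p ^ e l) z

theorem quadFactor_ge (q z : ℝ) : (1 - |q|) ^ 2 ≤ quadFactor q z := by
  have h : q * Real.cos (2 * z) ≤ |q| := by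
    calc q * Real.cos (2 * z) ≤ |q * Real.cos (2 * z)| := le_abs_self _
      _ = |q| * |Real.cos (2 * z)| := abs_mul _ _
      _ ≤ |q| * 1 := by gcongr; exact Real.abs_cos_le_one _
      _ = |q| := mul_one _
  have h2 : |q| ^ 2 = q ^ 2 := sq_abs q
  unfold quadFactor
  nlinarith

theorem quadFactor_pos {q : ℝ} (hq : |q| < 1) (z : ℝ) : 0 < quadFactor q z :=
  lt_of_lt_of_le (by have : 0 < 1 - |q| := by linarith
                     positivity) (quadFactor_ge q z)

theorem abs_pow_le_pow_succ {p : ℝ} (hp : |p| < 1) {k l : ℕ} (h : l + 1 ≤ k) :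
    |p ^ k| ≤ |p| ^ (l + 1) := by
  rw [abs_pow]
  exact pow_le_pow_of_le_one (abs_nonneg _) hp.le h

theorem abs_pow_lt_one {p : ℝ} (hp : |p| < 1) {k l : ℕ} (h : l + 1 ≤ k) : |p ^ k| < 1 := by
  rw [abs_pow]
  exact pow_lt_one₀ (abs_nonneg _) hp (by omega)

theorem summable_pow_succ {r : ℝ} (h0 : 0 ≤ r) (h : r < 1) :
    Summable fun l : ℕ => r ^ (l + 1) :=
  (summable_nat_add_iff 1).2 (summable_geometric_of_lt_one h0 h)

/-- The deviation from one of a factor of `qprod`. -/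
def factorDev (e : ℕ → ℕ) (l : ℕ) (p c : ℂ) : ℂ :=
  (1 - p ^ (2 * (l + 1))) * (1 - 2 * p ^ e l * c + (p ^ e l) ^ 2) - 1

/-- Only the nome becomes complex; `z` stays real, so `‖c‖ ≤ 1` is enough. The geometric bound,
uniform on discs, feeds the Weierstrass test for the product. -/
theorem norm_factorDev_le {e : ℕ → ℕ} (he : ∀ l, l + 1 ≤ e l) {R : ℝ} (hR : R < 1)
    (l : ℕ) {p c : ℂ} (hp : ‖p‖ ≤ R) (hc : ‖c‖ ≤ 1) :
    ‖factorDev e l p c‖ ≤ 7 * R ^ (l + 1) := by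
  have hR0 : 0 ≤ R := (norm_nonneg _).trans hp
  set a := p ^ (2 * (l + 1)) with ha
  set b := p ^ e l with hb
  have key : ∀ k, l + 1 ≤ k → ‖p ^ k‖ ≤ R ^ (l + 1) := fun k hk => by
    rw [norm_pow]
    exact (pow_le_pow_left₀ (norm_nonneg _) hp k).trans (pow_le_pow_of_le_one hR0 hR.le hk)
  have h1 : ‖a‖ ≤ R ^ (l + 1) := key _ (by omega)
  have h2 : ‖b‖ ≤ R ^ (l + 1) := key _ (he l)
  have h3 : R ^ (l + 1) ≤ 1 := pow_le_one₀ hR0 hR.le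
  have h4 : 0 ≤ R ^ (l + 1) := by positivity
  set t := R ^ (l + 1)
  -- From `(1 - a)(1 + x) - 1 = (1 - a) x - a` the constant is `7 = 2 · 3 + 1`.
  have : factorDev e l p c = (1 - a) * (-(2 * b * c) + b ^ 2) + (-a) := by
    simp only [factorDev]; ring
  rw [this]
  have h5 : ‖1 - a‖ ≤ 2 := (norm_sub_le _ _).trans (by simpa using by linarith)
  have h6 : ‖-(2 * b * c) + b ^ 2‖ ≤ 3 * t := by
    refine (norm_add_le _ _).trans ?_
    rw [norm_neg, norm_mul, norm_mul, norm_pow b 2]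
    have : ‖(2 : ℂ)‖ = 2 := by simp
    rw [this]
    have : ‖b‖ * ‖c‖ ≤ t * 1 := by gcongr
    have : ‖b‖ ^ 2 ≤ t ^ 2 := by gcongr
    nlinarith
  refine (norm_add_le _ _).trans ?_
  rw [norm_mul, norm_neg]
  have : ‖1 - a‖ * ‖-(2 * b * c) + b ^ 2‖ ≤ 2 * (3 * t) := by gcongr
  linarith

theorem one_add_factorDev_ofReal (e : ℕ → ℕ) (l : ℕ) (p z : ℝ) :
    1 + factorDev e l (p : ℂ) (Real.cos (2 * z) : ℝ) =
      (((1 - p ^ (2 * (l + 1))) * quadFactor (p ^ e l) z : ℝ) : ℂ) := by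
  simp only [factorDev, quadFactor]
  push_cast
  ring

theorem norm_ofReal_cos_le (z : ℝ) : ‖((Real.cos z : ℝ) : ℂ)‖ ≤ 1 := by
  rw [Complex.norm_real]
  exact Real.abs_cos_le_one _

theorem ofReal_qprod (e : ℕ → ℕ) (p z : ℝ) (he : ∀ l, l + 1 ≤ e l) (hp : |p| < 1) :
    ((qprod e p z : ℝ) : ℂ) =
      ∏' l : ℕ, (1 + factorDev e l (p : ℂ) (Real.cos (2 * z) : ℝ)) := by
  have hs : Summable fun l => ‖(1 - p ^ (2 * (l + 1))) * quadFactor (p ^ e l) z - 1‖ := by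
    refine Summable.of_nonneg_of_le (fun _ => norm_nonneg _) (fun l => ?_)
      ((summable_pow_succ (abs_nonneg p) hp).mul_left 7)
    have h := norm_factorDev_le he hp l (p := (p : ℂ)) (by simp) (norm_ofReal_cos_le (2 * z))
    have h2 := one_add_factorDev_ofReal e l p z
    have h3 : factorDev e l (p : ℂ) (Real.cos (2 * z) : ℝ) =
      (((1 - p ^ (2 * (l + 1))) * quadFactor (p ^ e l) z - 1 : ℝ) : ℂ) := by
      push_cast at h2 ⊢
      rw [← h2]; ring
    rwa [h3, Complex.norm_real] at h
  have hm : Multipliable fun l => (1 - p ^ (2 * (l + 1))) * quadFactor (p ^ e l) z := by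
    have := multipliable_one_add_of_summable hs
    simpa using this
  simp_rw [one_add_factorDev_ofReal]
  exact (hm.map_tprod Complex.ofRealHom Complex.continuous_ofReal)

theorem differentiableOn_tprod_factorDev {e : ℕ → ℕ} (he : ∀ l, l + 1 ≤ e l) {R : ℝ}
    (hR0 : 0 ≤ R) (hR : R < 1) {c : ℂ} (hc : ‖c‖ ≤ 1) :
    DifferentiableOn ℂ (fun p => ∏' l : ℕ, (1 + factorDev e l p c)) (Metric.ball 0 R) := by
  have hd : ∀ l, Differentiable ℂ fun p => factorDev e l p c := fun l => by
    unfold factorDev; fun_prop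
  have h := Summable.hasProdLocallyUniformlyOn_nat_one_add (f := fun l p => factorDev e l p c)
    (K := Metric.ball (0 : ℂ) R) Metric.isOpen_ball
    ((summable_pow_succ hR0 hR).mul_left 7)
    (Eventually.of_forall fun l p hp =>
      norm_factorDev_le he hR l (by simpa using (Metric.mem_ball.1 hp).le) hc)
    (fun l => (hd l).continuous.continuousOn)
  refine (h.tendstoLocallyUniformlyOn_finsetRange).differentiableOn
    (Eventually.of_forall fun n => ?_) Metric.isOpen_ball
  refine DifferentiableOn.fun_finsetProd fun i _ => ?_
  exact ((hd i).const_add 1).differentiableOn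

/-- A real function that extends to a holomorphic function on all discs of radius below one is
real-analytic on `(-1, 1)`. -/
theorem analyticOnNhd_of_complex {f : ℝ → ℝ} {F : ℂ → ℂ}
    (hF : ∀ R : ℝ, 0 ≤ R → R < 1 → DifferentiableOn ℂ F (Metric.ball 0 R))
    (hf : ∀ p : ℝ, |p| < 1 → ((f p : ℝ) : ℂ) = F p) :
    AnalyticOnNhd ℝ f (Set.Ioo (-1) 1) := by
  intro p hp
  have hp' : |p| < 1 := abs_lt.2 hp
  obtain ⟨R, h1, h2⟩ := exists_between hp'
  have hb : Metric.ball (0 : ℂ) R ∈ 𝓝 (p : ℂ) :=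
    Metric.isOpen_ball.mem_nhds (by simpa using h1)
  have ha : AnalyticAt ℂ F (p : ℂ) :=
    (hF R ((abs_nonneg _).trans h1.le) h2).analyticAt hb
  refine ha.re_ofReal.congr ?_
  filter_upwards [isOpen_Ioo.mem_nhds hp] with q hq
  rw [← hf q (abs_lt.2 hq), Complex.ofReal_re]

theorem analyticOnNhd_qprod {e : ℕ → ℕ} (he : ∀ l, l + 1 ≤ e l) (z : ℝ) :
    AnalyticOnNhd ℝ (fun p => qprod e p z) (Set.Ioo (-1) 1) :=
  analyticOnNhd_of_complex
    (fun _ h0 h1 => differentiableOn_tprod_factorDev he h0 h1 (norm_ofReal_cos_le (2 * z)))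
    (fun p hp => ofReal_qprod e p z he hp)

/-! Logarithmic form. -/

theorem abs_quadFactor_sub_one_le {q : ℝ} (hq : |q| ≤ 1) (z : ℝ) :
    |quadFactor q z - 1| ≤ 3 * |q| := by
  have h : |q * Real.cos (2 * z)| ≤ |q| := by
    rw [abs_mul]
    exact mul_le_of_le_one_right (abs_nonneg _) (Real.abs_cos_le_one _)
  have h2 : |q ^ 2| ≤ |q| := by
    rw [abs_pow]; nlinarith [abs_nonneg q]
  have : quadFactor q z - 1 = -2 * (q * Real.cos (2 * z)) + q ^ 2 := by
    unfold quadFactor; ring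
  rw [this]
  refine (abs_add_le _ _).trans ?_
  rw [abs_mul]
  have : |(-2 : ℝ)| = 2 := by norm_num
  rw [this]
  linarith

theorem summable_log_quadFactor {e : ℕ → ℕ} (he : ∀ l, l + 1 ≤ e l) {p : ℝ} (hp : |p| < 1)
    (z : ℝ) : Summable fun l => Real.log (quadFactor (p ^ e l) z) := by
  have h : Summable fun l => quadFactor (p ^ e l) z - 1 := by
    refine Summable.of_norm_bounded ((summable_pow_succ (abs_nonneg p) hp).mul_left 3)
      (fun l => ?_)
    refine (abs_quadFactor_sub_one_le (abs_pow_lt_one hp (he l)).le z).trans ?_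
    have := abs_pow_le_pow_succ hp (he l)
    linarith
  simpa using Real.summable_log_one_add_of_summable h

theorem summable_log_one_sub_pow {p : ℝ} (hp : |p| < 1) :
    Summable fun l : ℕ => Real.log (1 - p ^ (2 * (l + 1))) := by
  have h : Summable fun l : ℕ => -p ^ (2 * (l + 1)) := by
    refine Summable.of_norm_bounded (summable_pow_succ (abs_nonneg p) hp) (fun l => ?_)
    rw [norm_neg]
    exact abs_pow_le_pow_succ hp (by omega)
  simpa [← sub_eq_add_neg] using Real.summable_log_one_add_of_summable h

theorem one_sub_pow_pos {p : ℝ} (hp : |p| < 1) (l : ℕ) : 0 < 1 - p ^ (2 * (l + 1)) := by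
  have := abs_pow_lt_one hp (k := 2 * (l + 1)) (l := l) (by omega)
  linarith [le_abs_self (p ^ (2 * (l + 1)))]

/-- The exponential form shows that the infinite product of positive factors does not degenerate to
zero, and reduces its `z`-derivative to termwise differentiation of a series. -/
theorem qprod_eq_exp {e : ℕ → ℕ} (he : ∀ l, l + 1 ≤ e l) {p : ℝ} (hp : |p| < 1) (z : ℝ) :
    qprod e p z = Real.exp ((∑' l : ℕ, Real.log (1 - p ^ (2 * (l + 1)))) +
      ∑' l : ℕ, Real.log (quadFactor (p ^ e l) z)) := by
  have hq := fun l => quadFactor_pos (abs_pow_lt_one hp (he l)) z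
  rw [← (summable_log_one_sub_pow hp).tsum_add (summable_log_quadFactor he hp z)]
  have h : ∀ l, Real.log (1 - p ^ (2 * (l + 1))) + Real.log (quadFactor (p ^ e l) z) =
      Real.log ((1 - p ^ (2 * (l + 1))) * quadFactor (p ^ e l) z) := fun l =>
    (Real.log_mul (one_sub_pow_pos hp l).ne' (hq l).ne').symm
  simp_rw [h]
  rw [Real.rexp_tsum_eq_tprod (fun l => mul_pos (one_sub_pow_pos hp l) (hq l))]
  · rfl
  · simp_rw [← h]
    exact (summable_log_one_sub_pow hp).add (summable_log_quadFactor he hp z)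

theorem qprod_pos {e : ℕ → ℕ} (he : ∀ l, l + 1 ≤ e l) {p : ℝ} (hp : |p| < 1) (z : ℝ) :
    0 < qprod e p z := by
  rw [qprod_eq_exp he hp]; exact Real.exp_pos _

theorem hasDerivAt_quadFactor (q z : ℝ) :
    HasDerivAt (quadFactor q) (4 * q * Real.sin (2 * z)) z := by
  have h : HasDerivAt (fun z : ℝ => Real.cos (2 * z)) (-Real.sin (2 * z) * (2 * 1)) z :=
    (Real.hasDerivAt_cos _).comp z ((hasDerivAt_id z).const_mul 2)
  have := ((h.const_mul (2 * q)).const_sub 1).add_const (q ^ 2)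
  convert! this using 1
  ring

theorem abs_qsum_term_le {e : ℕ → ℕ} (he : ∀ l, l + 1 ≤ e l) {p : ℝ} (hp : |p| < 1) (l : ℕ)
    (z : ℝ) : ‖4 * p ^ e l * Real.sin (2 * z) / quadFactor (p ^ e l) z‖ ≤
      4 / (1 - |p|) ^ 2 * |p| ^ (l + 1) := by
  have h1 : |p ^ e l| ≤ |p| ^ (l + 1) := abs_pow_le_pow_succ hp (he l)
  have h2 : |p| ^ (l + 1) ≤ |p| := pow_le_of_le_one (abs_nonneg _) hp.le (by omega)
  have h0 : 0 < 1 - |p| := by linarith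
  have h3 : (1 - |p|) ^ 2 ≤ quadFactor (p ^ e l) z :=
    le_trans (by have : 1 - |p| ≤ 1 - |p ^ e l| := by linarith
                 gcongr) (quadFactor_ge _ z)
  have h4 : 0 < quadFactor (p ^ e l) z := quadFactor_pos (abs_pow_lt_one hp (he l)) z
  rw [Real.norm_eq_abs, abs_div, abs_mul, abs_mul, abs_of_pos h4, abs_of_pos (by norm_num : (0:ℝ) < 4)]
  calc 4 * |p ^ e l| * |Real.sin (2 * z)| / quadFactor (p ^ e l) z
      ≤ 4 * |p| ^ (l + 1) * 1 / (1 - |p|) ^ 2 := by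
        gcongr
        exact Real.abs_sin_le_one _
    _ = _ := by ring

theorem hasDerivAt_qprod {e : ℕ → ℕ} (he : ∀ l, l + 1 ≤ e l) {p : ℝ} (hp : |p| < 1) (z : ℝ) :
    HasDerivAt (qprod e p) (qprod e p z * qsum e p z) z := by
  have h := hasDerivAt_tsum (y₀ := z) (g := fun l z => Real.log (quadFactor (p ^ e l) z))
    (g' := fun l z => 4 * p ^ e l * Real.sin (2 * z) / quadFactor (p ^ e l) z)
    ((summable_pow_succ (abs_nonneg p) hp).mul_left (4 / (1 - |p|) ^ 2))
    (fun l y => (hasDerivAt_quadFactor _ y).log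
      (quadFactor_pos (abs_pow_lt_one hp (he l)) y).ne')
    (fun l y => abs_qsum_term_le he hp l y) (summable_log_quadFactor he hp z) z
  have h2 := (h.const_add (∑' l : ℕ, Real.log (1 - p ^ (2 * (l + 1))))).exp
  rw [← qprod_eq_exp he hp] at h2
  exact h2.congr_of_eventuallyEq (Eventually.of_forall fun y => qprod_eq_exp he hp y)

theorem continuous_qsum {e : ℕ → ℕ} (he : ∀ l, l + 1 ≤ e l) {p : ℝ} (hp : |p| < 1) :
    Continuous (qsum e p) := by
  refine continuous_tsum (fun l => ?_)
    ((summable_pow_succ (abs_nonneg p) hp).mul_left (4 / (1 - |p|) ^ 2))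
    (fun l y => abs_qsum_term_le he hp l y)
  refine Continuous.div (by fun_prop) (by unfold quadFactor; fun_prop)
    (fun y => (quadFactor_pos (abs_pow_lt_one hp (he l)) y).ne')

/-! Analyticity of `qsum` in the nome. -/

/-- The quadratic splits as `(1 - q e^{2iz})(1 - q e^{-2iz})` with phases of modulus one. Hence the
denominators in `qsum` have no zeros in the complex unit disc. -/
theorem norm_quad_ge {q : ℂ} (hq : ‖q‖ ≤ 1) (z : ℝ) :
    (1 - ‖q‖) ^ 2 ≤ ‖1 - 2 * q * (Real.cos (2 * z) : ℝ) + q ^ 2‖ := by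
  set w := Complex.exp ((2 * z : ℝ) * Complex.I) with hw
  set w' := Complex.exp (((-(2 * z) : ℝ) : ℂ) * Complex.I) with hw'
  have h1 : ‖w‖ = 1 := Complex.norm_exp_ofReal_mul_I _
  have h2 : ‖w'‖ = 1 := Complex.norm_exp_ofReal_mul_I _
  have h3 : w * w' = 1 := by
    rw [hw, hw', ← Complex.exp_add]; simp
  have h4 : 2 * ((Real.cos (2 * z) : ℝ) : ℂ) = w + w' := by
    rw [Complex.ofReal_cos, Complex.two_cos, hw, hw']
    simp
  have h5 : 1 - 2 * q * (Real.cos (2 * z) : ℝ) + q ^ 2 = (1 - q * w) * (1 - q * w') := by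
    linear_combination (-q) * h4 - q ^ 2 * h3
  have h6 : ∀ v : ℂ, ‖v‖ = 1 → 1 - ‖q‖ ≤ ‖1 - q * v‖ := fun v hv => by
    have := norm_sub_norm_le 1 (q * v)
    rw [norm_mul, hv, mul_one, norm_one] at this
    exact this
  rw [h5, norm_mul, sq]
  have : 0 ≤ 1 - ‖q‖ := by linarith
  exact mul_le_mul (h6 w h1) (h6 w' h2) this (norm_nonneg _)

theorem analyticOnNhd_qsum {e : ℕ → ℕ} (he : ∀ l, l + 1 ≤ e l) (z : ℝ) :
    AnalyticOnNhd ℝ (fun p => qsum e p z) (Set.Ioo (-1) 1) := by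
  refine analyticOnNhd_of_complex (F := fun p : ℂ => ∑' l : ℕ, 4 * p ^ e l *
    (Real.sin (2 * z) : ℝ) / (1 - 2 * p ^ e l * (Real.cos (2 * z) : ℝ) + (p ^ e l) ^ 2))
    (fun R h0 h1 => ?_) (fun p hp => ?_)
  · have hk : ∀ (l : ℕ) (p : ℂ), p ∈ Metric.ball (0 : ℂ) R → ‖p ^ e l‖ ≤ R ^ (l + 1) :=
      fun l p hp => by
      have : ‖p‖ ≤ R := by simpa using (Metric.mem_ball.1 hp).le
      rw [norm_pow]
      exact (pow_le_pow_left₀ (norm_nonneg _) this _).trans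
        (pow_le_pow_of_le_one h0 h1.le (he l))
    have hR2 : ∀ l : ℕ, R ^ (l + 1) ≤ R := fun l => pow_le_of_le_one h0 h1.le (by omega)
    have hR1 : 0 < 1 - R := by linarith
    have hq : ∀ (l : ℕ) (p : ℂ), p ∈ Metric.ball (0 : ℂ) R → (1 - R) ^ 2 ≤
        ‖1 - 2 * p ^ e l * (Real.cos (2 * z) : ℝ) + (p ^ e l) ^ 2‖ := fun l p hp => by
      have h3 := (hk l p hp).trans (hR2 l)
      refine le_trans ?_ (norm_quad_ge (h3.trans h1.le) z)
      have : 1 - R ≤ 1 - ‖p ^ e l‖ := by linarith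
      gcongr
    refine Complex.differentiableOn_tsum_of_summable_norm
      ((summable_pow_succ h0 h1).mul_left (4 / (1 - R) ^ 2)) (fun l => ?_)
      Metric.isOpen_ball (fun l p hp => ?_)
    · refine DifferentiableOn.div (by fun_prop) (by fun_prop) (fun p hp => ?_)
      rw [← norm_pos_iff]
      exact lt_of_lt_of_le (by positivity) (hq l p hp)
    · rw [norm_div, norm_mul, norm_mul, Complex.norm_real]
      have h4 : ‖(4 : ℂ)‖ = 4 := by simp
      rw [h4]
      calc 4 * ‖p ^ e l‖ * ‖Real.sin (2 * z)‖ /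
            ‖1 - 2 * p ^ e l * (Real.cos (2 * z) : ℝ) + (p ^ e l) ^ 2‖
          ≤ 4 * R ^ (l + 1) * 1 / (1 - R) ^ 2 := by
            gcongr
            · exact hk l p hp
            · exact Real.abs_sin_le_one _
            · exact hq l p hp
        _ = _ := by ring
  · rw [qsum, Complex.ofReal_tsum]
    congr 1
    ext l
    simp only [quadFactor]
    push_cast
    rfl

theorem quadFactor_neg (q z : ℝ) : quadFactor q (-z) = quadFactor q z := by
  simp [quadFactor]

theorem quadFactor_add_pi (q z : ℝ) : quadFactor q (z + Real.pi) = quadFactor q z := by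
  simp [quadFactor, mul_add]

theorem qprod_neg (e : ℕ → ℕ) (p z : ℝ) : qprod e p (-z) = qprod e p z := by
  simp [qprod, quadFactor_neg]

theorem qprod_add_pi (e : ℕ → ℕ) (p z : ℝ) : qprod e p (z + Real.pi) = qprod e p z := by
  simp [qprod, quadFactor_add_pi]

theorem qprod_zero {e : ℕ → ℕ} (he : ∀ l, l + 1 ≤ e l) (z : ℝ) : qprod e 0 z = 1 := by
  have h : ∀ l, e l ≠ 0 := fun l => by have := he l; omega
  simp [qprod, quadFactor, h]

/-! ### Theta functions -/

/-- Exponents of the products for `ϑ₁, ϑ₂`. -/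
def evenExp (l : ℕ) : ℕ := 2 * (l + 1)

/-- Exponents of the products for `ϑ₃, ϑ₄`. -/
def oddExp (l : ℕ) : ℕ := 2 * l + 1

theorem le_evenExp (l : ℕ) : l + 1 ≤ evenExp l := by unfold evenExp; omega

theorem le_oddExp (l : ℕ) : l + 1 ≤ oddExp l := by unfold oddExp; omega

/-- The sign change under a quarter-period shift yields all four theta functions from only two
families of products. -/
theorem cos_two_mul_shift (z : ℝ) : Real.cos (2 * (z + Real.pi / 2)) = -Real.cos (2 * z) := by
  rw [mul_add, mul_div_cancel₀ _ two_ne_zero, Real.cos_add_pi]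

theorem theta_zero (p z : ℝ) : theta p 0 z = Real.sin z * qprod evenExp p z := by
  simp only [theta, qprod, quadFactor, evenExp, Matrix.cons_val_zero]
  congr 1
  refine tprod_congr fun l => ?_
  ring

theorem theta_one (p z : ℝ) : theta p 1 z = Real.cos z * qprod evenExp p (z + Real.pi / 2) := by
  simp only [theta, qprod, quadFactor, evenExp, Matrix.cons_val_one, cos_two_mul_shift]
  refine congrArg (Real.cos z * ·) (tprod_congr fun l => ?_)
  ring

theorem theta_two (p z : ℝ) : theta p 2 z = qprod oddExp p (z + Real.pi / 2) := by
  simp only [theta, qprod, quadFactor, oddExp, Matrix.cons_val, cos_two_mul_shift]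
  refine tprod_congr fun l => ?_
  ring

theorem theta_three (p z : ℝ) : theta p 3 z = qprod oddExp p z := by
  simp only [theta, qprod, quadFactor, oddExp, Matrix.cons_val]
  refine tprod_congr fun l => ?_
  ring

theorem theta_one_eq_theta_zero (p z : ℝ) : theta p 1 z = theta p 0 (z + Real.pi / 2) := by
  rw [theta_one, theta_zero, Real.sin_add_pi_div_two]

/-- The derivatives of the theta functions. -/
def dtheta (p : ℝ) : Fin 4 → ℝ → ℝ :=
  ![fun z => qprod evenExp p z * (Real.cos z + Real.sin z * qsum evenExp p z),
    fun z => qprod evenExp p (z + Real.pi / 2) *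
      (-Real.sin z + Real.cos z * qsum evenExp p (z + Real.pi / 2)),
    fun z => qprod oddExp p (z + Real.pi / 2) * qsum oddExp p (z + Real.pi / 2),
    fun z => qprod oddExp p z * qsum oddExp p z]

theorem hasDerivAt_theta {p : ℝ} (hp : |p| < 1) (r : Fin 4) (z : ℝ) :
    HasDerivAt (theta p r) (dtheta p r z) z := by
  have h0 : ∀ z, HasDerivAt (theta p 0) (dtheta p 0 z) z := fun z => by
    have := (Real.hasDerivAt_sin z).mul (hasDerivAt_qprod le_evenExp hp z)
    convert! this using 1
    · ext y; exact theta_zero p y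
    · simp [dtheta]; ring
  have h3 : ∀ z, HasDerivAt (theta p 3) (dtheta p 3 z) z := fun z => by
    have := hasDerivAt_qprod le_oddExp hp z
    convert! this using 1
    ext y; exact theta_three p y
  match r with
  | 0 => exact h0 z
  | 1 =>
    have := (h0 (z + Real.pi / 2)).comp_add_const
    convert! this using 1
    · ext y; exact theta_one_eq_theta_zero p y
    · simp [dtheta, Real.cos_add_pi_div_two, Real.sin_add_pi_div_two]
  | 2 =>
    have := (h3 (z + Real.pi / 2)).comp_add_const
    convert! this using 1
    ext y; rw [theta_two, theta_three]
  | 3 => exact h3 z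

theorem continuous_qprod {e : ℕ → ℕ} (he : ∀ l, l + 1 ≤ e l) {p : ℝ} (hp : |p| < 1) :
    Continuous (qprod e p) :=
  continuous_iff_continuousAt.2 fun z => (hasDerivAt_qprod he hp z).continuousAt

theorem continuous_theta {p : ℝ} (hp : |p| < 1) (r : Fin 4) : Continuous (theta p r) :=
  continuous_iff_continuousAt.2 fun z => (hasDerivAt_theta hp r z).continuousAt

theorem continuous_dtheta {p : ℝ} (hp : |p| < 1) (r : Fin 4) : Continuous (dtheta p r) := by
  have h1 := continuous_qprod le_evenExp hp
  have h2 := continuous_qprod le_oddExp hp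
  have h3 := continuous_qsum le_evenExp hp
  have h4 := continuous_qsum le_oddExp hp
  match r with
  | 0 => show Continuous fun z => _; simp only [dtheta, Matrix.cons_val]; fun_prop
  | 1 => show Continuous fun z => _; simp only [dtheta, Matrix.cons_val]; fun_prop
  | 2 => show Continuous fun z => _; simp only [dtheta, Matrix.cons_val]; fun_prop
  | 3 => show Continuous fun z => _; simp only [dtheta, Matrix.cons_val]; fun_prop

theorem deriv_theta {p : ℝ} (hp : |p| < 1) (r : Fin 4) : deriv (theta p r) = dtheta p r :=
  funext fun z => (hasDerivAt_theta hp r z).deriv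

/-- Strictness is needed because in the limit `g → 1` the base point moves together with the
increment. -/
theorem hasStrictDerivAt_theta {p : ℝ} (hp : |p| < 1) (r : Fin 4) (z : ℝ) :
    HasStrictDerivAt (theta p r) (dtheta p r z) z :=
  hasStrictDerivAt_of_hasDerivAt_of_continuousAt
    (Eventually.of_forall fun y => hasDerivAt_theta hp r y) (continuous_dtheta hp r).continuousAt

theorem analyticOnNhd_theta (r : Fin 4) (z : ℝ) :
    AnalyticOnNhd ℝ (fun p => theta p r z) (Set.Ioo (-1) 1) := by
  match r with
  | 0 => simp only [theta_zero]; exact analyticOnNhd_const.mul (analyticOnNhd_qprod le_evenExp _)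
  | 1 => simp only [theta_one]; exact analyticOnNhd_const.mul (analyticOnNhd_qprod le_evenExp _)
  | 2 => simp only [theta_two]; exact analyticOnNhd_qprod le_oddExp _
  | 3 => simp only [theta_three]; exact analyticOnNhd_qprod le_oddExp _

theorem analyticOnNhd_dtheta (r : Fin 4) (z : ℝ) :
    AnalyticOnNhd ℝ (fun p => dtheta p r z) (Set.Ioo (-1) 1) := by
  have h1 := analyticOnNhd_qprod le_evenExp
  have h2 := analyticOnNhd_qprod le_oddExp
  have h3 := analyticOnNhd_qsum le_evenExp
  have h4 := analyticOnNhd_qsum le_oddExp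
  match r with
  | 0 => exact (h1 z).mul (analyticOnNhd_const.add (analyticOnNhd_const.mul (h3 z)))
  | 1 => exact (h1 _).mul (analyticOnNhd_const.add (analyticOnNhd_const.mul (h3 _)))
  | 2 => exact (h2 _).mul (h4 _)
  | 3 => exact (h2 _).mul (h4 _)

theorem theta_zero_neg (p z : ℝ) : theta p 0 (-z) = -theta p 0 z := by
  simp [theta_zero, qprod_neg]


theorem theta_zero_pos {p z : ℝ} (hp : |p| < 1) (h0 : 0 < z) (h1 : z < Real.pi) :
    0 < theta p 0 z := by
  rw [theta_zero]
  exact mul_pos (Real.sin_pos_of_pos_of_lt_pi h0 h1) (qprod_pos le_evenExp hp _)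

theorem theta_one_pos {p z : ℝ} (hp : |p| < 1) (h0 : -(Real.pi / 2) < z) (h1 : z < Real.pi / 2) :
    0 < theta p 1 z := by
  rw [theta_one_eq_theta_zero]
  exact theta_zero_pos hp (by linarith) (by linarith)

theorem theta_two_pos {p : ℝ} (hp : |p| < 1) (z : ℝ) : 0 < theta p 2 z := by
  rw [theta_two]; exact qprod_pos le_oddExp hp _

theorem theta_three_pos {p : ℝ} (hp : |p| < 1) (z : ℝ) : 0 < theta p 3 z := by
  rw [theta_three]; exact qprod_pos le_oddExp hp _

theorem dtheta_zero_zero_pos {p : ℝ} (hp : |p| < 1) : 0 < dtheta p 0 0 := by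
  simpa [dtheta] using qprod_pos le_evenExp hp 0

theorem theta_one_pi_div_two_sub (p z : ℝ) : theta p 1 (Real.pi / 2 - z) = theta p 0 z := by
  rw [theta_one, theta_zero, Real.cos_pi_div_two_sub,
    show Real.pi / 2 - z + Real.pi / 2 = -z + Real.pi by ring, qprod_add_pi, qprod_neg]


/-! ### Rescaled theta functions -/

/-- The normalizing constant of `br`. -/
def brNorm (α p : ℝ) (r : Fin 4) : ℝ :=
  if r = 0 then Real.sin (α / 2) * dtheta p 0 0 else theta p r 0

/-- The derivative of `br`. -/
def dbr (α p : ℝ) (r : Fin 4) (z : ℝ) : ℝ := α / 2 * dtheta p r (α / 2 * z) / brNorm α p r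

section
variable {p : ℝ} (hp : |p| < 1)
include hp

theorem br_eq (α : ℝ) (r : Fin 4) (z : ℝ) :
    br α p r z = theta p r (α / 2 * z) / brNorm α p r := by
  unfold br brNorm
  split_ifs with h
  · subst h; rw [deriv_theta hp]
  · rfl

theorem brNorm_pos {α : ℝ} (h0 : 0 < α) (h1 : α < 2 * Real.pi) (r : Fin 4) :
    0 < brNorm α p r := by
  have h := Real.pi_pos
  match r with
  | 0 =>
    exact mul_pos (Real.sin_pos_of_pos_of_lt_pi (by linarith) (by linarith))
      (dtheta_zero_zero_pos hp)
  | 1 => exact theta_one_pos hp (by linarith) (by linarith)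
  | 2 => exact theta_two_pos hp _
  | 3 => exact theta_three_pos hp _

theorem hasDerivAt_br (α : ℝ) (r : Fin 4) (z : ℝ) :
    HasDerivAt (br α p r) (dbr α p r z) z := by
  have h := ((hasDerivAt_theta hp r (α / 2 * z)).comp z
    ((hasDerivAt_id z).const_mul (α / 2))).div_const (brNorm α p r)
  convert! h using 1
  · ext y; exact br_eq hp α r y
  · unfold dbr; ring

theorem deriv_br (α : ℝ) (r : Fin 4) : deriv (br α p r) = dbr α p r :=
  funext fun z => (hasDerivAt_br hp α r z).deriv

variable {X : Type*} {F : Filter X} {a z h : X → ℝ} {α z₀ : ℝ}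

omit hp in
theorem tendsto_brNorm (ha : Tendsto a F (𝓝 α)) (r : Fin 4) :
    Tendsto (fun x => brNorm (a x) p r) F (𝓝 (brNorm α p r)) := by
  unfold brNorm
  split_ifs
  · exact ((Real.continuous_sin.tendsto _).comp (ha.div_const 2)).mul_const _
  · exact tendsto_const_nhds

theorem tendsto_br (h0 : 0 < α) (h1 : α < 2 * Real.pi) (ha : Tendsto a F (𝓝 α))
    (hz : Tendsto z F (𝓝 z₀)) (r : Fin 4) :
    Tendsto (fun x => br (a x) p r (z x)) F (𝓝 (br α p r z₀)) := by
  simp only [br_eq hp]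
  exact (((continuous_theta hp r).tendsto _).comp ((ha.div_const 2).mul hz)).div
    (tendsto_brNorm ha r) (brNorm_pos hp h0 h1 r).ne'

theorem tendsto_dbr (h0 : 0 < α) (h1 : α < 2 * Real.pi) (ha : Tendsto a F (𝓝 α))
    (hz : Tendsto z F (𝓝 z₀)) (r : Fin 4) :
    Tendsto (fun x => dbr (a x) p r (z x)) F (𝓝 (dbr α p r z₀)) :=
  ((ha.div_const 2).mul (((continuous_dtheta hp r).tendsto _).comp
    ((ha.div_const 2).mul hz))).div (tendsto_brNorm ha r) (brNorm_pos hp h0 h1 r).ne'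

omit hp in
theorem _root_.HasStrictDerivAt.tendsto_divided_difference {f : ℝ → ℝ} {f' : ℝ}
    (hf : HasStrictDerivAt f f' z₀) (hz : Tendsto z F (𝓝 z₀)) (hh : Tendsto h F (𝓝 0))
    (hne : ∀ᶠ x in F, h x ≠ 0) :
    Tendsto (fun x => (f (z x + h x) - f (z x)) / h x) F (𝓝 f') := by
  have h1 : Tendsto (fun x => (z x + h x, z x)) F (𝓝 (z₀, z₀)) := by
    have := (hz.add hh).prodMk_nhds hz
    simpa using this
  have h2 := (hf.isLittleO.comp_tendsto h1)
  have h3 : Tendsto (fun x => (f (z x + h x) - f (z x) - h x * f') / h x) F (𝓝 0) := by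
    have := h2.tendsto_div_nhds_zero
    simpa [Function.comp_def] using this
  have h4 := h3.add_const f'
  rw [zero_add] at h4
  refine h4.congr' ?_
  filter_upwards [hne] with x hx
  field_simp
  ring

/-- The scale `α` moves too, so the quotient is formed for the fixed function `theta` at `α z / 2`
with increment `α h / 2`. -/
theorem tendsto_br_slope (h0 : 0 < α) (h1 : α < 2 * Real.pi) (ha : Tendsto a F (𝓝 α))
    (hz : Tendsto z F (𝓝 z₀)) (hh : Tendsto h F (𝓝 0)) (hne : ∀ᶠ x in F, h x ≠ 0) (r : Fin 4) :
    Tendsto (fun x => (br (a x) p r (z x + h x) - br (a x) p r (z x)) / h x) F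
      (𝓝 (dbr α p r z₀)) := by
  have hpos : ∀ᶠ x in F, 0 < a x := ha.eventually_const_lt h0
  have h2 := (hasStrictDerivAt_theta hp r (α / 2 * z₀)).tendsto_divided_difference
    ((ha.div_const 2).mul hz) (h := fun x => a x / 2 * h x)
    (by simpa using (ha.div_const 2).mul hh)
    (by filter_upwards [hne, hpos] with x hx hx'
        exact mul_ne_zero (by positivity) hx)
  have h3 := ((ha.div_const 2).mul h2).div (tendsto_brNorm ha r) (brNorm_pos hp h0 h1 r).ne'
  refine h3.congr' ?_
  filter_upwards [hne, hpos] with x hx hx'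
  rw [br_eq hp, br_eq hp, mul_add]
  simp only [Pi.div_apply]
  field_simp

end

theorem br_zero_neg (α p z : ℝ) : br α p 0 (-z) = -br α p 0 z := by
  simp [br, theta_zero_neg, neg_div]

theorem br_zero_zero (α p : ℝ) : br α p 0 0 = 0 := by
  simp [br, theta_zero]

theorem br_one_one {p : ℝ} (hp : |p| < 1) {α : ℝ} (h0 : 0 < α) (h1 : α < 2 * Real.pi) :
    0 < br α p 0 1 := by
  rw [br_eq hp]
  exact div_pos (theta_zero_pos hp (by linarith) (by linarith)) (brNorm_pos hp h0 h1 0)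

section
variable {p : ℝ} (hp : |p| < 1) {T : ℝ} (hT : 1 < T)
include hT

theorem pi_div_pos : 0 < Real.pi / T := div_pos Real.pi_pos (by linarith)

theorem pi_div_lt : Real.pi / T < 2 * Real.pi := by
  have := Real.pi_pos
  rw [div_lt_iff₀ (by linarith)]
  nlinarith

include hp

/-- With `α = π / T`, the real zeros of `[·]_1` are the multiples of `2T` and those of `[·]_2` the
odd multiples of `T`; `[·]_3` and `[·]_4` have none. All positivity statements keep the argument
between consecutive zeros. -/
theorem br_zero_pos {z : ℝ} (h0 : 0 < z) (h1 : z < 2 * T) : 0 < br (Real.pi / T) p 0 z := by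
  have := Real.pi_pos
  have hT0 : 0 < T := by linarith
  rw [br_eq hp]
  refine div_pos (theta_zero_pos hp (by positivity) ?_)
    (brNorm_pos hp (pi_div_pos hT) (pi_div_lt hT) 0)
  rw [div_div, div_mul_eq_mul_div, div_lt_iff₀ (by linarith)]
  nlinarith

theorem br_zero_ne_zero {z : ℝ} (h : z ≠ 0) (h0 : -(2 * T) < z) (h1 : z < 2 * T) :
    br (Real.pi / T) p 0 z ≠ 0 := by
  rcases lt_or_gt_of_ne h with h | h
  · have := br_zero_pos hp hT (z := -z) (by linarith) (by linarith)
    rw [br_zero_neg] at this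
    linarith
  · exact (br_zero_pos hp hT h h1).ne'

theorem br_one_pos {z : ℝ} (h0 : -T < z) (h1 : z < T) : 0 < br (Real.pi / T) p 1 z := by
  have := Real.pi_pos
  have hT0 : 0 < T := by linarith
  rw [br_eq hp]
  refine div_pos (theta_one_pos hp ?_ ?_)
    (brNorm_pos hp (pi_div_pos hT) (pi_div_lt hT) 1)
  · rw [← neg_div, div_div, div_mul_eq_mul_div, div_lt_div_iff₀ (by linarith) (by linarith)]
    nlinarith
  · rw [div_div, div_mul_eq_mul_div, div_lt_div_iff₀ (by linarith) (by linarith)]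
    nlinarith

theorem br_two_pos (z : ℝ) : 0 < br (Real.pi / T) p 2 z := by
  rw [br_eq hp]
  exact div_pos (theta_two_pos hp _) (brNorm_pos hp (pi_div_pos hT) (pi_div_lt hT) 2)

theorem br_three_pos (z : ℝ) : 0 < br (Real.pi / T) p 3 z := by
  rw [br_eq hp]
  exact div_pos (theta_three_pos hp _) (brNorm_pos hp (pi_div_pos hT) (pi_div_lt hT) 3)

/-- Reflection in the half period exchanges `ϑ₁` and `ϑ₂`. It exposes the factor `[g_2 - 1/2]_1` at
the right end of the chain. -/
theorem br_one_sub (z : ℝ) : br (Real.pi / T) p 1 (T - z) =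
    br (Real.pi / T) p 0 z * (brNorm (Real.pi / T) p 0 / brNorm (Real.pi / T) p 1) := by
  have hn := (brNorm_pos hp (pi_div_pos hT) (pi_div_lt hT) 0).ne'
  have h : Real.pi / T / 2 * (T - z) = Real.pi / 2 - Real.pi / T / 2 * z := by
    have : T ≠ 0 := by linarith
    field_simp
  rw [br_eq hp, br_eq hp, h, theta_one_pi_div_two_sub]
  field_simp

/-- All `[z]_r` are positive for `0 < z < T`. -/
theorem br_pos {z : ℝ} (h0 : 0 < z) (h1 : z < T) (r : Fin 4) : 0 < br (Real.pi / T) p r z := by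
  match r with
  | 0 => exact br_zero_pos hp hT h0 (by linarith)
  | 1 => exact br_one_pos hp hT (by linarith) h1
  | 2 => exact br_two_pos hp hT z
  | 3 => exact br_three_pos hp hT z

theorem br_one_T : br (Real.pi / T) p 1 T = 0 := by
  have := br_one_sub hp hT 0
  rwa [br_zero_zero, zero_mul, sub_zero] at this

end

theorem brNorm_ne_zero_of_mem {p : ℝ} (hp : p ∈ Set.Ioo (-1 : ℝ) 1) {T : ℝ} (hT : 1 < T)
    (r : Fin 4) : brNorm (Real.pi / T) p r ≠ 0 :=
  (brNorm_pos (abs_lt.2 hp) (pi_div_pos hT) (pi_div_lt hT) r).ne'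

theorem analyticOnNhd_brNorm (α : ℝ) (r : Fin 4) :
    AnalyticOnNhd ℝ (fun p => brNorm α p r) (Set.Ioo (-1) 1) := by
  unfold brNorm
  split_ifs
  · exact analyticOnNhd_const.mul (analyticOnNhd_dtheta 0 0)
  · exact analyticOnNhd_theta r 0

theorem analyticOnNhd_br {T : ℝ} (hT : 1 < T) (r : Fin 4) (z : ℝ) :
    AnalyticOnNhd ℝ (fun p => br (Real.pi / T) p r z) (Set.Ioo (-1) 1) := by
  refine AnalyticOnNhd.congr isOpen_Ioo ((analyticOnNhd_theta r _).div (analyticOnNhd_brNorm _ r)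
    (fun p hp => brNorm_ne_zero_of_mem hp hT r))
    (fun p hp => (br_eq (abs_lt.2 hp) (Real.pi / T) r z).symm)

theorem analyticOnNhd_dbr {T : ℝ} (hT : 1 < T) (r : Fin 4) (z : ℝ) :
    AnalyticOnNhd ℝ (fun p => dbr (Real.pi / T) p r z) (Set.Ioo (-1) 1) :=
  (analyticOnNhd_const.mul (analyticOnNhd_dtheta r _)).div (analyticOnNhd_brNorm _ r)
    (fun _ hp => brNorm_ne_zero_of_mem hp hT r)

theorem dbr_zero_zero_ne {p : ℝ} (hp : |p| < 1) {T : ℝ} (hT : 1 < T) :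
    dbr (Real.pi / T) p 0 0 ≠ 0 := by
  have h1 := pi_div_pos hT
  have h2 := dtheta_zero_zero_pos hp
  have h3 := brNorm_pos hp h1 (pi_div_lt hT) 0
  simp only [dbr, mul_zero]
  positivity


/-! ### Partitions and nodes -/

theorem mem_Lam {n m : ℕ} {l : Fin n → ℤ} :
    l ∈ Lam n m ↔ (∀ j, 0 ≤ l j ∧ l j ≤ m) ∧ Antitone l := by
  simp only [Lam, Finset.mem_filter, Finset.mem_Icc, Pi.le_def, Pi.zero_apply]
  refine and_congr_left fun _ => ⟨fun h j => ⟨h.1 j, h.2 j⟩, fun h => ⟨fun j => (h j).1, fun j => (h j).2⟩⟩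

/-- `node` is built with truncated subtraction and `toNat`; for a nonnegative part neither
truncates. -/
theorem node_int {n : ℕ} {l : Fin n → ℤ} {j : Fin n} (h : 0 ≤ l j) :
    (node n l j : ℤ) = (n : ℤ) - 1 - j + l j := by
  have := j.isLt
  unfold node
  omega

theorem node_real {n : ℕ} {l : Fin n → ℤ} {j : Fin n} (h : 0 ≤ l j) :
    (node n l j : ℝ) = (n : ℝ) - 1 - (j : ℕ) + l j := by
  have := congrArg (Int.cast : ℤ → ℝ) (node_int h)
  push_cast at this
  exact this

theorem node_lt {n m : ℕ} {l : Fin n → ℤ} (h : l ∈ Lam n m) (j : Fin n) :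
    node n l j < n + m := by
  have h1 := (mem_Lam.1 h).1 j
  have := node_int h1.1
  have := j.isLt
  omega

/-! ### The half period -/

/-- `π / α` at coupling `g`. -/
def halfPeriod (n m : ℕ) (g : ℝ) (G : Fin 4 → ℝ) : ℝ := m + ((n : ℝ) - 1) * g + G 0 + G 1

theorem alpha_eq (n m : ℕ) (g : ℝ) (G : Fin 4 → ℝ) :
    alpha n m g G = Real.pi / halfPeriod n m g G := rfl

theorem halfPeriod_one (n m : ℕ) (G : Fin 4 → ℝ) :
    halfPeriod n m 1 G = ((n + m : ℕ) : ℝ) - 1 + G 0 + G 1 := by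
  unfold halfPeriod; push_cast; ring

theorem one_lt_halfPeriod {n m : ℕ} (hn : 1 ≤ n) (hm : 1 ≤ m) {G : Fin 4 → ℝ} (hG0 : 0 < G 0)
    (hG1 : 0 < G 1) : 1 < halfPeriod n m 1 G := by
  rw [halfPeriod_one]
  have : (2 : ℝ) ≤ ((n + m : ℕ) : ℝ) := by exact_mod_cast (by omega : 2 ≤ n + m)
  linarith

/-! ### Removable singularities of the diagonal coefficients -/

/-- `c_1` without its constant prefactor and the factor `[g_1 - 1/2]_1`. -/
def cRestZero (α p : ℝ) (G G' : Fin 4 → ℝ) : ℝ :=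
  br α p 0 (G' 0) * (br α p 1 (G 1 - 1 / 2) * br α p 1 (G' 1)) *
    (br α p 2 (G 2 - 1 / 2) * br α p 2 (G' 2)) * (br α p 3 (G 3 - 1 / 2) * br α p 3 (G' 3))

/-- `c_2` without its constant prefactor and the factor `[g_2 - 1/2]_1`. -/
def cRestOne (α p : ℝ) (G G' : Fin 4 → ℝ) : ℝ :=
  br α p 0 (G' 1) * (br α p 1 (G 0 - 1 / 2) * br α p 1 (G' 0)) *
    (br α p 2 (G 3 - 1 / 2) * br α p 2 (G' 3)) * (br α p 3 (G 2 - 1 / 2) * br α p 3 (G' 2))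

theorem klein_one_apply : klein 1 0 = 1 ∧ klein 1 1 = 0 ∧ klein 1 2 = 3 ∧ klein 1 3 = 2 := by
  unfold klein; decide

theorem cNum_zero (α p : ℝ) (G G' : Fin 4 → ℝ) :
    cNum α p G G' 0 = br α p 0 (G 0 - 1 / 2) * cRestZero α p G G' := by
  simp only [cNum, cRestZero, Fin.prod_univ_four, klein, Matrix.cons_val_zero, Equiv.Perm.one_apply]
  ring

theorem cNum_one (α p : ℝ) (G G' : Fin 4 → ℝ) :
    cNum α p G G' 1 = br α p 0 (G 1 - 1 / 2) * cRestOne α p G G' := by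
  obtain ⟨h0, h1, h2, h3⟩ := klein_one_apply
  simp only [cNum, cRestOne, Fin.prod_univ_four, h0, h1, h2, h3]
  ring

/-- The regular part `∏_s [g_{π_r(s)} - 1/2]_s [g'_{π_r(s)}]_s / ([u]_r [u+1]_r)` with
`u = g_1 + k - 1/2`, continued to the removable singularities. -/
def regCoeff (N : ℕ) (α p : ℝ) (G G' : Fin 4 → ℝ) (k : ℕ) (r : Fin 4) : ℝ :=
  if r = 0 ∧ k = 0 then cRestZero α p G G' / br α p 0 (G 0 + k + 1 / 2)
  -- At the right end `[u+1]_2` is `[g_2 - 1/2]_1` times the quotient of norms from `br_one_sub`;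
  -- the factor `[g_2 - 1/2]_1` has been cancelled.
  else if r = 1 ∧ k + 1 = N then
    cRestOne α p G G' / (brNorm α p 0 / brNorm α p 1) / br α p 1 (G 0 + k - 1 / 2)
  else cNum α p G G' r / (br α p r (G 0 + k - 1 / 2) * br α p r (G 0 + k + 1 / 2))

/-- The `r`-th term of the coefficient `a_k`, continued to the removable singularities. -/
def racahTerm (N : ℕ) (α p : ℝ) (G G' : Fin 4 → ℝ) (k : ℕ) (r : Fin 4) : ℝ :=
  -- The difference of logarithmic derivatives at `u + 1` and `u`, multiplied by `[u]_r [u+1]_r`, is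
  -- this regular Wronskian; the division is carried by `regCoeff`.
  2 / (br α p 0 1 * dbr α p 0 0) * (regCoeff N α p G G' k r *
    (br α p r (G 0 + k - 1 / 2) * dbr α p r (G 0 + k + 1 / 2) -
      dbr α p r (G 0 + k - 1 / 2) * br α p r (G 0 + k + 1 / 2)))

section
variable {p : ℝ} (hp : |p| < 1) {N : ℕ} (hN : 2 ≤ N) {G G' : Fin 4 → ℝ}
  (hG0 : 0 < G 0) (hG1 : 0 < G 1) {T₀ : ℝ} (hT₀ : T₀ = (N : ℝ) - 1 + G 0 + G 1)
include hp hN hG0 hG1 hT₀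

/-- In the excluded case the value is `[g_1 - 1/2]_1`, which vanishes at `g_1 = 1/2`. -/
theorem br_sub_half_ne {k : ℕ} (hk : k < N) {r : Fin 4} (h : ¬(r = 0 ∧ k = 0)) :
    br (Real.pi / T₀) p r (G 0 + k - 1 / 2) ≠ 0 := by
  have hN' : (2 : ℝ) ≤ N := by exact_mod_cast hN
  have hk' : (k : ℝ) + 1 ≤ N := by exact_mod_cast hk
  have hk0 : (0 : ℝ) ≤ k := k.cast_nonneg
  have hT : 1 < T₀ := by linarith
  match r with
  | 0 =>
    have : 1 ≤ k := Nat.one_le_iff_ne_zero.2 (by simpa using h)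
    have : (1 : ℝ) ≤ k := by exact_mod_cast this
    exact (br_zero_pos hp hT (by linarith) (by linarith)).ne'
  | 1 => exact (br_one_pos hp hT (by linarith) (by linarith)).ne'
  | 2 => exact (br_two_pos hp hT _).ne'
  | 3 => exact (br_three_pos hp hT _).ne'

/-- In the excluded case the argument is `T₀ - (g_2 - 1/2)`, where `[·]_2` vanishes for `g_2 = 1/2`.
-/
theorem br_add_half_ne {k : ℕ} (hk : k < N) {r : Fin 4} (h : ¬(r = 1 ∧ k + 1 = N)) :
    br (Real.pi / T₀) p r (G 0 + k + 1 / 2) ≠ 0 := by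
  have hN' : (2 : ℝ) ≤ N := by exact_mod_cast hN
  have hk' : (k : ℝ) + 1 ≤ N := by exact_mod_cast hk
  have hk0 : (0 : ℝ) ≤ k := k.cast_nonneg
  have hT : 1 < T₀ := by linarith
  match r with
  | 0 => exact (br_zero_pos hp hT (by linarith) (by linarith)).ne'
  | 1 =>
    have : k + 2 ≤ N := by
      have : k + 1 ≠ N := by simpa using h
      omega
    have : (k : ℝ) + 2 ≤ N := by exact_mod_cast this
    exact (br_one_pos hp hT (by linarith) (by linarith)).ne'
  | 2 => exact (br_two_pos hp hT _).ne'
  | 3 => exact (br_three_pos hp hT _).ne'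

variable {X : Type*} {F : Filter X} {T u h : X → ℝ} {H H' : X → Fin 4 → ℝ}
  (hT : Tendsto T F (𝓝 T₀)) (hH : ∀ i, Tendsto (fun x => H x i) F (𝓝 (G i)))
  (hH' : ∀ i, Tendsto (fun x => H' x i) F (𝓝 (G' i)))
include hT

omit hp in
theorem tendsto_pi_div : Tendsto (fun x => Real.pi / T x) F (𝓝 (Real.pi / T₀)) := by
  have hN' : (2 : ℝ) ≤ N := by exact_mod_cast hN
  exact tendsto_const_nhds.div hT (by linarith)

theorem tendsto_br_pi_div {z : X → ℝ} {z₀ : ℝ} (hz : Tendsto z F (𝓝 z₀)) (r : Fin 4) :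
    Tendsto (fun x => br (Real.pi / T x) p r (z x)) F (𝓝 (br (Real.pi / T₀) p r z₀)) := by
  have hN' : (2 : ℝ) ≤ N := by exact_mod_cast hN
  have hT1 : 1 < T₀ := by linarith
  exact tendsto_br hp (pi_div_pos hT1) (pi_div_lt hT1) (tendsto_pi_div hN hG0 hG1 hT₀ hT) hz r

include hH hH'

/-- The numerator of `c_r` contains `[g_1 - 1/2]_1` for `r = 0` and `[g_2 - 1/2]_1` for `r = 1`,
which cancel the only denominators that can tend to zero. The identities `h0`, `h1` make this
cancellation exact along the filter. The filter is arbitrary because the same factorization serves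
the limit defining `a_k` and the joint limit of `H`. -/
theorem exists_regular_coeff {k : ℕ} (hk : k < N) (r : Fin 4)
    (hu : Tendsto u F (𝓝 (G 0 + k - 1 / 2)))
    (h0 : k = 0 → ∀ᶠ x in F, u x = H x 0 - 1 / 2)
    (h1 : k + 1 = N → ∀ᶠ x in F, u x + 1 = T x - (H x 1 - 1 / 2))
    (hne0 : ∀ᶠ x in F, H x 0 ≠ 1 / 2) (hne1 : ∀ᶠ x in F, H x 1 ≠ 1 / 2) :
    ∃ c : X → ℝ, Tendsto c F (𝓝 (regCoeff N (Real.pi / T₀) p G G' k r)) ∧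
      ∀ᶠ x in F, br (Real.pi / T x) p r (u x) ≠ 0 ∧ br (Real.pi / T x) p r (u x + 1) ≠ 0 ∧
        cNum (Real.pi / T x) p (H x) (H' x) r =
          c x * (br (Real.pi / T x) p r (u x) * br (Real.pi / T x) p r (u x + 1)) := by
  have hN' : (2 : ℝ) ≤ N := by exact_mod_cast hN
  have hT1 : 1 < T₀ := by linarith
  have hbr : ∀ {z : X → ℝ} {z₀ : ℝ}, Tendsto z F (𝓝 z₀) → ∀ r, Tendsto
      (fun x => br (Real.pi / T x) p r (z x)) F (𝓝 (br (Real.pi / T₀) p r z₀)) :=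
    fun hz r => tendsto_br_pi_div hp hN hG0 hG1 hT₀ hT hz r
  have hTx : ∀ᶠ x in F, 1 < T x := hT.eventually_const_lt hT1
  have hu1 : Tendsto (fun x => u x + 1) F (𝓝 (G 0 + k + 1 / 2)) := by
    convert hu.add_const 1 using 2; ring
  have hc0 : Tendsto (fun x => cRestZero (Real.pi / T x) p (H x) (H' x)) F
      (𝓝 (cRestZero (Real.pi / T₀) p G G')) :=
    (((hbr (hH' 0) 0).mul ((hbr ((hH 1).sub_const _) 1).mul (hbr (hH' 1) 1))).mul
      ((hbr ((hH 2).sub_const _) 2).mul (hbr (hH' 2) 2))).mul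
      ((hbr ((hH 3).sub_const _) 3).mul (hbr (hH' 3) 3))
  have hc1 : Tendsto (fun x => cRestOne (Real.pi / T x) p (H x) (H' x)) F
      (𝓝 (cRestOne (Real.pi / T₀) p G G')) :=
    (((hbr (hH' 1) 0).mul ((hbr ((hH 0).sub_const _) 1).mul (hbr (hH' 0) 1))).mul
      ((hbr ((hH 3).sub_const _) 2).mul (hbr (hH' 3) 2))).mul
      ((hbr ((hH 2).sub_const _) 3).mul (hbr (hH' 2) 3))
  by_cases hr0 : r = 0 ∧ k = 0
  · have hreg := br_add_half_ne hp hN hG0 hG1 hT₀ hk (r := r) (by rw [hr0.1]; simp)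
    refine ⟨fun x => cRestZero (Real.pi / T x) p (H x) (H' x) / br (Real.pi / T x) p 0 (u x + 1),
      ?_, ?_⟩
    · rw [regCoeff, if_pos hr0]
      rw [hr0.1] at hreg
      exact hc0.div (hbr hu1 0) hreg
    · have hlim := (hbr hu1 r).eventually_ne hreg
      have hlt : ∀ᶠ x in F, H x 0 - 1 / 2 < 2 * T x :=
        ((hH 0).sub_const _).eventually_lt (hT.const_mul 2) (by linarith)
      have hgt : ∀ᶠ x in F, -(2 * T x) < H x 0 - 1 / 2 :=
        (hT.const_mul 2).neg.eventually_lt ((hH 0).sub_const _) (by linarith)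
      filter_upwards [hlim, hlt, hgt, hTx, hne0, h0 hr0.2] with x e1 e2 e3 e4 e5 e6
      rw [hr0.1] at e1 ⊢
      refine ⟨?_, e1, ?_⟩
      · rw [e6]
        exact br_zero_ne_zero hp e4 (sub_ne_zero.2 e5) e3 e2
      · rw [cNum_zero, ← e6]
        field_simp
  · have hreg0 := br_sub_half_ne hp hN hG0 hG1 hT₀ hk hr0
    have hl0 := (hbr hu r).eventually_ne hreg0
    by_cases hr1 : r = 1 ∧ k + 1 = N
    · have hn0 := (brNorm_pos hp (pi_div_pos hT1) (pi_div_lt hT1) 0).ne'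
      have hn1 := (brNorm_pos hp (pi_div_pos hT1) (pi_div_lt hT1) 1).ne'
      have ha := tendsto_pi_div hN hG0 hG1 hT₀ hT
      refine ⟨fun x => cRestOne (Real.pi / T x) p (H x) (H' x) /
        (brNorm (Real.pi / T x) p 0 / brNorm (Real.pi / T x) p 1) / br (Real.pi / T x) p 1 (u x),
        ?_, ?_⟩
      · rw [regCoeff, if_neg hr0, if_pos hr1]
        rw [hr1.1] at hreg0
        exact (hc1.div ((tendsto_brNorm ha 0).div (tendsto_brNorm ha 1) hn1)
          (div_ne_zero hn0 hn1)).div (hbr hu 1) hreg0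
      · have hlt : ∀ᶠ x in F, H x 1 - 1 / 2 < 2 * T x :=
          ((hH 1).sub_const _).eventually_lt (hT.const_mul 2) (by linarith)
        have hgt : ∀ᶠ x in F, -(2 * T x) < H x 1 - 1 / 2 :=
          (hT.const_mul 2).neg.eventually_lt ((hH 1).sub_const _) (by linarith)
        filter_upwards [hl0, hlt, hgt, hTx, hne1, h1 hr1.2] with x e1 e2 e3 e4 e5 e6
        rw [hr1.1] at e1 ⊢
        have k0 := (brNorm_pos hp (pi_div_pos e4) (pi_div_lt e4) 0).ne'
        have k1 := (brNorm_pos hp (pi_div_pos e4) (pi_div_lt e4) 1).ne'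
        have k2 := br_zero_ne_zero hp e4 (sub_ne_zero.2 e5) e3 e2
        have k3 : br (Real.pi / T x) p 1 (u x + 1) = br (Real.pi / T x) p 0 (H x 1 - 1 / 2) *
            (brNorm (Real.pi / T x) p 0 / brNorm (Real.pi / T x) p 1) := by
          rw [e6, br_one_sub hp e4]
        refine ⟨e1, ?_, ?_⟩
        · rw [k3]
          exact mul_ne_zero k2 (div_ne_zero k0 k1)
        · rw [cNum_one, k3]
          field_simp
    · have hreg1 := br_add_half_ne hp hN hG0 hG1 hT₀ hk hr1
      have hl1 := (hbr hu1 r).eventually_ne hreg1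
      refine ⟨fun x => cNum (Real.pi / T x) p (H x) (H' x) r /
        (br (Real.pi / T x) p r (u x) * br (Real.pi / T x) p r (u x + 1)), ?_, ?_⟩
      · rw [regCoeff, if_neg hr0, if_neg hr1]
        refine Tendsto.div ?_ ((hbr hu r).mul (hbr hu1 r)) (mul_ne_zero hreg0 hreg1)
        exact tendsto_finsetProd _ fun s _ =>
          (hbr ((hH _).sub_const _) s).mul (hbr (hH' _) s)
      · filter_upwards [hl0, hl1] with x e0 e1
        exact ⟨e0, e1, by field_simp⟩

/-- The one-particle diagonal term converges to the regularized term of `a_k`. -/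
theorem tendsto_diagonal_term {k : ℕ} (hk : k < N) (r : Fin 4)
    (hu : Tendsto u F (𝓝 (G 0 + k - 1 / 2)))
    (h0 : k = 0 → ∀ᶠ x in F, u x = H x 0 - 1 / 2)
    (h1 : k + 1 = N → ∀ᶠ x in F, u x + 1 = T x - (H x 1 - 1 / 2))
    (hne0 : ∀ᶠ x in F, H x 0 ≠ 1 / 2) (hne1 : ∀ᶠ x in F, H x 1 ≠ 1 / 2)
    (hh : Tendsto h F (𝓝 0)) (hhne : ∀ᶠ x in F, h x ≠ 0) :
    Tendsto (fun x => cCoeff (Real.pi / T x) p (1 + h x) (H x) (H' x) r *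
      (br (Real.pi / T x) p r (u x - h x) / br (Real.pi / T x) p r (u x + 1) *
        (br (Real.pi / T x) p r (u x + 1 + h x) / br (Real.pi / T x) p r (u x)) - 1)) F
      (𝓝 (racahTerm N (Real.pi / T₀) p G G' k r)) := by
  obtain ⟨c, hc, hcx⟩ := exists_regular_coeff hp hN hG0 hG1 hT₀ hT hH hH' hk r hu h0 h1 hne0 hne1
  have hN' : (2 : ℝ) ≤ N := by exact_mod_cast hN
  have hT1 : 1 < T₀ := by linarith
  have ha := tendsto_pi_div hN hG0 hG1 hT₀ hT
  have p0 := pi_div_pos hT1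
  have p1 := pi_div_lt hT1
  have hu1 : Tendsto (fun x => u x + 1) F (𝓝 (G 0 + k + 1 / 2)) := by
    convert hu.add_const 1 using 2; ring
  have hg : Tendsto (fun x => 1 + h x) F (𝓝 1) := by simpa using hh.const_add 1
  have hbrg := tendsto_br hp p0 p1 ha hg 0
  -- Division by `h` turns `[g - 1]_1` into a slope at `0`, and `[u-h]_r [u+1+h]_r - [u]_r [u+1]_r`
  -- into `[u]_r` times a slope at `u+1` minus a slope at `u` times `[u+1+h]_r`.
  have s0 := tendsto_br_slope hp p0 p1 ha (tendsto_const_nhds (x := (0 : ℝ))) hh hhne 0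
  have s1 := tendsto_br_slope hp p0 p1 ha hu (by simpa using hh.neg)
    (hhne.mono fun x hx => neg_ne_zero.2 hx) r
  have s2 := tendsto_br_slope hp p0 p1 ha hu1 hh hhne r
  have b0 := tendsto_br hp p0 p1 ha hu r
  have hu1h : Tendsto (fun x => u x + 1 + h x) F (𝓝 (G 0 + k + 1 / 2)) := by
    have := hu1.add hh
    rwa [add_zero] at this
  have b1 := tendsto_br hp p0 p1 ha hu1h r
  have hd := dbr_zero_zero_ne hp hT1
  have hb1 := (br_one_one hp p0 p1).ne'
  have key := (tendsto_const_nhds (x := (2 : ℝ))).div (hbrg.mul s0) (mul_ne_zero hb1 hd)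
  have key2 := key.mul (hc.mul ((b0.mul s2).sub (s1.mul b1)))
  refine key2.congr' ?_
  filter_upwards [hcx, hhne, s0.eventually_ne hd] with x ⟨e1, e2, e3⟩ e4 e5
  rw [zero_add, br_zero_zero, sub_zero] at e5
  have e6 : br (Real.pi / T x) p 0 (h x) ≠ 0 := fun h => e5 (by rw [h, zero_div])
  simp only [cCoeff, e3, Pi.div_apply, add_sub_cancel_left, zero_add, br_zero_zero, sub_zero,
    ← sub_eq_add_neg]
  field_simp
  ring

end


/-! ### The coefficients `a_k` -/

/-- Couplings at which the formula for `a_k` is regular. -/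
abbrev regularSet : Set (Fin 4 → ℝ) := {H | H 0 ≠ 1 / 2 ∧ H 1 ≠ 1 / 2}

theorem eventually_add_ne (a b : ℝ) : ∀ᶠ t : ℝ in 𝓝[>] 0, a + t ≠ b := by
  by_cases h : a = b
  · filter_upwards [self_mem_nhdsWithin] with t ht
    have : (0 : ℝ) < t := ht
    intro h2; linarith
  · have hc : Tendsto (fun t : ℝ => a + t) (𝓝[>] 0) (𝓝 (a + 0)) :=
      (tendsto_const_nhds.add tendsto_id).mono_left nhdsWithin_le_nhds
    exact hc.eventually_ne (by simpa using h)

/-- Makes the limit defining `racahA` unique. The shifts `G + t` with small `t > 0` avoid both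
hyperplanes even when `G` lies on them. -/
instance neBot_nhdsWithin_regularSet (G : Fin 4 → ℝ) : (𝓝[regularSet] G).NeBot := by
  have h : Tendsto (fun t : ℝ => fun i => G i + t) (𝓝[>] 0) (𝓝[regularSet] G) := by
    refine tendsto_nhdsWithin_iff.2 ⟨?_, ?_⟩
    · refine tendsto_pi_nhds.2 fun i => ?_
      have hc : Tendsto (fun t : ℝ => G i + t) (𝓝[>] 0) (𝓝 (G i + 0)) :=
        (tendsto_const_nhds.add tendsto_id).mono_left nhdsWithin_le_nhds
      simpa using hc
    · filter_upwards [eventually_add_ne (G 0) (1 / 2), eventually_add_ne (G 1) (1 / 2)]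
        with t h1 h2 using ⟨h1, h2⟩
  exact h.neBot

section
variable {p : ℝ} (hp : |p| < 1) {n m : ℕ} (hn : 1 ≤ n) (hm : 1 ≤ m) {G G' : Fin 4 → ℝ}
  (hG0 : 0 < G 0) (hG1 : 0 < G 1)
include hp hn hm hG0 hG1

theorem tendsto_racahAFormula {k : ℕ} (hk : k < n + m) :
    Tendsto (fun H => racahAFormula n m p H G' k) (𝓝[regularSet] G)
      (𝓝 (∑ r, racahTerm (n + m) (Real.pi / halfPeriod n m 1 G) p G G' k r)) := by
  refine tendsto_finsetSum _ fun r _ => ?_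
  have hN : 2 ≤ n + m := by omega
  have hT1 := one_lt_halfPeriod hn hm hG0 hG1
  have hH : ∀ i, Tendsto (fun H : Fin 4 → ℝ => H i) (𝓝[regularSet] G) (𝓝 (G i)) := fun i =>
    ((continuous_apply i).tendsto G).mono_left nhdsWithin_le_nhds
  have hT : Tendsto (halfPeriod n m 1) (𝓝[regularSet] G) (𝓝 (halfPeriod n m 1 G)) :=
    ((hH 0).const_add _).add (hH 1)
  have hu : Tendsto (fun H : Fin 4 → ℝ => H 0 + k - 1 / 2) (𝓝[regularSet] G)
      (𝓝 (G 0 + k - 1 / 2)) := ((hH 0).add_const _).sub_const _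
  have hu1 : Tendsto (fun H : Fin 4 → ℝ => H 0 + k + 1 / 2) (𝓝[regularSet] G)
      (𝓝 (G 0 + k + 1 / 2)) := ((hH 0).add_const _).add_const _
  have hreg : ∀ᶠ H : Fin 4 → ℝ in 𝓝[regularSet] G, H ∈ regularSet := self_mem_nhdsWithin
  obtain ⟨c, hc, hcx⟩ := exists_regular_coeff hp hN hG0 hG1 (halfPeriod_one n m G) hT hH
    (H' := fun _ => G') (fun i => tendsto_const_nhds) hk r hu
    (by rintro rfl; exact Eventually.of_forall fun H => by simp)
    (by
      intro hk1
      refine Eventually.of_forall fun H => ?_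
      have : ((n + m : ℕ) : ℝ) = k + 1 := by exact_mod_cast hk1.symm
      rw [halfPeriod_one, this]; ring)
    (hreg.mono fun H h => h.1) (hreg.mono fun H h => h.2)
  have ha := tendsto_pi_div hN hG0 hG1 (halfPeriod_one n m G) hT
  have p0 := pi_div_pos hT1
  have p1 := pi_div_lt hT1
  have hd := dbr_zero_zero_ne hp hT1
  have hb1 := (br_one_one hp p0 p1).ne'
  have key := ((tendsto_const_nhds (x := (2 : ℝ))).div
    ((tendsto_br hp p0 p1 ha (tendsto_const_nhds (x := (1 : ℝ))) 0).mul
    (tendsto_dbr hp p0 p1 ha (tendsto_const_nhds (x := (0 : ℝ))) 0)) (mul_ne_zero hb1 hd)).mul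
    (hc.mul (((tendsto_br hp p0 p1 ha hu r).mul (tendsto_dbr hp p0 p1 ha hu1 r)).sub
      ((tendsto_dbr hp p0 p1 ha hu r).mul (tendsto_br hp p0 p1 ha hu1 r))))
  refine key.congr' ?_
  filter_upwards [hcx] with H ⟨e1, e2, e3⟩
  rw [show H 0 + (k : ℝ) - 1 / 2 + 1 = H 0 + k + 1 / 2 by ring] at e2 e3
  simp only [resC, alpha_eq, e3, Pi.div_apply, deriv_br hp]
  generalize br (Real.pi / halfPeriod n m 1 H) p r (H 0 + k - 1 / 2) = y0 at *
  generalize br (Real.pi / halfPeriod n m 1 H) p r (H 0 + k + 1 / 2) = y1 at *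
  field_simp

theorem racahA_eq {k : ℕ} (hk : k < n + m) :
    racahA n m p G G' k = ∑ r, racahTerm (n + m) (Real.pi / halfPeriod n m 1 G) p G G' k r :=
  (tendsto_racahAFormula hp hn hm hG0 hG1 hk).limUnder_eq

end

/-! ### The limit of the difference operator -/

/-- By `f P - 1 = (f - 1) P + (P - 1)`, with `P → 1`, the product linearizes. Here `c` may diverge,
as `c_r` does at `g = 1`. -/
theorem tendsto_mul_prod_sub_one {X ι : Type*} {F : Filter X} {c : X → ℝ} {f : ι → X → ℝ}
    {L : ι → ℝ} (s : Finset ι) (hL : ∀ j ∈ s, Tendsto (fun x => c x * (f j x - 1)) F (𝓝 (L j)))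
    (hf : ∀ j ∈ s, Tendsto (f j) F (𝓝 1)) :
    Tendsto (fun x => c x * (∏ j ∈ s, f j x - 1)) F (𝓝 (∑ j ∈ s, L j)) := by
  classical
  induction s using Finset.induction_on with
  | empty => simpa using tendsto_const_nhds
  | insert j s hj ih =>
    have h1 := ih (fun i hi => hL i (Finset.mem_insert_of_mem hi))
      (fun i hi => hf i (Finset.mem_insert_of_mem hi))
    have h2 : Tendsto (fun x => ∏ j ∈ s, f j x) F (𝓝 1) := by
      simpa using tendsto_finsetProd s fun i hi => hf i (Finset.mem_insert_of_mem hi)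
    have h3 := ((hL j (Finset.mem_insert_self _ _)).mul h2).add h1
    rw [Finset.sum_insert hj, ← mul_one (L j)]
    refine h3.congr fun x => ?_
    rw [Finset.prod_insert hj]
    ring

/-- One factor need not tend to one, since its deviation is only multiplied by the others. Near a
removable singularity the factor of the particle at the end site can depend on the direction of
approach. -/
theorem tendsto_mul_prod_sub_one' {X ι : Type*} [Fintype ι] {F : Filter X} {c : X → ℝ}
    {f : ι → X → ℝ} {L : ι → ℝ} (i : ι)
    (hL : ∀ j, Tendsto (fun x => c x * (f j x - 1)) F (𝓝 (L j)))
    (hf : ∀ j ≠ i, Tendsto (f j) F (𝓝 1)) :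
    Tendsto (fun x => c x * (∏ j, f j x - 1)) F (𝓝 (∑ j, L j)) := by
  classical
  have h1 := tendsto_mul_prod_sub_one (Finset.univ.erase i) (fun j _ => hL j)
    (fun j hj => hf j (Finset.ne_of_mem_erase hj))
  have h2 : Tendsto (fun x => ∏ j ∈ Finset.univ.erase i, f j x) F (𝓝 1) := by
    simpa using tendsto_finsetProd (Finset.univ.erase i)
      fun j hj => hf j (Finset.ne_of_mem_erase hj)
  have h3 := ((hL i).mul h2).add h1
  rw [← Finset.add_sum_erase _ _ (Finset.mem_univ i), ← mul_one (L i)]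
  refine h3.congr fun x => ?_
  rw [← Finset.mul_prod_erase _ _ (Finset.mem_univ i)]
  ring

/-- The couplings `(g, g_r, g'_r)` at which the difference operator is regular. -/
abbrev regularParams : Set (ℝ × (Fin 4 → ℝ) × (Fin 4 → ℝ)) :=
  {x | x.1 ≠ 1 ∧ x.2.1 0 ≠ 1 / 2 ∧ x.2.1 1 ≠ 1 / 2}

section
variable (G G' : Fin 4 → ℝ)

theorem tendsto_coupling :
    Tendsto (fun x : ℝ × (Fin 4 → ℝ) × (Fin 4 → ℝ) => x.1) (𝓝[regularParams] (1, G, G')) (𝓝 1) :=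
  (continuous_fst.tendsto (1, G, G')).mono_left nhdsWithin_le_nhds

theorem tendsto_couplings (i : Fin 4) :
    Tendsto (fun x : ℝ × (Fin 4 → ℝ) × (Fin 4 → ℝ) => x.2.1 i) (𝓝[regularParams] (1, G, G'))
      (𝓝 (G i)) :=
  (((continuous_apply i).comp (continuous_fst.comp continuous_snd)).tendsto
    (1, G, G')).mono_left nhdsWithin_le_nhds

theorem tendsto_couplings' (i : Fin 4) :
    Tendsto (fun x : ℝ × (Fin 4 → ℝ) × (Fin 4 → ℝ) => x.2.2 i) (𝓝[regularParams] (1, G, G'))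
      (𝓝 (G' i)) :=
  (((continuous_apply i).comp (continuous_snd.comp continuous_snd)).tendsto
    (1, G, G')).mono_left nhdsWithin_le_nhds

theorem tendsto_halfPeriod (n m : ℕ) :
    Tendsto (fun x : ℝ × (Fin 4 → ℝ) × (Fin 4 → ℝ) => halfPeriod n m x.1 x.2.1)
      (𝓝[regularParams] (1, G, G')) (𝓝 (halfPeriod n m 1 G)) :=
  ((((tendsto_coupling G G').const_mul _).const_add _).add (tendsto_couplings G G' 0)).add
    (tendsto_couplings G G' 1)

theorem tendsto_rho (n : ℕ) (j : Fin n) :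
    Tendsto (fun x : ℝ × (Fin 4 → ℝ) × (Fin 4 → ℝ) => rho n x.1 x.2.1 j)
      (𝓝[regularParams] (1, G, G')) (𝓝 (rho n 1 G j)) :=
  ((tendsto_coupling G G').const_mul _).add (tendsto_couplings G G' 0)

end

/-- At `g = 1` all particles live on the common lattice `g_1 + k`. -/
theorem rho_one_add {n : ℕ} (G : Fin 4 → ℝ) {l : Fin n → ℤ} {j : Fin n} (h : 0 ≤ l j) :
    rho n 1 G j + l j = G 0 + node n l j := by
  rw [node_real h, rho]; ring

/-- Only the last particle can reach site `0`; likewise, below, only the first can reach site `n + m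
- 1`. -/
theorem node_pos_of_ne_last {n : ℕ} {l : Fin n → ℤ} {j : Fin n} (h : (j : ℕ) ≠ n - 1) :
    node n l j ≠ 0 := by
  have := j.isLt
  unfold node; omega

theorem node_add_one_ne {n m : ℕ} {l : Fin n → ℤ} (hl : l ∈ Lam n m) {j : Fin n}
    (h : (j : ℕ) ≠ 0) : node n l j + 1 ≠ n + m := by
  have h1 := (mem_Lam.1 hl).1 j
  have := node_int h1.1
  have := j.isLt
  omega

section
variable {p : ℝ} (hp : |p| < 1) {n m : ℕ} (hn : 1 ≤ n) (hm : 1 ≤ m) {G G' : Fin 4 → ℝ}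
  (hG0 : 0 < G 0) (hG1 : 0 < G 1)
include hp hn hm hG0 hG1

/-- The pole of `c_r` at `g = 1` meets a product whose factors, except perhaps one, tend to one, so
the many-particle term becomes the sum of the one-particle terms. -/
theorem tendsto_coeffA {l : Fin n → ℤ} (hl : l ∈ Lam n m) :
    Tendsto (fun x : ℝ × (Fin 4 → ℝ) × (Fin 4 → ℝ) => coeffA n m p x.1 x.2.1 x.2.2 l)
      (𝓝[regularParams] (1, G, G')) (𝓝 (∑ j, racahA n m p G G' (node n l j))) := by
  have hsum : ∑ j, racahA n m p G G' (node n l j) = ∑ r, ∑ j,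
      racahTerm (n + m) (Real.pi / halfPeriod n m 1 G) p G G' (node n l j) r := by
    rw [Finset.sum_comm]
    exact Finset.sum_congr rfl fun j _ => racahA_eq hp hn hm hG0 hG1 (node_lt hl j)
  rw [hsum]
  refine tendsto_finsetSum _ fun r _ => ?_
  have hN : 2 ≤ n + m := by omega
  have hT := tendsto_halfPeriod G G' n m
  have hT0 := halfPeriod_one n m G
  have hreg : ∀ᶠ x in 𝓝[regularParams] (1, G, G'), x ∈ regularParams := self_mem_nhdsWithin
  have hh : Tendsto (fun x : ℝ × (Fin 4 → ℝ) × (Fin 4 → ℝ) => x.1 - 1)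
      (𝓝[regularParams] (1, G, G')) (𝓝 0) := by
    simpa using (tendsto_coupling G G').sub_const 1
  have hl0 := fun j => ((mem_Lam.1 hl).1 j).1
  have hu : ∀ j, Tendsto
      (fun x : ℝ × (Fin 4 → ℝ) × (Fin 4 → ℝ) => rho n x.1 x.2.1 j + l j - 1 / 2)
      (𝓝[regularParams] (1, G, G')) (𝓝 (G 0 + node n l j - 1 / 2)) := fun j => by
    rw [← rho_one_add G (hl0 j)]
    exact ((tendsto_rho G G' n j).add_const _).sub_const _
  -- For every `g` one has `ρ_n = g_1` and `ρ_1 + m = π / α - g_2`, so the identities required at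
  -- the two end sites hold exactly and not only in the limit.
  have hterm := fun j => tendsto_diagonal_term hp hN hG0 hG1 hT0 hT (tendsto_couplings G G')
    (tendsto_couplings' G G') (node_lt hl j) r (hu j)
    (by
      intro h0
      refine Eventually.of_forall fun x => ?_
      have h1 : (j : ℕ) = n - 1 := by
        by_contra h; exact node_pos_of_ne_last h h0
      have h2 : l j = 0 := by
        have := hl0 j
        unfold node at h0; omega
      have h3 : (n : ℝ) - 1 - (j : ℕ) = 0 := by
        rw [h1]; push_cast [hn]; ring
      rw [rho, h3, h2]; simp)
    (by
      intro h0
      refine Eventually.of_forall fun x => ?_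
      have h1 : (j : ℕ) = 0 := by
        by_contra h; exact node_add_one_ne hl h h0
      have h2 : l j = m := by
        have := hl0 j
        unfold node at h0; omega
      rw [rho, h1, h2, halfPeriod]; push_cast; ring)
    (hreg.mono fun x h => h.2.1) (hreg.mono fun x h => h.2.2) hh
    (hreg.mono fun x h => sub_ne_zero.2 h.1)
  have hbr : ∀ {z : ℝ × (Fin 4 → ℝ) × (Fin 4 → ℝ) → ℝ} {z₀ : ℝ},
      Tendsto z (𝓝[regularParams] (1, G, G')) (𝓝 z₀) → Tendsto
      (fun x => br (Real.pi / halfPeriod n m x.1 x.2.1) p r (z x))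
      (𝓝[regularParams] (1, G, G')) (𝓝 (br (Real.pi / halfPeriod n m 1 G) p r z₀)) :=
    fun hz => tendsto_br_pi_div hp hN hG0 hG1 hT0 hT hz r
  have hone : ∀ j : Fin n, ¬(r = 0 ∧ node n l j = 0) → ¬(r = 1 ∧ node n l j + 1 = n + m) →
      Tendsto (fun x : ℝ × (Fin 4 → ℝ) × (Fin 4 → ℝ) =>
        br (Real.pi / halfPeriod n m x.1 x.2.1) p r (rho n x.1 x.2.1 j + l j - 1 / 2 - (x.1 - 1)) /
        br (Real.pi / halfPeriod n m x.1 x.2.1) p r (rho n x.1 x.2.1 j + l j - 1 / 2 + 1) *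
        (br (Real.pi / halfPeriod n m x.1 x.2.1) p r
          (rho n x.1 x.2.1 j + l j - 1 / 2 + 1 + (x.1 - 1)) /
        br (Real.pi / halfPeriod n m x.1 x.2.1) p r (rho n x.1 x.2.1 j + l j - 1 / 2)))
      (𝓝[regularParams] (1, G, G')) (𝓝 1) := fun j h0 h1 => by
    have k0 := br_sub_half_ne hp hN hG0 hG1 hT0 (node_lt hl j) h0
    have k1 := br_add_half_ne hp hN hG0 hG1 hT0 (node_lt hl j) h1
    rw [show G 0 + (node n l j : ℝ) + 1 / 2 = G 0 + node n l j - 1 / 2 + 1 by ring] at k1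
    have := ((hbr ((hu j).sub hh)).div (hbr ((hu j).add_const 1)) k1).mul
      ((hbr (((hu j).add_const 1).add hh)).div (hbr (hu j)) k0)
    simp only [sub_zero, add_zero] at this
    convert! this using 2
    generalize br (Real.pi / halfPeriod n m 1 G) p r (G 0 + (node n l j : ℝ) - 1 / 2) = y0 at *
    generalize br (Real.pi / halfPeriod n m 1 G) p r (G 0 + (node n l j : ℝ) - 1 / 2 + 1) = y1 at *
    field_simp
  -- For `r = 0` the exempt particle is the last one, the only candidate for site `0`; otherwise it
  -- is the first, the only candidate for site `n + m - 1`.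
  have hex : ∃ i : Fin n, ∀ j ≠ i, ¬(r = 0 ∧ node n l j = 0) ∧
      ¬(r = 1 ∧ node n l j + 1 = n + m) := by
    by_cases hr : r = 0
    · refine ⟨⟨n - 1, by omega⟩, fun j hj => ⟨fun h => ?_, fun h => by simp [hr] at h⟩⟩
      exact node_pos_of_ne_last (fun h' => hj (Fin.ext h')) h.2
    · refine ⟨⟨0, hn⟩, fun j hj => ⟨fun h => hr h.1, fun h => ?_⟩⟩
      exact node_add_one_ne hl (fun h' => hj (Fin.ext h')) h.2
  obtain ⟨i, hi⟩ := hex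
  have key := tendsto_mul_prod_sub_one' i hterm fun j hj => hone j (hi j hj).1 (hi j hj).2
  refine key.congr fun x => ?_
  simp only [alpha_eq, add_sub_cancel]
  congr 3
  refine funext fun j => ?_
  congr 3 <;> ring

/-- The coefficient `B_λ` is continuous at `g = 1` wherever it occurs in the operator. -/
theorem tendsto_coeffB {l : Fin n → ℤ} (hl : l ∈ Lam n m) {ε : ℤ} (hε : ε = 1 ∨ ε = -1)
    {j : Fin n} (hj : l + Pi.single j ε ∈ Lam n m) :
    Tendsto (fun x : ℝ × (Fin 4 → ℝ) × (Fin 4 → ℝ) => coeffB n m p x.1 x.2.1 x.2.2 l ε j)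
      (𝓝[regularParams] (1, G, G')) (𝓝 (coeffB n m p 1 G G' l ε j)) := by
  have hN : 2 ≤ n + m := by omega
  have hT := tendsto_halfPeriod G G' n m
  have hT0 := halfPeriod_one n m G
  have hT1 := one_lt_halfPeriod hn hm hG0 hG1
  have hl0 := fun j => ((mem_Lam.1 hl).1 j).1
  have hx := fun i => (tendsto_rho G G' n i).add_const (l i : ℝ)
  have hbr : ∀ (r) {z : ℝ × (Fin 4 → ℝ) × (Fin 4 → ℝ) → ℝ} {z₀ : ℝ},
      Tendsto z (𝓝[regularParams] (1, G, G')) (𝓝 z₀) → Tendsto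
      (fun x => br (Real.pi / halfPeriod n m x.1 x.2.1) p r (z x))
      (𝓝[regularParams] (1, G, G')) (𝓝 (br (Real.pi / halfPeriod n m 1 G) p r z₀)) :=
    fun r _ _ hz => tendsto_br_pi_div hp hN hG0 hG1 hT0 hT hz r
  have hnode := fun i => rho_one_add G (hl0 i)
  have hbound : ∀ i, (0 : ℝ) < rho n 1 G i + l i ∧ rho n 1 G i + l i < halfPeriod n m 1 G :=
    fun i => by
      have h1 : (node n l i : ℝ) + 1 ≤ ((n + m : ℕ) : ℝ) := by exact_mod_cast node_lt hl i
      have h2 : (0 : ℝ) ≤ node n l i := Nat.cast_nonneg _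
      rw [hnode, hT0]
      constructor <;> linarith
  -- As the target of the move is again a partition, the midpoint of the jump lies strictly inside
  -- `(0, T)`, where no denominator vanishes.
  have hjb : (0 : ℝ) < rho n 1 G j + l j + ε / 2 ∧
      rho n 1 G j + l j + ε / 2 < halfPeriod n m 1 G := by
    have h1 : (node n l j : ℝ) + 1 ≤ ((n + m : ℕ) : ℝ) := by exact_mod_cast node_lt hl j
    have h2 : (0 : ℝ) ≤ node n l j := Nat.cast_nonneg _
    have h3 := node_int (hl0 j)
    have h4 := (mem_Lam.1 hj).1 j
    have h5 := node_int h4.1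
    have h6 := node_lt hj j
    simp only [Pi.add_apply, Pi.single_eq_same] at h4 h5
    rw [hnode, hT0]
    rcases hε with rfl | rfl
    · have : (node n l j : ℝ) + 2 ≤ ((n + m : ℕ) : ℝ) := by
        exact_mod_cast (by omega : node n l j + 2 ≤ n + m)
      rw [Int.cast_one]
      constructor <;> linarith
    · have : (1 : ℝ) ≤ node n l j := by
        exact_mod_cast (by omega : 1 ≤ node n l j)
      rw [Int.cast_neg, Int.cast_one]
      constructor <;> linarith
  refine Tendsto.mul ?_ ?_
  · refine tendsto_finsetProd _ fun r _ => ?_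
    refine Tendsto.div ((hbr r ((hx j).add ((tendsto_couplings G G' r).const_mul _))).mul
      (hbr r ((hx j).add (((tendsto_couplings' G G' r).add_const _).const_mul _))))
      ((hbr r (hx j)).mul (hbr r ((hx j).add_const _))) ?_
    exact mul_ne_zero (br_pos hp hT1 (hbound j).1 (hbound j).2 r).ne'
      (br_pos hp hT1 hjb.1 hjb.2 r).ne'
  · refine tendsto_finsetProd _ fun k hk => tendsto_finsetProd _ fun δ hδ => ?_
    refine Tendsto.div (hbr 0 (((hx j).add ((hx k).const_mul _)).add
      ((tendsto_coupling G G').const_mul _))) (hbr 0 ((hx j).add ((hx k).const_mul _))) ?_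
    have hjk : k ≠ j := (Finset.mem_erase.1 hk).1
    have hne : rho n 1 G j + l j ≠ rho n 1 G k + l k := by
      rw [hnode, hnode]
      intro h
      have h1 : (node n l j : ℤ) = node n l k := by
        have : (node n l j : ℝ) = node n l k := by linarith
        exact_mod_cast this
      rw [node_int (hl0 j), node_int (hl0 k)] at h1
      have h2 : (j : ℕ) ≠ k := fun h => hjk (Fin.ext h.symm)
      rcases lt_or_gt_of_ne h2 with h3 | h3
      · have := (mem_Lam.1 hl).2 (show j ≤ k from h3.le)
        omega
      · have := (mem_Lam.1 hl).2 (show k ≤ j from h3.le)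
        omega
    have b1 := hbound j
    have b2 := hbound k
    simp only [Finset.mem_insert, Finset.mem_singleton] at hδ
    rcases hδ with rfl | rfl
    · push_cast
      exact br_zero_ne_zero hp hT1 (by linarith) (by linarith) (by linarith)
    · push_cast
      refine br_zero_ne_zero hp hT1 (fun h => hne (by linarith)) (by linarith) (by linarith)

end


/-! ### Tridiagonal matrices -/

/-- Laplace expansion along the last row, followed in the off-diagonal minor by expansion along its
last column. It gives the three-term recurrence of the characteristic polynomials. -/
theorem _root_.Matrix.det_succ_succ_of_tridiagonal {R : Type*} [CommRing R] {k : ℕ}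
    (A : Matrix (Fin (k + 2)) (Fin (k + 2)) R)
    (hrow : ∀ i : Fin k, A (Fin.last _) i.castSucc.castSucc = 0)
    (hcol : ∀ i : Fin k, A i.castSucc.castSucc (Fin.last _) = 0) :
    A.det = A (Fin.last _) (Fin.last _) * (A.submatrix Fin.castSucc Fin.castSucc).det -
      A (Fin.last _) (Fin.last _).castSucc * A (Fin.last _).castSucc (Fin.last _) *
        (A.submatrix (fun i : Fin k => i.castSucc.castSucc)
          (fun i : Fin k => i.castSucc.castSucc)).det := by
  have hsub : (A.submatrix (Fin.last (k + 1)).succAbove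
      (Fin.last k).castSucc.succAbove).det =
      A (Fin.last _).castSucc (Fin.last _) *
        (A.submatrix (fun i : Fin k => i.castSucc.castSucc)
          (fun i : Fin k => i.castSucc.castSucc)).det := by
    rw [Matrix.det_succ_column _ (Fin.last k), Fin.sum_univ_castSucc]
    have h0 : (Fin.last k).castSucc.succAbove (Fin.last k) = Fin.last (k + 1) := by
      rw [Fin.succAbove_castSucc_self, Fin.succ_last]
    have h1 : ∀ i : Fin k, (Fin.last k).castSucc.succAbove i.castSucc = i.castSucc.castSucc :=
      fun i => Fin.succAbove_of_castSucc_lt _ _ (by simp [Fin.lt_def])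
    rw [Finset.sum_eq_zero, zero_add]
    · simp only [Matrix.submatrix_apply, h0, Fin.succAbove_last, Matrix.submatrix_submatrix]
      rw [← two_mul, pow_mul, neg_one_sq, one_pow, one_mul]
      congr 2
      ext i j
      simp [Matrix.submatrix_apply, h1]
    · intro i _
      simp [Matrix.submatrix_apply, h0, hcol]
  rw [Matrix.det_succ_row A (Fin.last (k + 1)), Fin.sum_univ_castSucc, Fin.sum_univ_castSucc,
    Finset.sum_eq_zero (fun i _ => by rw [hrow]; ring), zero_add, hsub]
  simp only [Fin.succAbove_last, Fin.val_castSucc, Fin.val_last]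
  have e1 : (-1 : R) ^ (k + 1 + k) = -1 := by
    rw [show k + 1 + k = 2 * k + 1 by ring, pow_succ, pow_mul]; simp
  have e2 : (-1 : R) ^ (k + 1 + (k + 1)) = 1 := by
    rw [← two_mul, pow_mul]; simp
  rw [e1, e2]
  ring

/-- The tridiagonal matrix with diagonal `a`, superdiagonal `b` and subdiagonal `c`. -/
def tridiag (a b c : ℕ → ℝ) (k : ℕ) : Matrix (Fin k) (Fin k) ℝ :=
  fun i j =>
    if i = j then a i
    else if (i : ℕ) + 1 = j then b i
    else if (j : ℕ) + 1 = i then c i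
    else 0

section
variable (a b c : ℕ → ℝ)

theorem charpoly_tridiag_one : (tridiag a b c 1).charpoly = X - C (a 0) := by
  simp [Matrix.charpoly, Matrix.det_unique, tridiag]

theorem charpoly_tridiag_add_two (k : ℕ) :
    (tridiag a b c (k + 2)).charpoly = (X - C (a (k + 1))) * (tridiag a b c (k + 1)).charpoly -
      C (b k * c (k + 1)) * (tridiag a b c k).charpoly := by
  have hs : ∀ i j : Fin (k + 1), (tridiag a b c (k + 2)) i.castSucc j.castSucc =
      tridiag a b c (k + 1) i j := fun i j => by simp [tridiag]
  have hs2 : ∀ i j : Fin k, (tridiag a b c (k + 2)) i.castSucc.castSucc j.castSucc.castSucc =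
      tridiag a b c k i j := fun i j => by simp [tridiag]
  rw [Matrix.charpoly, Matrix.det_succ_succ_of_tridiagonal]
  · have e1 : ((tridiag a b c (k + 2)).charmatrix).submatrix Fin.castSucc Fin.castSucc =
        (tridiag a b c (k + 1)).charmatrix := by
      ext1 i j
      simp [Matrix.charmatrix_apply, Matrix.diagonal_apply, hs]
    have e2 : ((tridiag a b c (k + 2)).charmatrix).submatrix
        (fun i : Fin k => i.castSucc.castSucc) (fun i : Fin k => i.castSucc.castSucc) =
        (tridiag a b c k).charmatrix := by
      ext1 i j
      simp [Matrix.charmatrix_apply, Matrix.diagonal_apply, hs2]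
    rw [e1, e2, ← Matrix.charpoly, ← Matrix.charpoly]
    have h1 : Fin.last (k + 1) ≠ (Fin.last k).castSucc := by simp [Fin.ext_iff]
    rw [Matrix.charmatrix_apply_eq, Matrix.charmatrix_apply_ne _ _ _ h1,
      Matrix.charmatrix_apply_ne _ _ _ h1.symm]
    have e3 : tridiag a b c (k + 2) (Fin.last _) (Fin.last _).castSucc = c (k + 1) := by
      rw [tridiag, if_neg h1, if_neg (by simp; omega), if_pos (by simp)]
      simp
    have e4 : tridiag a b c (k + 2) (Fin.last _).castSucc (Fin.last _) = b k := by
      rw [tridiag, if_neg h1.symm, if_pos (by simp)]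
      simp
    have e5 : tridiag a b c (k + 2) (Fin.last _) (Fin.last _) = a (k + 1) := by
      rw [tridiag, if_pos rfl]; simp
    rw [e3, e4, e5, C_mul]
    ring
  · intro i
    have h1 : Fin.last (k + 1) ≠ i.castSucc.castSucc := by
      simp [Fin.ext_iff]; omega
    have := i.isLt
    rw [Matrix.charmatrix_apply_ne _ _ _ h1, tridiag, if_neg h1, if_neg, if_neg]
    · simp
    · simp; omega
    · simp; omega
  · intro i
    have h1 : i.castSucc.castSucc ≠ Fin.last (k + 1) := by
      simp [Fin.ext_iff]; omega
    have := i.isLt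
    rw [Matrix.charmatrix_apply_ne _ _ _ h1, tridiag, if_neg h1, if_neg, if_neg]
    · simp
    · simp; omega
    · simp; omega

theorem natDegree_charpoly_tridiag (k : ℕ) : (tridiag a b c k).charpoly.natDegree = k := by
  simp [Matrix.charpoly_natDegree_eq_dim]

/-- The recurrence sees the off-diagonal entries only through the products `b k * c (k + 1)`, which
leaves the freedom to symmetrize. -/
theorem charpoly_tridiag_congr {b' c' : ℕ → ℝ} (N : ℕ)
    (h : ∀ k, k + 1 < N → b k * c (k + 1) = b' k * c' (k + 1)) :
    ∀ k ≤ N, (tridiag a b c k).charpoly = (tridiag a b' c' k).charpoly := by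
  intro k
  induction k using Nat.strong_induction_on with
  | _ k ih =>
    intro hk
    match k with
    | 0 => simp
    | 1 => simp [charpoly_tridiag_one]
    | k + 2 =>
      rw [charpoly_tridiag_add_two, charpoly_tridiag_add_two, ih _ (by omega) (by omega),
        ih _ (by omega) (by omega), h k (by omega)]

/-- The values of the orthogonal polynomials of a tridiagonal matrix. -/
def triP (k : ℕ) (x : ℝ) : ℝ := (tridiag a b c k).charpoly.eval x

theorem triP_zero (x : ℝ) : triP a b c 0 x = 1 := by simp [triP]

theorem triP_one (x : ℝ) : triP a b c 1 x = x - a 0 := by simp [triP, charpoly_tridiag_one]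

theorem triP_add_two (k : ℕ) (x : ℝ) :
    triP a b c (k + 2) x = (x - a (k + 1)) * triP a b c (k + 1) x -
      b k * c (k + 1) * triP a b c k x := by
  simp [triP, charpoly_tridiag_add_two]

/-- Christoffel–Darboux identity. -/
theorem christoffel_darboux (x y : ℝ) (k : ℕ) :
    triP a b c (k + 1) x * triP a b c k y - triP a b c k x * triP a b c (k + 1) y =
      (x - y) * ∑ i ∈ Finset.range (k + 1), triP a b c i x * triP a b c i y *
        ∏ s ∈ Finset.Ico i k, (b s * c (s + 1)) := by
  induction k with
  | zero => simp [triP_zero, triP_one]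
  | succ k ih =>
    rw [Finset.sum_range_succ, Finset.Ico_self, Finset.prod_empty, mul_one, mul_add]
    have : ∑ i ∈ Finset.range (k + 1), triP a b c i x * triP a b c i y *
        ∏ s ∈ Finset.Ico i (k + 1), (b s * c (s + 1)) = (b k * c (k + 1)) *
        ∑ i ∈ Finset.range (k + 1), triP a b c i x * triP a b c i y *
        ∏ s ∈ Finset.Ico i k, (b s * c (s + 1)) := by
      rw [Finset.mul_sum]
      refine Finset.sum_congr rfl fun i hi => ?_
      rw [Finset.prod_Ico_succ_top (by simpa [Nat.lt_succ_iff] using hi)]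
      ring
    rw [this, triP_add_two, triP_add_two]
    linear_combination (b k * c (k + 1)) * ih

/-- Confluent Christoffel–Darboux identity. -/
theorem christoffel_darboux_deriv (x : ℝ) (k : ℕ) :
    (tridiag a b c (k + 1)).charpoly.derivative.eval x * triP a b c k x -
      triP a b c (k + 1) x * (tridiag a b c k).charpoly.derivative.eval x =
      ∑ i ∈ Finset.range (k + 1), triP a b c i x ^ 2 *
        ∏ s ∈ Finset.Ico i k, (b s * c (s + 1)) := by
  induction k with
  | zero => simp [triP_zero, charpoly_tridiag_one]
  | succ k ih =>
    rw [Finset.sum_range_succ, Finset.Ico_self, Finset.prod_empty, mul_one]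
    have : ∑ i ∈ Finset.range (k + 1), triP a b c i x ^ 2 *
        ∏ s ∈ Finset.Ico i (k + 1), (b s * c (s + 1)) = (b k * c (k + 1)) *
        ∑ i ∈ Finset.range (k + 1), triP a b c i x ^ 2 *
        ∏ s ∈ Finset.Ico i k, (b s * c (s + 1)) := by
      rw [Finset.mul_sum]
      refine Finset.sum_congr rfl fun i hi => ?_
      rw [Finset.prod_Ico_succ_top (by simpa [Nat.lt_succ_iff] using hi)]
      ring
    have hd : (tridiag a b c (k + 1 + 1)).charpoly.derivative.eval x = triP a b c (k + 1) x +
        (x - a (k + 1)) * (tridiag a b c (k + 1)).charpoly.derivative.eval x -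
        b k * c (k + 1) * (tridiag a b c k).charpoly.derivative.eval x := by
      rw [charpoly_tridiag_add_two]
      simp [triP]
    rw [this, triP_add_two, hd]
    linear_combination (b k * c (k + 1)) * ih

variable {a b c} {N : ℕ} (hbc : ∀ k, k + 1 < N → 0 < b k * c (k + 1))
include hbc

theorem prod_tridiag_pos (i : ℕ) {k : ℕ} (hk : k < N) :
    0 < ∏ s ∈ Finset.Ico i k, (b s * c (s + 1)) :=
  Finset.prod_pos fun s hs => hbc s (by have := (Finset.mem_Ico.1 hs).2; omega)

theorem sum_sq_triP_pos (hN : 0 < N) (x : ℝ) :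
    0 < ∑ i ∈ Finset.range N, triP a b c i x ^ 2 *
      ∏ s ∈ Finset.Ico i (N - 1), (b s * c (s + 1)) := by
  refine Finset.sum_pos' (fun i _ => ?_) ⟨0, Finset.mem_range.2 hN, ?_⟩
  · exact mul_nonneg (sq_nonneg _) (prod_tridiag_pos hbc i (by omega)).le
  · rw [triP_zero]
    have := prod_tridiag_pos hbc 0 (k := N - 1) (by omega)
    simpa using this

/-- At a zero of `P_N` the confluent identity reads `P_N' P_{N-1} =` a positive sum, so every real
root is simple. -/
theorem derivative_eval_ne_zero (hN : 0 < N) {x : ℝ} (hx : triP a b c N x = 0) :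
    (tridiag a b c N).charpoly.derivative.eval x ≠ 0 := by
  obtain ⟨k, rfl⟩ : ∃ k, N = k + 1 := ⟨N - 1, by omega⟩
  have h1 := christoffel_darboux_deriv a b c x k
  have h2 := sum_sq_triP_pos (a := a) hbc hN x
  rw [Nat.add_sub_cancel, ← h1, hx, zero_mul, sub_zero] at h2
  intro h
  rw [h, zero_mul] at h2
  exact lt_irrefl _ h2

/-- The characteristic polynomial of a Jacobi matrix splits over the reals. -/
theorem card_roots_tridiag : (tridiag a b c N).charpoly.roots.card = N := by
  -- Placing `√(b_k c_{k+1})` on both off-diagonals keeps the polynomial and makes the matrix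
  -- symmetric. The shift `k - 1` below is due to `c` being indexed by its row.
  set s : ℕ → ℝ := fun k => Real.sqrt (b k * c (k + 1)) with hs
  have h1 : (tridiag a b c N).charpoly = (tridiag a s (fun k => s (k - 1)) N).charpoly := by
    refine charpoly_tridiag_congr a b c N (fun k hk => ?_) N le_rfl
    simp only [hs, Nat.add_sub_cancel]
    exact (Real.mul_self_sqrt (hbc k hk).le).symm
  have h2 : (tridiag a s (fun k => s (k - 1)) N).IsHermitian := by
    refine Matrix.IsHermitian.ext fun i j => ?_
    simp only [tridiag, star_trivial, Fin.ext_iff]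
    rcases lt_trichotomy (i : ℕ) (j : ℕ) with h | h | h
    · have e1 : ¬((j : ℕ) = i) := by omega
      have e2 : ¬((j : ℕ) + 1 = i) := by omega
      have e3 : ¬((i : ℕ) = j) := by omega
      simp only [e1, e2, e3, if_false]
      split_ifs with h'
      · rw [← h']; simp
      · rfl
    · simp [h]
    · have e1 : ¬((j : ℕ) = i) := by omega
      have e2 : ¬((i : ℕ) + 1 = j) := by omega
      have e3 : ¬((i : ℕ) = j) := by omega
      simp only [e1, e2, e3, if_false]
      split_ifs with h'
      · rw [← h']; simp
      · rfl
  rw [h1, h2.roots_charpoly_eq_eigenvalues]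
  simp

theorem nodup_roots_tridiag (hN : 0 < N) : (tridiag a b c N).charpoly.roots.Nodup := by
  have h0 : (tridiag a b c N).charpoly ≠ 0 := (Matrix.charpoly_monic _).ne_zero
  rw [Multiset.nodup_iff_count_le_one]
  intro x
  by_contra! h
  rw [count_roots] at h
  have h1 := (one_lt_rootMultiplicity_iff_isRoot h0).1 h
  exact derivative_eval_ne_zero hbc hN h1.1 h1.2

end

/-! ### Sorted roots -/

/-- The `l`-th largest root of a real polynomial. -/
def sortedRoot (P : ℝ[X]) (l : ℕ) : ℝ := (P.roots.sort (· ≥ ·)).getD l 0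

theorem sortedRoot_lt {P : ℝ[X]} {N : ℕ} (hc : P.roots.card = N) (hn : P.roots.Nodup)
    {k l : ℕ} (hkl : k < l) (hl : l < N) : sortedRoot P l < sortedRoot P k := by
  have hlen : (P.roots.sort (· ≥ ·)).length = N := by rw [Multiset.length_sort, hc]
  unfold sortedRoot
  rw [List.getD_eq_getElem _ _ (by omega : l < _), List.getD_eq_getElem _ _ (by omega : k < _)]
  have h1 := List.pairwise_iff_getElem.1 (Multiset.pairwise_sort P.roots (· ≥ ·)) k l
    (by omega) (by omega) hkl
  refine lt_of_le_of_ne h1 fun h => ?_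
  have hnd : (P.roots.sort (· ≥ ·)).Nodup := by
    rw [← Multiset.coe_nodup, Multiset.sort_eq]; exact hn
  have := (hnd.getElem_inj_iff).1 h
  omega

theorem map_sortedRoot {P : ℝ[X]} {N : ℕ} (hc : P.roots.card = N) :
    (Multiset.range N).map (sortedRoot P) = P.roots := by
  have hlen : (P.roots.sort (· ≥ ·)).length = N := by rw [Multiset.length_sort, hc]
  conv_rhs => rw [← Multiset.sort_eq P.roots (· ≥ ·)]
  rw [← Multiset.coe_range, Multiset.map_coe]
  congr 1
  refine List.ext_getElem (by simp [hlen]) fun i h1 h2 => ?_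
  rw [List.getElem_map, List.getElem_range, sortedRoot, List.getD_eq_getElem _ _ h2]

theorem eq_prod_sortedRoot {P : ℝ[X]} {N : ℕ} (hP : P.Monic) (hd : P.natDegree = N)
    (hc : P.roots.card = N) :
    P = ∏ l ∈ Finset.range N, (X - C (sortedRoot P l)) := by
  have h := prod_multiset_X_sub_C_of_monic_of_roots_card_eq hP (hc.trans hd.symm)
  rw [← map_sortedRoot hc, Multiset.map_map] at h
  exact h.symm

theorem eval_sortedRoot {P : ℝ[X]} {N : ℕ} (hc : P.roots.card = N) {l : ℕ} (hl : l < N) :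
    P.eval (sortedRoot P l) = 0 := by
  have : sortedRoot P l ∈ P.roots := by
    rw [← map_sortedRoot hc]
    exact Multiset.mem_map_of_mem _ (Multiset.mem_range.2 hl)
  exact isRoot_of_mem_roots this

/-- A strictly decreasing list of roots of full length is the list of sorted roots. -/
theorem sortedRoot_eq_of_strictAnti {P : ℝ[X]} {N : ℕ} (h0 : P ≠ 0) (hd : P.natDegree = N)
    {y : ℕ → ℝ} (hy : ∀ k l, k < l → l < N → y l < y k) (hr : ∀ l < N, P.eval (y l) = 0)
    {l : ℕ} (hl : l < N) : sortedRoot P l = y l := by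
  have hinj : ∀ i ∈ List.range N, ∀ j ∈ List.range N, y i = y j → i = j := by
    intro i hi j hj h
    rw [List.mem_range] at hi hj
    rcases lt_trichotomy i j with h' | h' | h'
    · exact absurd h (hy i j h' hj).ne'
    · exact h'
    · exact absurd h (hy j i h' hi).ne
  have hnd : ((List.range N).map y).Nodup := by
    exact List.Nodup.map_on (fun i hi j hj h => hinj i hi j hj h) List.nodup_range
  have hle : (((List.range N).map y : List ℝ) : Multiset ℝ) ≤ P.roots := by
    rw [Multiset.le_iff_subset (Multiset.coe_nodup.2 hnd)]
    intro x hx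
    obtain ⟨i, hi, rfl⟩ := List.mem_map.1 (Multiset.mem_coe.1 hx)
    exact (mem_roots h0).2 (hr i (List.mem_range.1 hi))
  have heq : (((List.range N).map y : List ℝ) : Multiset ℝ) = P.roots := by
    refine Multiset.eq_of_le_of_card_le hle ?_
    simpa [hd] using P.card_roots'
  have hsort : P.roots.sort (· ≥ ·) = (List.range N).map y := by
    refine List.Perm.eq_of_pairwise' (r := (· ≥ ·)) (Multiset.pairwise_sort _ _) ?_ ?_
    · rw [List.pairwise_map]
      refine List.Pairwise.imp_of_mem ?_ List.pairwise_lt_range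
      intro i j _ hj hij
      exact (hy i j hij (List.mem_range.1 hj)).le
    · rw [← Multiset.coe_eq_coe, Multiset.sort_eq, heq]
  rw [sortedRoot, hsort, List.getD_eq_getElem _ _ (by simpa using hl), List.getElem_map,
    List.getElem_range]


/-! ### The elliptic Racah polynomials -/

theorem jacobiMatrix_eq (n m : ℕ) (p : ℝ) (G G' : Fin 4 → ℝ) (k : ℕ) :
    jacobiMatrix n m p G G' k = tridiag (racahA n m p G G') (racahBplus n m p G G')
      (racahBminus n m p G G') k := rfl

theorem racahP_eval (n m : ℕ) (p : ℝ) (G G' : Fin 4 → ℝ) (k : ℕ) (x : ℝ) :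
    (racahP n m p G G' k).eval x = triP (racahA n m p G G') (racahBplus n m p G G')
      (racahBminus n m p G G') k x := rfl

theorem racahRoot_eq (n m : ℕ) (p : ℝ) (G G' : Fin 4 → ℝ) (l : ℕ) :
    racahRoot n m p G G' l = sortedRoot (racahP n m p G G' (n + m)) l := rfl

/-- The left end of the chain closes by itself: the factor `[g_1 - g_1]_1` is zero. -/
theorem racahBminus_zero (n m : ℕ) (p : ℝ) (G G' : Fin 4 → ℝ) :
    racahBminus n m p G G' 0 = 0 := by
  unfold racahBminus
  exact Finset.prod_eq_zero (Finset.mem_univ 0) (by simp [br_zero_zero])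

section
variable {p : ℝ} (hp : |p| < 1) {n m : ℕ} (hn : 1 ≤ n) (hm : 1 ≤ m) {G G' : Fin 4 → ℝ}
  (hG0 : 0 < G 0) (hG1 : 0 < G 1)
  (hG0' : |G' 0| < G 0 + 1 / 2) (hG1' : |G' 1| < G 1 + 1 / 2)
include hp hn hm hG0 hG1 hG0' hG1'

/-- The bounds on `g'_1`, `g'_2` keep the arguments of `[·]_1` in `(0, 2T)` and of `[·]_2` in `(-T,
T)`; `k + 1 < n + m` excludes the zero at the last site. -/
theorem racahBplus_pos {k : ℕ} (hk : k + 1 < n + m) : 0 < racahBplus n m p G G' k := by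
  have hT := one_lt_halfPeriod hn hm hG0 hG1
  have hT0 := halfPeriod_one n m G
  have hk' : (k : ℝ) + 2 ≤ ((n + m : ℕ) : ℝ) := by exact_mod_cast hk
  have hk0 : (0 : ℝ) ≤ k := k.cast_nonneg
  have h0 := abs_lt.1 hG0'
  have h1 := abs_lt.1 hG1'
  simp only [racahBplus, alpha_eq]
  refine Finset.prod_pos fun r _ => ?_
  refine div_pos ?_ (mul_pos (br_pos hp hT (by linarith) (by linarith) r)
    (br_pos hp hT (by linarith) (by linarith) r))
  match r with
  | 0 =>
    exact mul_pos (br_zero_pos hp hT (by linarith) (by linarith))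
      (br_zero_pos hp hT (by linarith) (by linarith))
  | 1 =>
    exact mul_pos (br_one_pos hp hT (by linarith) (by linarith))
      (br_one_pos hp hT (by linarith) (by linarith))
  | 2 => exact mul_pos (br_two_pos hp hT _) (br_two_pos hp hT _)
  | 3 => exact mul_pos (br_three_pos hp hT _) (br_three_pos hp hT _)

theorem racahBminus_pos {k : ℕ} (hk1 : 1 ≤ k) (hk : k < n + m) :
    0 < racahBminus n m p G G' k := by
  have hT := one_lt_halfPeriod hn hm hG0 hG1
  have hT0 := halfPeriod_one n m G
  have hk' : (k : ℝ) + 1 ≤ ((n + m : ℕ) : ℝ) := by exact_mod_cast hk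
  have hk0 : (1 : ℝ) ≤ k := by exact_mod_cast hk1
  have h0 := abs_lt.1 hG0'
  have h1 := abs_lt.1 hG1'
  simp only [racahBminus, alpha_eq]
  refine Finset.prod_pos fun r _ => ?_
  refine div_pos ?_ (mul_pos (br_pos hp hT (by linarith) (by linarith) r)
    (br_pos hp hT (by linarith) (by linarith) r))
  match r with
  | 0 =>
    exact mul_pos (br_zero_pos hp hT (by linarith) (by linarith))
      (br_zero_pos hp hT (by linarith) (by linarith))
  | 1 =>
    exact mul_pos (br_one_pos hp hT (by linarith) (by linarith))
      (br_one_pos hp hT (by linarith) (by linarith))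
  | 2 => exact mul_pos (br_two_pos hp hT _) (br_two_pos hp hT _)
  | 3 => exact mul_pos (br_three_pos hp hT _) (br_three_pos hp hT _)

theorem racahB_mul_pos {k : ℕ} (hk : k + 1 < n + m) :
    0 < racahBplus n m p G G' k * racahBminus n m p G G' (k + 1) :=
  mul_pos (racahBplus_pos hp hn hm hG0 hG1 hG0' hG1' hk)
    (racahBminus_pos hp hn hm hG0 hG1 hG0' hG1' (by omega) hk)

theorem card_roots_racahP : (racahP n m p G G' (n + m)).roots.card = n + m :=
  card_roots_tridiag fun _ hk => racahB_mul_pos hp hn hm hG0 hG1 hG0' hG1' hk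

theorem racahRoot_lt {k l : ℕ} (hkl : k < l) (hl : l < n + m) :
    racahRoot n m p G G' l < racahRoot n m p G G' k :=
  sortedRoot_lt (card_roots_racahP hp hn hm hG0 hG1 hG0' hG1')
    (nodup_roots_tridiag (fun _ hk => racahB_mul_pos hp hn hm hG0 hG1 hG0' hG1' hk) (by omega))
    hkl hl

theorem racahRoot_injOn : Set.InjOn (racahRoot n m p G G') (Set.Iio (n + m)) := by
  intro i hi j hj h
  rcases lt_trichotomy i j with h' | h' | h'
  · exact absurd h (racahRoot_lt hp hn hm hG0 hG1 hG0' hG1' h' hj).ne'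
  · exact h'
  · exact absurd h (racahRoot_lt hp hn hm hG0 hG1 hG0' hG1' h' hi).ne

theorem racahP_eq_prod : racahP n m p G G' (n + m) =
    ∏ l ∈ Finset.range (n + m), (X - C (racahRoot n m p G G' l)) :=
  eq_prod_sortedRoot (Matrix.charpoly_monic _) (natDegree_charpoly_tridiag _ _ _ _)
    (card_roots_racahP hp hn hm hG0 hG1 hG0' hG1')

theorem racahP_eval_racahRoot {l : ℕ} (hl : l < n + m) :
    (racahP n m p G G' (n + m)).eval (racahRoot n m p G G' l) = 0 :=
  eval_sortedRoot (card_roots_racahP hp hn hm hG0 hG1 hG0' hG1') hl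

end

/-! ### Analyticity in the nome -/

section
variable {n m : ℕ} (hn : 1 ≤ n) (hm : 1 ≤ m) {G G' : Fin 4 → ℝ}
  (hG0 : 0 < G 0) (hG1 : 0 < G 1)
include hn hm hG0 hG1

/-- `racahA` is defined as a limit, so its analyticity is read off from the regularized terms
`racahTerm`, whose denominators vanish for no `p`. -/
theorem analyticOnNhd_racahA {k : ℕ} (hk : k < n + m) :
    AnalyticOnNhd ℝ (fun p => racahA n m p G G' k) (Set.Ioo (-1) 1) := by
  have hT := one_lt_halfPeriod hn hm hG0 hG1
  have hN : 2 ≤ n + m := by omega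
  have hb := analyticOnNhd_br hT
  have hd := analyticOnNhd_dbr hT
  refine AnalyticOnNhd.congr isOpen_Ioo (Finset.analyticOnNhd_fun_sum Finset.univ fun r _ => ?_)
    (fun p hp => (racahA_eq (abs_lt.2 hp) hn hm hG0 hG1 hk).symm)
  have h1 : ∀ p ∈ Set.Ioo (-1 : ℝ) 1, br (Real.pi / halfPeriod n m 1 G) p 0 1 *
      dbr (Real.pi / halfPeriod n m 1 G) p 0 0 ≠ 0 := fun p hp =>
    mul_ne_zero (br_one_one (abs_lt.2 hp) (pi_div_pos hT) (pi_div_lt hT)).ne'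
      (dbr_zero_zero_ne (abs_lt.2 hp) hT)
  refine AnalyticOnNhd.mul (analyticOnNhd_const.div ((hb 0 1).mul (hd 0 0)) h1)
    (AnalyticOnNhd.mul ?_ (((hb r _).mul (hd r _)).sub ((hd r _).mul (hb r _))))
  have hc0 : AnalyticOnNhd ℝ (fun p => cRestZero (Real.pi / halfPeriod n m 1 G) p G G')
      (Set.Ioo (-1) 1) :=
    (((hb 0 _).mul ((hb 1 _).mul (hb 1 _))).mul ((hb 2 _).mul (hb 2 _))).mul
      ((hb 3 _).mul (hb 3 _))
  have hc1 : AnalyticOnNhd ℝ (fun p => cRestOne (Real.pi / halfPeriod n m 1 G) p G G')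
      (Set.Ioo (-1) 1) :=
    (((hb 0 _).mul ((hb 1 _).mul (hb 1 _))).mul ((hb 2 _).mul (hb 2 _))).mul
      ((hb 3 _).mul (hb 3 _))
  have hT0 := halfPeriod_one n m G
  by_cases hr0 : r = 0 ∧ k = 0
  · simp only [regCoeff, if_pos hr0]
    refine hc0.div (hb 0 _) fun p hp => ?_
    have := br_add_half_ne (abs_lt.2 hp) hN hG0 hG1 hT0 hk (r := r) (by rw [hr0.1]; simp)
    rwa [hr0.1] at this
  · by_cases hr1 : r = 1 ∧ k + 1 = n + m
    · simp only [regCoeff, if_neg hr0, if_pos hr1]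
      refine AnalyticOnNhd.div (hc1.div ((analyticOnNhd_brNorm _ 0).div (analyticOnNhd_brNorm _ 1)
        fun p hp => brNorm_ne_zero_of_mem hp hT 1) fun p hp => ?_) (hb 1 _) fun p hp => ?_
      · exact div_ne_zero (brNorm_ne_zero_of_mem hp hT 0) (brNorm_ne_zero_of_mem hp hT 1)
      · have := br_sub_half_ne (abs_lt.2 hp) hN hG0 hG1 hT0 hk hr0
        rwa [hr1.1] at this
    · simp only [regCoeff, if_neg hr0, if_neg hr1]
      refine AnalyticOnNhd.div (Finset.analyticOnNhd_fun_prod Finset.univ fun s _ =>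
        (hb s _).mul (hb s _)) ((hb r _).mul (hb r _)) fun p hp => ?_
      exact mul_ne_zero (br_sub_half_ne (abs_lt.2 hp) hN hG0 hG1 hT0 hk hr0)
        (br_add_half_ne (abs_lt.2 hp) hN hG0 hG1 hT0 hk hr1)

theorem analyticOnNhd_racahBplus {k : ℕ} (hk : k + 1 < n + m) :
    AnalyticOnNhd ℝ (fun p => racahBplus n m p G G' k) (Set.Ioo (-1) 1) := by
  have hT := one_lt_halfPeriod hn hm hG0 hG1
  have hT0 := halfPeriod_one n m G
  have hk' : (k : ℝ) + 2 ≤ ((n + m : ℕ) : ℝ) := by exact_mod_cast hk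
  have hk0 : (0 : ℝ) ≤ k := k.cast_nonneg
  have hb := analyticOnNhd_br hT
  refine Finset.analyticOnNhd_fun_prod Finset.univ fun r _ =>
    ((hb r _).mul (hb r _)).div ((hb r _).mul (hb r _)) fun p hp => ?_
  exact mul_ne_zero (br_pos (abs_lt.2 hp) hT (by linarith) (by linarith) r).ne'
    (br_pos (abs_lt.2 hp) hT (by linarith) (by linarith) r).ne'

theorem analyticOnNhd_racahBminus {k : ℕ} (hk1 : 1 ≤ k) (hk : k < n + m) :
    AnalyticOnNhd ℝ (fun p => racahBminus n m p G G' k) (Set.Ioo (-1) 1) := by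
  have hT := one_lt_halfPeriod hn hm hG0 hG1
  have hT0 := halfPeriod_one n m G
  have hk' : (k : ℝ) + 1 ≤ ((n + m : ℕ) : ℝ) := by exact_mod_cast hk
  have hk0 : (1 : ℝ) ≤ k := by exact_mod_cast hk1
  have hb := analyticOnNhd_br hT
  refine Finset.analyticOnNhd_fun_prod Finset.univ fun r _ =>
    ((hb r _).mul (hb r _)).div ((hb r _).mul (hb r _)) fun p hp => ?_
  exact mul_ne_zero (br_pos (abs_lt.2 hp) hT (by linarith) (by linarith) r).ne'
    (br_pos (abs_lt.2 hp) hT (by linarith) (by linarith) r).ne'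

/-- Joint analyticity in nome and spectral parameter, by the recurrence; this is the input for the
implicit function theorem. -/
theorem analyticAt_racahP_eval {k : ℕ} (hk : k ≤ n + m) {x : ℝ × ℝ}
    (hx : x.1 ∈ Set.Ioo (-1 : ℝ) 1) :
    AnalyticAt ℝ (fun x : ℝ × ℝ => (racahP n m x.1 G G' k).eval x.2) x := by
  induction k using Nat.strong_induction_on with
  | _ k ih =>
    match k with
    | 0 =>
      simp only [racahP_eval, triP_zero]
      exact analyticAt_const
    | 1 =>
      simp only [racahP_eval, triP_one]
      exact analyticAt_snd.sub ((analyticOnNhd_racahA hn hm hG0 hG1 (by omega) x.1 hx).comp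
        analyticAt_fst)
    | k + 2 =>
      simp only [racahP_eval, triP_add_two]
      exact ((analyticAt_snd.sub ((analyticOnNhd_racahA hn hm hG0 hG1 (by omega) x.1 hx).comp
        analyticAt_fst)).mul (ih (k + 1) (by omega) (by omega))).sub
        ((((analyticOnNhd_racahBplus hn hm hG0 hG1 (by omega) x.1 hx).comp analyticAt_fst).mul
        ((analyticOnNhd_racahBminus hn hm hG0 hG1 (by omega) (by omega) x.1 hx).comp
          analyticAt_fst)).mul (ih k (by omega) (by omega)))

end

/-! ### Analytic dependence of the roots on the nome -/

/-- Analytic implicit function theorem for a scalar equation. -/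
theorem _root_.AnalyticAt.exists_implicit {f : ℝ × ℝ → ℝ} {a b d : ℝ}
    (hf : AnalyticAt ℝ f (a, b)) (h0 : f (a, b) = 0)
    (hd : HasDerivAt (fun y => f (a, y)) d b) (hd0 : d ≠ 0) :
    ∃ ψ : ℝ → ℝ, AnalyticAt ℝ ψ a ∧ ψ a = b ∧ ∀ᶠ x in 𝓝 a, f (x, ψ x) = 0 := by
  have cdf : ContDiffAt ℝ ⊤ f (a, b) := hf.contDiffAt
  have hne : (⊤ : WithTop ℕ∞) ≠ 0 := by simp
  have hfd := (cdf.differentiableAt hne).hasFDerivAt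
  have hcomp : HasFDerivAt (fun y => f (a, y))
      (fderiv ℝ f (a, b) ∘L .inr ℝ ℝ ℝ) b :=
    hfd.comp b (hasFDerivAt_prodMk_right a b)
  have heq : fderiv ℝ f (a, b) ∘L .inr ℝ ℝ ℝ = ContinuousLinearMap.toSpanSingleton ℝ d :=
    hcomp.unique hd.hasFDerivAt
  have hinv : (fderiv ℝ f (a, b) ∘L .inr ℝ ℝ ℝ).IsInvertible := by
    rw [heq]
    refine ⟨ContinuousLinearEquiv.unitsEquivAut ℝ (Units.mk0 d hd0), ?_⟩
    ext
    simp
  refine ⟨cdf.implicitFunction hne hinv, ?_, cdf.implicitFunction_apply_self hne hinv, ?_⟩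
  · exact (cdf.contDiffAt_implicitFunction hne hinv).analyticAt
  · filter_upwards [cdf.eventually_apply_implicitFunction hne hinv] with x hx
    rw [hx, h0]

/-- Each simple root continues to an analytic branch. The branches stay strictly ordered near `p`
and are as many as the degree, so the `l`-th branch remains the `l`-th largest root. -/
theorem analyticOnNhd_racahRoot {n m : ℕ} (hn : 1 ≤ n) (hm : 1 ≤ m) {G G' : Fin 4 → ℝ}
    (hG0 : 0 < G 0) (hG1 : 0 < G 1)
    (hG0' : |G' 0| < G 0 + 1 / 2) (hG1' : |G' 1| < G 1 + 1 / 2) {l : ℕ} (hl : l < n + m) :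
    AnalyticOnNhd ℝ (fun p => racahRoot n m p G G' l) (Set.Ioo (-1) 1) := by
  intro p hp
  have hp' := abs_lt.2 hp
  have hex : ∀ i : Fin (n + m), ∃ ψ : ℝ → ℝ, AnalyticAt ℝ ψ p ∧ ψ p = racahRoot n m p G G' i ∧
      ∀ᶠ x in 𝓝 p, (racahP n m x G G' (n + m)).eval (ψ x) = 0 := fun i => by
    have h0 := racahP_eval_racahRoot hp' hn hm hG0 hG1 hG0' hG1' i.isLt
    exact AnalyticAt.exists_implicit (f := fun x : ℝ × ℝ => (racahP n m x.1 G G' (n + m)).eval x.2)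
      (analyticAt_racahP_eval hn hm hG0 hG1 le_rfl hp) h0
      ((racahP n m p G G' (n + m)).hasDerivAt _)
      (derivative_eval_ne_zero (fun _ hk => racahB_mul_pos hp' hn hm hG0 hG1 hG0' hG1' hk)
        (by omega) h0)
  choose ψ h1 h2 h3 using hex
  refine (h1 ⟨l, hl⟩).congr ?_
  have hlt : ∀ᶠ x in 𝓝 p, ∀ i j : Fin (n + m), i < j → ψ j x < ψ i x := by
    refine eventually_all.2 fun i => eventually_all.2 fun j => ?_
    by_cases hij : i < j
    · have := (h1 j).continuousAt.eventually_lt (h1 i).continuousAt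
        (by rw [h2, h2]; exact racahRoot_lt hp' hn hm hG0 hG1 hG0' hG1' hij j.isLt)
      exact this.mono fun x hx _ => hx
    · exact Eventually.of_forall fun x h => absurd h hij
  filter_upwards [hlt, eventually_all.2 h3] with x hx1 hx2
  have := sortedRoot_eq_of_strictAnti (P := racahP n m x G G' (n + m)) (N := n + m)
    (y := fun i => if h : i < n + m then ψ ⟨i, h⟩ x else 0) (Matrix.charpoly_monic _).ne_zero
    (natDegree_charpoly_tridiag _ _ _ _)
    (fun k l hkl hl => by
      simp only [dif_pos hl, dif_pos (hkl.trans hl)]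
      exact hx1 _ _ hkl)
    (fun i hi => by simp only [dif_pos hi]; exact hx2 ⟨i, hi⟩) hl
  rw [racahRoot_eq, this, dif_pos hl]


/-! ### The trigonometric case `p = 0` -/

/-- With `u = α(g_1 + k)/2` and `h = α/4` this is `a_k + b_k^+ + b_k^- = const` at `p = 0`,
denominators cleared: constant functions are eigenfunctions. -/
theorem trig_three_term (u h A B c d : ℝ) :
    Real.sin (u + A) * Real.sin (u + c + h) * Real.cos (u + B) * Real.cos (u + d + h) *
        (Real.sin (u - h) * Real.cos (u - h)) +
      Real.sin (u - A) * Real.sin (u - c - h) * Real.cos (u - B) * Real.cos (u - d - h) *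
        (Real.sin (u + h) * Real.cos (u + h)) -
      2 * Real.sin (A - h) * Real.sin c * Real.cos (B - h) * Real.cos d *
        (Real.sin u * Real.cos u * Real.cos (u + h) * Real.cos (u - h)) -
      2 * Real.sin (B - h) * Real.sin d * Real.cos (A - h) * Real.cos c *
        (Real.sin u * Real.cos u * Real.sin (u + h) * Real.sin (u - h)) =
    2 * Real.cos (A + B + c + d) * (Real.sin u * Real.cos u * Real.sin (u + h) *
      Real.sin (u - h) * Real.cos (u + h) * Real.cos (u - h)) := by
  have hu := Real.sin_sq_add_cos_sq u
  have hh := Real.sin_sq_add_cos_sq h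
  simp only [Real.sin_add, Real.cos_add, Real.sin_sub, Real.cos_sub]
  generalize Real.sin u = su at *
  generalize Real.cos u = cu at *
  generalize Real.sin h = sh at *
  generalize Real.cos h = ch at *
  have e1 : su ^ 2 = 1 - cu ^ 2 := by linarith
  have e2 : sh ^ 2 = 1 - ch ^ 2 := by linarith
  grind

/-- Twice the odd part in `u` of the numerator of a forward jump, combining `b^+` and `b^-`. With `D
= a(g_1 + M)` the two summands on the right reproduce the basis functions of index `M + 1` and `M`.
-/
theorem trig_odd_part (u A B C D : ℝ) :
    Real.cos (u + A) * Real.sin (u + B) * Real.cos (u + C) * Real.sin (u + D) -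
      Real.cos (A - u) * Real.sin (B - u) * Real.cos (C - u) * Real.sin (D - u) =
    Real.sin u * Real.cos u * (2 * Real.sin (A + B + C + D) *
      (Real.sin (D + u) * Real.sin (D - u)) +
      2 * Real.cos (D + A) * Real.sin (D + B) * Real.cos (D + C)) := by
  have hu := Real.sin_sq_add_cos_sq u
  have hD := Real.sin_sq_add_cos_sq D
  simp only [Real.sin_add, Real.cos_add, Real.sin_sub, Real.cos_sub]
  generalize Real.sin u = su at *
  generalize Real.cos u = cu at *
  generalize Real.sin D = sD at *
  generalize Real.cos D = cD at *
  grind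

/-- The factor `sin(u+h) cos(u+h)` produced here is what cancels the half-step denominators of
`b^±`. -/
theorem trig_bracket (u h D e : ℝ) :
    Real.sin (D + 2 * h + u) * Real.sin (D - e - 2 * h - u) -
      Real.sin (D - e + u) * Real.sin (D - u) =
    -(2 * Real.sin (u + h) * Real.cos (u + h) * Real.sin (e + 2 * h)) := by
  have h1 := Real.sin_sq_add_cos_sq D
  have h2 := Real.sin_sq_add_cos_sq (u + h)
  have e1 : D + 2 * h + u = D + ((u + h) + h) := by ring
  have e2 : D - e - 2 * h - u = D - ((u + h) + (e + h)) := by ring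
  have e3 : D - e + u = D + ((u + h) - (e + h)) := by ring
  have e4 : D - u = D - ((u + h) - h) := by ring
  have e5 : e + 2 * h = (e + h) + h := by ring
  rw [e1, e2, e3, e4, e5]
  have h3 := Real.sin_sq_add_cos_sq h
  have h4 := Real.sin_sq_add_cos_sq (e + h)
  rw [Real.sin_add D, Real.sin_sub D, Real.sin_add D, Real.sin_sub D]
  simp only [Real.sin_add (u + h), Real.cos_add (u + h), Real.sin_sub (u + h),
    Real.cos_sub (u + h), Real.sin_add (e + h)]
  generalize Real.sin (u + h) = su at *
  generalize Real.cos (u + h) = cu at *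
  generalize Real.sin D = sD at *
  generalize Real.cos D = cD at *
  generalize Real.sin (e + h) = se at *
  generalize Real.cos (e + h) = ce at *
  generalize Real.sin h = sh at *
  generalize Real.cos h = ch at *
  grind

section
variable {α : ℝ}

theorem theta_nome_zero (z : ℝ) : theta 0 0 z = Real.sin z ∧ theta 0 1 z = Real.cos z ∧
    theta 0 2 z = 1 ∧ theta 0 3 z = 1 := by
  rw [theta_zero, theta_one, theta_two, theta_three]
  simp [qprod_zero le_evenExp, qprod_zero le_oddExp]

theorem qsum_nome_zero {e : ℕ → ℕ} (he : ∀ l, l + 1 ≤ e l) (z : ℝ) : qsum e 0 z = 0 := by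
  have h : ∀ l, e l ≠ 0 := fun l => by have := he l; omega
  simp [qsum, h]

theorem dtheta_nome_zero (z : ℝ) : dtheta 0 0 z = Real.cos z ∧ dtheta 0 1 z = -Real.sin z ∧
    dtheta 0 2 z = 0 ∧ dtheta 0 3 z = 0 := by
  simp [dtheta, qprod_zero le_evenExp, qsum_nome_zero le_evenExp, qsum_nome_zero le_oddExp]

theorem brNorm_nome_zero (α : ℝ) : brNorm α 0 0 = Real.sin (α / 2) ∧ brNorm α 0 1 = 1 ∧
    brNorm α 0 2 = 1 ∧ brNorm α 0 3 = 1 := by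
  simp [brNorm, dtheta_nome_zero, theta_nome_zero]

theorem br_nome_zero (α z : ℝ) : br α 0 0 z = Real.sin (α / 2 * z) / Real.sin (α / 2) ∧
    br α 0 1 z = Real.cos (α / 2 * z) ∧ br α 0 2 z = 1 ∧ br α 0 3 z = 1 := by
  have hp : |(0 : ℝ)| < 1 := by simp
  simp only [br_eq hp]
  simp [brNorm_nome_zero, theta_nome_zero]

theorem dbr_nome_zero (α z : ℝ) :
    dbr α 0 0 z = α / 2 * Real.cos (α / 2 * z) / Real.sin (α / 2) ∧
    dbr α 0 1 z = -(α / 2 * Real.sin (α / 2 * z)) ∧ dbr α 0 2 z = 0 ∧ dbr α 0 3 z = 0 := by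
  simp [dbr, brNorm_nome_zero, dtheta_nome_zero]

end

/-- The exponent `(g_1 + g_2 + g'_1 + g'_2)/2`. -/
def halfSum (G G' : Fin 4 → ℝ) : ℝ := (G 0 + G 1 + G' 0 + G' 1) / 2

theorem racahBplus_nome_zero {n m : ℕ} {G G' : Fin 4 → ℝ} (k : ℕ)
    (hs : Real.sin (alpha n m 1 G / 2) ≠ 0) :
    racahBplus n m 0 G G' k =
      Real.sin (alpha n m 1 G / 2 * (G 0 + G 0 + k)) *
        Real.sin (alpha n m 1 G / 2 * (G 0 + G' 0 + 1 / 2 + k)) *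
        Real.cos (alpha n m 1 G / 2 * (G 0 + G 1 + k)) *
        Real.cos (alpha n m 1 G / 2 * (G 0 + G' 1 + 1 / 2 + k)) /
      (Real.sin (alpha n m 1 G / 2 * (G 0 + k)) * Real.sin (alpha n m 1 G / 2 * (G 0 + 1 / 2 + k)) *
        Real.cos (alpha n m 1 G / 2 * (G 0 + k)) *
        Real.cos (alpha n m 1 G / 2 * (G 0 + 1 / 2 + k))) := by
  simp only [racahBplus, Fin.prod_univ_four, br_nome_zero]
  field_simp

theorem racahBminus_nome_zero {n m : ℕ} {G G' : Fin 4 → ℝ} (k : ℕ)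
    (hs : Real.sin (alpha n m 1 G / 2) ≠ 0) :
    racahBminus n m 0 G G' k =
      Real.sin (alpha n m 1 G / 2 * (G 0 - G 0 + k)) *
        Real.sin (alpha n m 1 G / 2 * (G 0 - G' 0 - 1 / 2 + k)) *
        Real.cos (alpha n m 1 G / 2 * (G 0 - G 1 + k)) *
        Real.cos (alpha n m 1 G / 2 * (G 0 - G' 1 - 1 / 2 + k)) /
      (Real.sin (alpha n m 1 G / 2 * (G 0 + k)) * Real.sin (alpha n m 1 G / 2 * (G 0 - 1 / 2 + k)) *
        Real.cos (alpha n m 1 G / 2 * (G 0 + k)) *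
        Real.cos (alpha n m 1 G / 2 * (G 0 - 1 / 2 + k))) := by
  simp only [racahBminus, Fin.prod_univ_four, br_nome_zero]
  field_simp

/-- At nome zero `ϑ₃` and `ϑ₄` are constant, so only two terms survive; the rest is
`trig_three_term`. -/
theorem racahAFormula_nome_zero_eq {n m : ℕ} {G G' : Fin 4 → ℝ} (k : ℕ)
    (hα : alpha n m 1 G ≠ 0)
    (hs : Real.sin (alpha n m 1 G / 2) ≠ 0)
    (h1 : Real.sin (alpha n m 1 G / 2 * (G 0 + k)) ≠ 0)
    (h2 : Real.cos (alpha n m 1 G / 2 * (G 0 + k)) ≠ 0)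
    (h3 : Real.sin (alpha n m 1 G / 2 * (G 0 + k + 1 / 2)) ≠ 0)
    (h4 : Real.cos (alpha n m 1 G / 2 * (G 0 + k + 1 / 2)) ≠ 0)
    (h5 : Real.sin (alpha n m 1 G / 2 * (G 0 + k - 1 / 2)) ≠ 0)
    (h6 : Real.cos (alpha n m 1 G / 2 * (G 0 + k - 1 / 2)) ≠ 0) :
    racahAFormula n m 0 G G' k = 2 * Real.cos (alpha n m 1 G * halfSum G G') -
      racahBplus n m 0 G G' k - racahBminus n m 0 G G' k := by
  have hp : |(0 : ℝ)| < 1 := by simp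
  rw [racahBplus_nome_zero k hs, racahBminus_nome_zero k hs]
  obtain ⟨k0, k1, k2, k3⟩ := klein_one_apply
  simp only [racahAFormula, resC, deriv_br hp, Fin.sum_univ_four, br_nome_zero, dbr_nome_zero,
    cNum_zero, cNum_one, cRestZero, cRestOne]
  generalize alpha n m 1 G = α at *
  have key := trig_three_term (α / 2 * (G 0 + k)) (α / 4) (α / 2 * G 0) (α / 2 * G 1)
    (α / 2 * G' 0) (α / 2 * G' 1)
  have hcot : Real.cos (α / 2 * (G 0 + k + 1 / 2)) * Real.sin (α / 2 * (G 0 + k - 1 / 2)) -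
      Real.cos (α / 2 * (G 0 + k - 1 / 2)) * Real.sin (α / 2 * (G 0 + k + 1 / 2)) =
      -Real.sin (α / 2) := by
    rw [← Real.sin_neg, show -(α / 2) = α / 2 * (G 0 + k - 1 / 2) - α / 2 * (G 0 + k + 1 / 2) by
      ring, Real.sin_sub]
    ring
  simp only [show α / 2 * (G 0 + k) + α / 2 * G 0 = α / 2 * (G 0 + G 0 + k) by ring,
    show α / 2 * (G 0 + k) + α / 2 * G' 0 + α / 4 = α / 2 * (G 0 + G' 0 + 1 / 2 + k) by ring,
    show α / 2 * (G 0 + k) + α / 2 * G 1 = α / 2 * (G 0 + G 1 + k) by ring,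
    show α / 2 * (G 0 + k) + α / 2 * G' 1 + α / 4 = α / 2 * (G 0 + G' 1 + 1 / 2 + k) by ring,
    show α / 2 * (G 0 + k) - α / 4 = α / 2 * (G 0 + k - 1 / 2) by ring,
    show α / 2 * (G 0 + k) + α / 4 = α / 2 * (G 0 + k + 1 / 2) by ring,
    show α / 2 * (G 0 + k) - α / 2 * G 0 = α / 2 * (G 0 - G 0 + k) by ring,
    show α / 2 * (G 0 + k) - α / 2 * G' 0 - α / 4 = α / 2 * (G 0 - G' 0 - 1 / 2 + k) by ring,
    show α / 2 * (G 0 + k) - α / 2 * G 1 = α / 2 * (G 0 - G 1 + k) by ring,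
    show α / 2 * (G 0 + k) - α / 2 * G' 1 - α / 4 = α / 2 * (G 0 - G' 1 - 1 / 2 + k) by ring,
    show α / 2 * G 0 - α / 4 = α / 2 * (G 0 - 1 / 2) by ring,
    show α / 2 * G 1 - α / 4 = α / 2 * (G 1 - 1 / 2) by ring,
    show α / 2 * G 0 + α / 2 * G 1 + α / 2 * G' 0 + α / 2 * G' 1 = α * halfSum G G' by
      unfold halfSum; ring] at key
  simp only [show G 0 + 1 / 2 + (k : ℝ) = G 0 + k + 1 / 2 by ring,
    show G 0 - 1 / 2 + (k : ℝ) = G 0 + k - 1 / 2 by ring, mul_zero, Real.cos_zero, mul_one,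
    zero_div, sub_zero, add_zero]
  generalize Real.sin (α / 2 * (G 0 + k)) = s0 at *
  generalize Real.cos (α / 2 * (G 0 + k)) = c0 at *
  generalize Real.sin (α / 2 * (G 0 + k + 1 / 2)) = sp at *
  generalize Real.cos (α / 2 * (G 0 + k + 1 / 2)) = cp at *
  generalize Real.sin (α / 2 * (G 0 + k - 1 / 2)) = sm at *
  generalize Real.cos (α / 2 * (G 0 + k - 1 / 2)) = cm at *
  generalize Real.sin (α / 2 * (G 0 + G 0 + k)) = t1 at *
  generalize Real.sin (α / 2 * (G 0 + G' 0 + 1 / 2 + k)) = t2 at *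
  generalize Real.cos (α / 2 * (G 0 + G 1 + k)) = t3 at *
  generalize Real.cos (α / 2 * (G 0 + G' 1 + 1 / 2 + k)) = t4 at *
  generalize Real.sin (α / 2 * (G 0 - G 0 + k)) = t5 at *
  generalize Real.sin (α / 2 * (G 0 - G' 0 - 1 / 2 + k)) = t6 at *
  generalize Real.cos (α / 2 * (G 0 - G 1 + k)) = t7 at *
  generalize Real.cos (α / 2 * (G 0 - G' 1 - 1 / 2 + k)) = t8 at *
  generalize Real.sin (α / 2 * (G 0 - 1 / 2)) = t9 at *
  generalize Real.cos (α / 2 * (G 0 - 1 / 2)) = t10 at *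
  generalize Real.sin (α / 2 * (G 1 - 1 / 2)) = t11 at *
  generalize Real.cos (α / 2 * (G 1 - 1 / 2)) = t12 at *
  generalize Real.cos (α * halfSum G G') = t13 at *
  generalize Real.sin (α / 2 * G' 0) = t14 at *
  generalize Real.cos (α / 2 * G' 0) = t15 at *
  generalize Real.sin (α / 2 * G' 1) = t16 at *
  generalize Real.cos (α / 2 * G' 1) = t17 at *
  generalize Real.sin (α / 2) = s at *
  -- Differences of cotangents or tangents at arguments `α/2` apart have numerator `± sin(α/2)`, by
  -- `hcot`.
  have hA : 2 / (s / s * (α / 2 / s)) * (t9 / s * (t14 / s * (t12 * t17))) *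
      (α / 2 * cp / s / (sp / s) - α / 2 * cm / s / (sm / s)) =
      -(2 * t9 * t14 * t12 * t17 / (sp * sm)) := by
    have : α / 2 * cp / s / (sp / s) - α / 2 * cm / s / (sm / s) = -(α / 2 * s / (sp * sm)) := by
      field_simp
      linear_combination hcot
    rw [this]
    field_simp
  have hB : 2 / (s / s * (α / 2 / s)) * (t11 / s * (t16 / s * (t10 * t15))) *
      (-(α / 2 * sp) / cp - -(α / 2 * sm) / cm) =
      -(2 * t11 * t16 * t10 * t15 / (cp * cm)) := by
    have : -(α / 2 * sp) / cp - -(α / 2 * sm) / cm = -(α / 2 * s / (cp * cm)) := by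
      field_simp
      linear_combination hcot
    rw [this]
    field_simp
  rw [hA, hB]
  field_simp
  linear_combination key


section
variable {n m : ℕ} (hn : 1 ≤ n) (hm : 1 ≤ m) {G G' : Fin 4 → ℝ} (hG0 : 0 < G 0) (hG1 : 0 < G 1)
include hn hm hG0 hG1

theorem alpha_pos : 0 < alpha n m 1 G := pi_div_pos (one_lt_halfPeriod hn hm hG0 hG1)

theorem alpha_mul_halfPeriod : alpha n m 1 G * halfPeriod n m 1 G = Real.pi := by
  have := one_lt_halfPeriod hn hm hG0 hG1
  rw [alpha_eq]; field_simp

theorem sin_alpha_pos {z : ℝ} (h0 : 0 < z) (h1 : z < 2 * halfPeriod n m 1 G) :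
    0 < Real.sin (alpha n m 1 G / 2 * z) := by
  have h2 := alpha_pos hn hm hG0 hG1
  have h3 := alpha_mul_halfPeriod hn hm hG0 hG1
  refine Real.sin_pos_of_pos_of_lt_pi (by positivity) ?_
  nlinarith

theorem cos_alpha_pos {z : ℝ} (h0 : -halfPeriod n m 1 G < z) (h1 : z < halfPeriod n m 1 G) :
    0 < Real.cos (alpha n m 1 G / 2 * z) := by
  have h2 := alpha_pos hn hm hG0 hG1
  have h3 := alpha_mul_halfPeriod hn hm hG0 hG1
  refine Real.cos_pos_of_mem_Ioo ⟨?_, ?_⟩ <;> nlinarith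

theorem cos_alpha_halfPeriod : Real.cos (alpha n m 1 G / 2 * halfPeriod n m 1 G) = 0 := by
  have h3 := alpha_mul_halfPeriod hn hm hG0 hG1
  rw [show alpha n m 1 G / 2 * halfPeriod n m 1 G = Real.pi / 2 by linarith, Real.cos_pi_div_two]

theorem racahAFormula_nome_zero {k : ℕ} (hk : k < n + m) (hr : G ∈ regularSet) :
    racahAFormula n m 0 G G' k = 2 * Real.cos (alpha n m 1 G * halfSum G G') -
      racahBplus n m 0 G G' k - racahBminus n m 0 G G' k := by
  have hT0 := halfPeriod_one n m G
  have hT := one_lt_halfPeriod hn hm hG0 hG1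
  have hk' : (k : ℝ) + 1 ≤ ((n + m : ℕ) : ℝ) := by exact_mod_cast hk
  have hk0 : (0 : ℝ) ≤ k := k.cast_nonneg
  have hα := alpha_pos hn hm hG0 hG1
  have hs : Real.sin (alpha n m 1 G / 2) ≠ 0 := by
    have := sin_alpha_pos hn hm hG0 hG1 (z := 1) (by norm_num) (by linarith)
    rw [mul_one] at this
    exact this.ne'
  refine racahAFormula_nome_zero_eq k hα.ne' hs
    (sin_alpha_pos hn hm hG0 hG1 (by linarith) (by linarith)).ne'
    (cos_alpha_pos hn hm hG0 hG1 (by linarith) (by linarith)).ne'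
    (sin_alpha_pos hn hm hG0 hG1 (by linarith) (by linarith)).ne' ?_ ?_
    (cos_alpha_pos hn hm hG0 hG1 (by linarith) (by linarith)).ne'
  · by_cases hkN : k + 1 = n + m
    · have hkN' : (k : ℝ) + 1 = ((n + m : ℕ) : ℝ) := by exact_mod_cast hkN
      have h3 := alpha_mul_halfPeriod hn hm hG0 hG1
      rw [show G 0 + (k : ℝ) + 1 / 2 = halfPeriod n m 1 G - (G 1 - 1 / 2) by linarith, mul_sub,
        show alpha n m 1 G / 2 * halfPeriod n m 1 G = Real.pi / 2 by linarith,
        Real.cos_pi_div_two_sub]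
      rcases lt_or_gt_of_ne hr.2 with h | h
      · have := sin_alpha_pos hn hm hG0 hG1 (z := -(G 1 - 1 / 2)) (by linarith) (by linarith)
        rw [mul_neg, Real.sin_neg] at this
        linarith
      · exact (sin_alpha_pos hn hm hG0 hG1 (by linarith) (by linarith)).ne'
    · have hkN' : (k : ℝ) + 2 ≤ ((n + m : ℕ) : ℝ) := by exact_mod_cast (by omega : k + 2 ≤ n + m)
      exact (cos_alpha_pos hn hm hG0 hG1 (by linarith) (by linarith)).ne'
  · by_cases hk1 : k = 0
    · subst hk1
      rw [Nat.cast_zero, add_zero]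
      rcases lt_or_gt_of_ne hr.1 with h | h
      · have := sin_alpha_pos hn hm hG0 hG1 (z := -(G 0 - 1 / 2)) (by linarith) (by linarith)
        rw [mul_neg, Real.sin_neg] at this
        linarith
      · exact (sin_alpha_pos hn hm hG0 hG1 (by linarith) (by linarith)).ne'
    · have : (1 : ℝ) ≤ k := by exact_mod_cast Nat.one_le_iff_ne_zero.2 hk1
      exact (sin_alpha_pos hn hm hG0 hG1 (by linarith) (by linarith)).ne'

omit hG0 hG1 in
-- The truncation condition at work: at the last site the argument `g_1 + g_2 + k` is the half
-- period `π / α`, a zero of `[·]_2`.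
theorem racahBplus_last {p : ℝ} (hp : |p| < 1) (hG0 : 0 < G 0) (hG1 : 0 < G 1) {k : ℕ}
    (hk : k + 1 = n + m) : racahBplus n m p G G' k = 0 := by
  have hkN' : (k : ℝ) + 1 = ((n + m : ℕ) : ℝ) := by exact_mod_cast hk
  have hT0 := halfPeriod_one n m G
  refine Finset.prod_eq_zero (Finset.mem_univ 1) ?_
  rw [show G 0 + G 1 + (k : ℝ) = halfPeriod n m 1 G by linarith, alpha_eq,
    br_one_T hp (one_lt_halfPeriod hn hm hG0 hG1)]
  simp

theorem tendsto_racahB {p : ℝ} (hp : |p| < 1) {k : ℕ} (hk : k < n + m) :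
    Tendsto (fun H => racahBplus n m p H G' k) (𝓝[regularSet] G) (𝓝 (racahBplus n m p G G' k)) ∧
    Tendsto (fun H => racahBminus n m p H G' k) (𝓝[regularSet] G)
      (𝓝 (racahBminus n m p G G' k)) := by
  have hN : 2 ≤ n + m := by omega
  have hT0 := halfPeriod_one n m G
  have hT1 := one_lt_halfPeriod hn hm hG0 hG1
  have hk' : (k : ℝ) + 1 ≤ ((n + m : ℕ) : ℝ) := by exact_mod_cast hk
  have hk0 : (0 : ℝ) ≤ k := k.cast_nonneg
  have hH : ∀ i, Tendsto (fun H : Fin 4 → ℝ => H i) (𝓝[regularSet] G) (𝓝 (G i)) := fun i =>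
    ((continuous_apply i).tendsto G).mono_left nhdsWithin_le_nhds
  have hT : Tendsto (halfPeriod n m 1) (𝓝[regularSet] G) (𝓝 (halfPeriod n m 1 G)) :=
    ((hH 0).const_add _).add (hH 1)
  have hbr : ∀ (r) {z : (Fin 4 → ℝ) → ℝ} {z₀ : ℝ},
      Tendsto z (𝓝[regularSet] G) (𝓝 z₀) → Tendsto
      (fun H => br (Real.pi / halfPeriod n m 1 H) p r (z H))
      (𝓝[regularSet] G) (𝓝 (br (Real.pi / halfPeriod n m 1 G) p r z₀)) :=
    fun r _ _ hz => tendsto_br_pi_div hp hN hG0 hG1 hT0 hT hz r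
  have hpos0 : ∀ᶠ H : Fin 4 → ℝ in 𝓝[regularSet] G, 0 < H 0 := (hH 0).eventually_const_lt hG0
  have hpos1 : ∀ᶠ H : Fin 4 → ℝ in 𝓝[regularSet] G, 0 < H 1 := (hH 1).eventually_const_lt hG1
  constructor
  -- At the last site a denominator vanishes for `g_2 = 1/2`, but the numerator is identically zero,
  -- so constancy replaces continuity. The same happens at site `0` for `b^-`.
  · by_cases hkN : k + 1 = n + m
    · rw [racahBplus_last hn hm hp hG0 hG1 hkN]
      refine tendsto_const_nhds.congr' ?_
      filter_upwards [hpos0, hpos1] with H h0 h1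
      rw [racahBplus_last hn hm hp h0 h1 hkN]
    · have hkN' : (k : ℝ) + 2 ≤ ((n + m : ℕ) : ℝ) := by exact_mod_cast (by omega : k + 2 ≤ n + m)
      refine tendsto_finsetProd _ fun r _ => Tendsto.div
        ((hbr r (((hH 0).add (hH r)).add_const _)).mul
          (hbr r ((((hH 0).add_const _).add_const _).add_const _)))
        ((hbr r ((hH 0).add_const _)).mul (hbr r (((hH 0).add_const _).add_const _))) ?_
      exact mul_ne_zero (br_pos hp hT1 (by linarith) (by linarith) r).ne'
        (br_pos hp hT1 (by linarith) (by linarith) r).ne'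
  · by_cases hk1 : k = 0
    · subst hk1
      simp only [racahBminus_zero]
      exact tendsto_const_nhds
    · have : (1 : ℝ) ≤ k := by exact_mod_cast Nat.one_le_iff_ne_zero.2 hk1
      refine tendsto_finsetProd _ fun r _ => Tendsto.div
        ((hbr r (((hH 0).sub (hH r)).add_const _)).mul
          (hbr r ((((hH 0).sub_const _).sub_const _).add_const _)))
        ((hbr r ((hH 0).add_const _)).mul (hbr r (((hH 0).sub_const _).add_const _))) ?_
      exact mul_ne_zero (br_pos hp hT1 (by linarith) (by linarith) r).ne'
        (br_pos hp hT1 (by linarith) (by linarith) r).ne'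

/-- Passing to the limit over regular couplings extends the identity to `g_1 = 1/2` and `g_2 = 1/2`.
-/
theorem racahA_nome_zero {k : ℕ} (hk : k < n + m) :
    racahA n m 0 G G' k = 2 * Real.cos (alpha n m 1 G * halfSum G G') -
      racahBplus n m 0 G G' k - racahBminus n m 0 G G' k := by
  have hp : |(0 : ℝ)| < 1 := by simp
  have hH : ∀ i, Tendsto (fun H : Fin 4 → ℝ => H i) (𝓝[regularSet] G) (𝓝 (G i)) := fun i =>
    ((continuous_apply i).tendsto G).mono_left nhdsWithin_le_nhds
  have hT : Tendsto (halfPeriod n m 1) (𝓝[regularSet] G) (𝓝 (halfPeriod n m 1 G)) :=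
    ((hH 0).const_add _).add (hH 1)
  have ha := tendsto_pi_div (by omega : 2 ≤ n + m) hG0 hG1 (halfPeriod_one n m G) hT
  have hs : Tendsto (fun H => halfSum H G') (𝓝[regularSet] G) (𝓝 (halfSum G G')) :=
    ((((hH 0).add (hH 1)).add_const _).add_const _).div_const _
  obtain ⟨hbp, hbm⟩ := tendsto_racahB hn hm hG0 hG1 hp (G' := G') hk
  have key := ((((Real.continuous_cos.tendsto _).comp (ha.mul hs)).const_mul 2).sub hbp).sub hbm
  refine Tendsto.limUnder_eq (key.congr' ?_)
  have hpos0 : ∀ᶠ H : Fin 4 → ℝ in 𝓝[regularSet] G, 0 < H 0 := (hH 0).eventually_const_lt hG0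
  have hpos1 : ∀ᶠ H : Fin 4 → ℝ in 𝓝[regularSet] G, 0 < H 1 := (hH 1).eventually_const_lt hG1
  filter_upwards [hpos0, hpos1, self_mem_nhdsWithin] with H h0 h1 h2
  rw [racahAFormula_nome_zero hn hm h0 h1 hk h2]
  rfl

end

/-! ### Diagonalization at nome zero in the Askey–Wilson basis -/

/-- The Askey–Wilson basis functions `∏_{i<k} sin(a(g+i+x)) sin(a(g+i-x))`. -/
def awBasis (a g : ℝ) (k : ℕ) (x : ℝ) : ℝ :=
  ∏ i ∈ Finset.range k, Real.sin (a * (g + i + x)) * Real.sin (a * (g + i - x))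

theorem awBasis_succ (a g : ℝ) (k : ℕ) (x : ℝ) : awBasis a g (k + 1) x =
    awBasis a g k x * (Real.sin (a * (g + k + x)) * Real.sin (a * (g + k - x))) :=
  Finset.prod_range_succ _ _

theorem awBasis_neg (a g : ℝ) (k : ℕ) (x : ℝ) : awBasis a g k (-x) = awBasis a g k x :=
  Finset.prod_congr rfl fun i _ => by
    rw [sub_neg_eq_add, ← sub_eq_add_neg, mul_comm]

/-- Under `x ↦ x + 1` one family of factors moves up an index and the other moves down, so only end
factors change. The multiplier `sin(a(g + x))` avoids a division. -/
theorem awBasis_shift (a g : ℝ) (k : ℕ) (x : ℝ) :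
    awBasis a g (k + 1) (x + 1) * Real.sin (a * (g + x)) =
      awBasis a g k x * (Real.sin (a * (g + k + x)) * Real.sin (a * (g + k + 1 + x)) *
        Real.sin (a * (g - 1 - x))) := by
  induction k with
  | zero =>
    simp only [awBasis, Finset.prod_range_succ, Finset.prod_range_zero, Nat.cast_zero, add_zero,
      zero_add, one_mul]
    rw [show g + (x + 1) = g + 1 + x by ring, show g - (x + 1) = g - 1 - x by ring]
    ring
  | succ k ih =>
    rw [awBasis_succ, mul_right_comm, ih, awBasis_succ]
    push_cast
    rw [show g + ((k : ℝ) + 1) + (x + 1) = g + ((k : ℝ) + 1) + 1 + x by ring,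
      show g + ((k : ℝ) + 1) - (x + 1) = g + k - x by ring,
      show g + (k : ℝ) + 1 + x = g + ((k : ℝ) + 1) + x by ring]
    ring

/-- The difference `φ_{k+1}(x+1) - φ_{k+1}(x)` of Askey–Wilson basis functions. -/
theorem awBasis_difference (a g : ℝ) (k : ℕ) (x : ℝ) :
    Real.sin (a * (g + x)) * (awBasis a g (k + 1) (x + 1) - awBasis a g (k + 1) x) =
      -(2 * Real.sin (a * (x + 1 / 2)) * Real.cos (a * (x + 1 / 2)) * Real.sin (a * (k + 1))) *
        (awBasis a g k x * Real.sin (a * (g + k + x))) := by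
  have h1 := awBasis_shift a g k x
  have h2 := trig_bracket (a * x) (a / 2) (a * (g + k)) (a * k)
  rw [show a * (g + (k : ℝ)) + 2 * (a / 2) + a * x = a * (g + k + 1 + x) by ring,
    show a * (g + (k : ℝ)) - a * k - 2 * (a / 2) - a * x = a * (g - 1 - x) by ring,
    show a * (g + (k : ℝ)) - a * k + a * x = a * (g + x) by ring,
    show a * (g + (k : ℝ)) - a * x = a * (g + k - x) by ring,
    show a * x + a / 2 = a * (x + 1 / 2) by ring,
    show a * (k : ℝ) + 2 * (a / 2) = a * (k + 1) by ring] at h2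
  rw [mul_sub, mul_comm, h1, awBasis_succ]
  linear_combination (awBasis a g k x * Real.sin (a * (g + k + x))) * h2

/-- Makes the matrix of basis functions evaluated at the sites triangular. -/
theorem awBasis_node_eq_zero (a g : ℝ) {k l : ℕ} (h : l < k) : awBasis a g k (g + l) = 0 := by
  refine Finset.prod_eq_zero (Finset.mem_range.2 h) ?_
  simp


/-- The vanishing end coefficients allow `f` to be any function on `ℕ`: its value at `N` and the
truncated index `k - 1` at `k = 0` are multiplied by zero. -/
theorem tridiag_mulVec (a b c : ℕ → ℝ) {N : ℕ} (f : ℕ → ℝ) (k : Fin N)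
    (hb : (k : ℕ) + 1 = N → b k = 0) (hc : (k : ℕ) = 0 → c 0 = 0) :
    ∑ i : Fin N, tridiag a b c N k i * f i =
      a k * f k + b k * f (k + 1) + c k * f (k - 1) := by
  have hk := k.isLt
  have h1 : ∀ i : Fin N, tridiag a b c N k i * f i =
      (if (i : ℕ) = k then a k * f k else 0) + (if (i : ℕ) = k + 1 then b k * f (k + 1) else 0) +
        (if (i : ℕ) + 1 = k then c k * f (k - 1) else 0) := fun i => by
    simp only [tridiag, Fin.ext_iff]
    by_cases e1 : (i : ℕ) = k
    · simp [e1]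
    · by_cases e2 : (i : ℕ) = k + 1
      · simp [e2]; intro h; omega
      · by_cases e3 : (i : ℕ) + 1 = k
        · have e4 : ¬((k : ℕ) = i) := by omega
          have e5 : ¬((k : ℕ) + 1 = i) := by omega
          have e6 : (k : ℕ) - 1 = i := by omega
          simp [e1, e2, e3, e4, e5, e6]
        · have e4 : ¬((k : ℕ) = i) := by omega
          have e5 : ¬((k : ℕ) + 1 = i) := by omega
          simp [e1, e2, e3, e4, e5]
  simp_rw [h1]
  rw [Finset.sum_add_distrib, Finset.sum_add_distrib,
    Fin.sum_univ_eq_sum_range (fun i => if i = (k : ℕ) then a k * f k else 0),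
    Fin.sum_univ_eq_sum_range (fun i => if i = (k : ℕ) + 1 then b k * f (k + 1) else 0),
    Fin.sum_univ_eq_sum_range (fun i => if i + 1 = (k : ℕ) then c k * f (k - 1) else 0)]
  congr 1
  · congr 1
    · simp
    · by_cases h : (k : ℕ) + 1 = N
      · simp [hb h]
      · simp; intro h'; omega
  · by_cases h : (k : ℕ) = 0
    · rw [h, hc h]; simp
    · obtain ⟨j, hj⟩ : ∃ j, (k : ℕ) = j + 1 := ⟨k - 1, by omega⟩
      simp only [hj, Nat.add_right_cancel_iff]
      simp
      intro h'; omega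

/-- The roots of the Racah polynomial at `p = 0`. -/
def trigRoot (n m : ℕ) (G G' : Fin 4 → ℝ) (l : ℕ) : ℝ :=
  2 * Real.cos (alpha n m 1 G * (halfSum G G' + l))

section
variable {n m : ℕ} (hn : 1 ≤ n) (hm : 1 ≤ m) {G G' : Fin 4 → ℝ} (hG0 : 0 < G 0) (hG1 : 0 < G 1)
include hn hm hG0 hG1

theorem sin_alpha_ne : Real.sin (alpha n m 1 G / 2) ≠ 0 := by
  have hT := one_lt_halfPeriod hn hm hG0 hG1
  have := sin_alpha_pos hn hm hG0 hG1 (z := 1) (by norm_num) (by linarith)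
  rw [mul_one] at this
  exact this.ne'

/-- The half-step denominator of `b_k^+` cancels against `awBasis_difference`, and `sin(ax) cos(ax)`
clears the rest. At the last site both sides vanish because `a(x + g_2) = π/2`. -/
theorem racahBplus_mul_difference {k : ℕ} (hk : k < n + m) (M : ℕ) {a x : ℝ}
    (ha : a = alpha n m 1 G / 2) (hx : x = G 0 + k) :
    racahBplus n m 0 G G' k * (awBasis a (G 0) (M + 1) (x + 1) - awBasis a (G 0) (M + 1) x) *
      (Real.sin (a * x) * Real.cos (a * x)) =
    -(2 * Real.sin (a * (M + 1)) * awBasis a (G 0) M x *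
      (Real.cos (a * x + a * G 1) * Real.sin (a * x + a * (G' 0 + 1 / 2)) *
        Real.cos (a * x + a * (G' 1 + 1 / 2)) * Real.sin (a * x + a * (G 0 + M)))) := by
  have hp : |(0 : ℝ)| < 1 := by simp
  have hT0 := halfPeriod_one n m G
  have hk0 : (0 : ℝ) ≤ k := k.cast_nonneg
  by_cases hkN : k + 1 = n + m
  · have hk' : (k : ℝ) + 1 = ((n + m : ℕ) : ℝ) := by exact_mod_cast hkN
    have h1 : a * x + a * G 1 = alpha n m 1 G / 2 * halfPeriod n m 1 G := by
      rw [ha, hx, hT0, ← hk']; ring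
    rw [racahBplus_last hn hm hp hG0 hG1 hkN, h1, cos_alpha_halfPeriod hn hm hG0 hG1]
    ring
  · have hk' : (k : ℝ) + 2 ≤ ((n + m : ℕ) : ℝ) := by exact_mod_cast (by omega : k + 2 ≤ n + m)
    have hd := awBasis_difference a (G 0) M x
    rw [racahBplus_nome_zero k (sin_alpha_ne hn hm hG0 hG1), ← ha,
      show G 0 + G 0 + (k : ℝ) = G 0 + x by rw [hx]; ring,
      show a * (G 0 + G' 0 + 1 / 2 + k) = a * x + a * (G' 0 + 1 / 2) by rw [hx]; ring,
      show a * (G 0 + G 1 + k) = a * x + a * G 1 by rw [hx]; ring,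
      show a * (G 0 + G' 1 + 1 / 2 + k) = a * x + a * (G' 1 + 1 / 2) by rw [hx]; ring,
      show G 0 + 1 / 2 + (k : ℝ) = x + 1 / 2 by rw [hx]; ring, ← hx,
      show a * x + a * (G 0 + M) = a * (G 0 + M + x) by ring]
    have s1 : Real.sin (a * x) ≠ 0 := by
      rw [ha, hx]; exact (sin_alpha_pos hn hm hG0 hG1 (by linarith) (by linarith)).ne'
    have s2 : Real.sin (a * (x + 1 / 2)) ≠ 0 := by
      rw [ha, hx]; exact (sin_alpha_pos hn hm hG0 hG1 (by linarith) (by linarith)).ne'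
    have c1 : Real.cos (a * x) ≠ 0 := by
      rw [ha, hx]; exact (cos_alpha_pos hn hm hG0 hG1 (by linarith) (by linarith)).ne'
    have c2 : Real.cos (a * (x + 1 / 2)) ≠ 0 := by
      rw [ha, hx]; exact (cos_alpha_pos hn hm hG0 hG1 (by linarith) (by linarith)).ne'
    generalize Real.sin (a * x) = v1 at *
    generalize Real.cos (a * x) = v2 at *
    generalize Real.sin (a * (x + 1 / 2)) = v3 at *
    generalize Real.cos (a * (x + 1 / 2)) = v4 at *
    generalize Real.sin (a * (G 0 + x)) = v5 at *
    generalize Real.sin (a * (G 0 + M + x)) = v6 at *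
    generalize Real.sin (a * (M + 1)) = v7 at *
    generalize Real.cos (a * x + a * G 1) = v8 at *
    generalize Real.cos (a * x + a * (G' 1 + 1 / 2)) = v9 at *
    generalize Real.sin (a * x + a * (G' 0 + 1 / 2)) = v10 at *
    generalize awBasis a (G 0) M x = v11 at *
    generalize awBasis a (G 0) (M + 1) x = v12 at *
    generalize awBasis a (G 0) (M + 1) (x + 1) = v13 at *
    field_simp
    linear_combination (v10 * v8 * v9) * hd

/-- The forward case reflected by `x ↦ -x`, the basis functions being even. At site `0` the right
side vanishes too: through a sine if `M = 0`, through the basis function otherwise. -/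
theorem racahBminus_mul_difference {k : ℕ} (hk : k < n + m) (M : ℕ) {a x : ℝ}
    (ha : a = alpha n m 1 G / 2) (hx : x = G 0 + k) :
    racahBminus n m 0 G G' k * (awBasis a (G 0) (M + 1) (x - 1) - awBasis a (G 0) (M + 1) x) *
      (Real.sin (a * x) * Real.cos (a * x)) =
    2 * Real.sin (a * (M + 1)) * awBasis a (G 0) M x *
      (Real.cos (a * G 1 - a * x) * Real.sin (a * (G' 0 + 1 / 2) - a * x) *
        Real.cos (a * (G' 1 + 1 / 2) - a * x) * Real.sin (a * (G 0 + M) - a * x)) := by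
  have hT0 := halfPeriod_one n m G
  by_cases hk1 : k = 0
  · subst hk1
    rw [racahBminus_zero]
    rcases Nat.eq_zero_or_pos M with hM | hM
    · have : a * (G 0 + (M : ℝ)) - a * x = 0 := by rw [hM, hx]; simp
      rw [this, Real.sin_zero]; ring
    · have := awBasis_node_eq_zero a (G 0) hM
      rw [hx, this]; ring
  · have hk0 : (1 : ℝ) ≤ k := by exact_mod_cast Nat.one_le_iff_ne_zero.2 hk1
    have hk' : (k : ℝ) + 1 ≤ ((n + m : ℕ) : ℝ) := by exact_mod_cast hk
    have hd := awBasis_difference a (G 0) M (-x)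
    rw [show -x + 1 = -(x - 1) by ring, awBasis_neg, awBasis_neg, awBasis_neg,
      ← sub_eq_add_neg] at hd
    rw [show a * (-x + 1 / 2) = -(a * (x - 1 / 2)) by ring, Real.sin_neg, Real.cos_neg,
      ← sub_eq_add_neg] at hd
    rw [racahBminus_nome_zero k (sin_alpha_ne hn hm hG0 hG1), ← ha,
      show a * (G 0 - G 0 + (k : ℝ)) = -(a * (G 0 - x)) by rw [hx]; ring,
      show a * (G 0 - G' 0 - 1 / 2 + k) = -(a * (G' 0 + 1 / 2) - a * x) by rw [hx]; ring,
      show a * (G 0 - G 1 + k) = -(a * G 1 - a * x) by rw [hx]; ring,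
      show a * (G 0 - G' 1 - 1 / 2 + k) = -(a * (G' 1 + 1 / 2) - a * x) by rw [hx]; ring,
      show G 0 - 1 / 2 + (k : ℝ) = x - 1 / 2 by rw [hx]; ring, ← hx,
      show a * (G 0 + M) - a * x = a * (G 0 + M - x) by ring,
      Real.sin_neg, Real.sin_neg, Real.cos_neg, Real.cos_neg]
    have s1 : Real.sin (a * x) ≠ 0 := by
      rw [ha, hx]; exact (sin_alpha_pos hn hm hG0 hG1 (by linarith) (by linarith)).ne'
    have s2 : Real.sin (a * (x - 1 / 2)) ≠ 0 := by
      rw [ha, hx]; exact (sin_alpha_pos hn hm hG0 hG1 (by linarith) (by linarith)).ne'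
    have c1 : Real.cos (a * x) ≠ 0 := by
      rw [ha, hx]; exact (cos_alpha_pos hn hm hG0 hG1 (by linarith) (by linarith)).ne'
    have c2 : Real.cos (a * (x - 1 / 2)) ≠ 0 := by
      rw [ha, hx]; exact (cos_alpha_pos hn hm hG0 hG1 (by linarith) (by linarith)).ne'
    generalize Real.sin (a * x) = v1 at *
    generalize Real.cos (a * x) = v2 at *
    generalize Real.sin (a * (x - 1 / 2)) = v3 at *
    generalize Real.cos (a * (x - 1 / 2)) = v4 at *
    generalize Real.sin (a * (G 0 - x)) = v5 at *
    generalize Real.sin (a * (G 0 + M - x)) = v6 at *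
    generalize Real.sin (a * (M + 1)) = v7 at *
    generalize Real.cos (a * G 1 - a * x) = v8 at *
    generalize Real.cos (a * (G' 1 + 1 / 2) - a * x) = v9 at *
    generalize Real.sin (a * (G' 0 + 1 / 2) - a * x) = v10 at *
    generalize awBasis a (G 0) M x = v11 at *
    generalize awBasis a (G 0) (M + 1) x = v12 at *
    generalize awBasis a (G 0) (M + 1) (x - 1) = v13 at *
    field_simp
    linear_combination (v10 * v8 * v9) * hd

/-- The one-particle operator at `p = 0` is bidiagonal in the Askey–Wilson basis. -/
theorem exists_bidiagonal : ∃ d : ℕ → ℝ, ∀ k < n + m, ∀ M : ℕ,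
    racahA n m 0 G G' k * awBasis (alpha n m 1 G / 2) (G 0) M (G 0 + k) +
      racahBplus n m 0 G G' k * awBasis (alpha n m 1 G / 2) (G 0) M (G 0 + k + 1) +
      racahBminus n m 0 G G' k * awBasis (alpha n m 1 G / 2) (G 0) M (G 0 + k - 1) =
    trigRoot n m G G' M * awBasis (alpha n m 1 G / 2) (G 0) M (G 0 + k) +
      (if M = 0 then 0 else d M * awBasis (alpha n m 1 G / 2) (G 0) (M - 1) (G 0 + k)) := by
  set a := alpha n m 1 G / 2 with ha
  -- The coefficient of the lower basis function is the second summand of `trig_odd_part`, taken at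
  -- `D = a(g_1 + M - 1)`.
  refine ⟨fun M => -(4 * Real.sin (a * M) * Real.cos (a * (G 0 + (M - 1)) + a * G 1) *
    Real.sin (a * (G 0 + (M - 1)) + a * (G' 0 + 1 / 2)) *
    Real.cos (a * (G 0 + (M - 1)) + a * (G' 1 + 1 / 2))), fun k hk M => ?_⟩
  -- Eliminating `a_k` leaves the differences of the basis function along the two jumps.
  rw [racahA_nome_zero hn hm hG0 hG1 hk]
  match M with
  | 0 =>
    simp only [awBasis, Finset.range_zero, Finset.prod_empty, trigRoot, Nat.cast_zero, add_zero,
      if_true]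
    ring
  | M + 1 =>
    have hT0 := halfPeriod_one n m G
    have hk0 : (0 : ℝ) ≤ k := k.cast_nonneg
    have hk' : (k : ℝ) + 1 ≤ ((n + m : ℕ) : ℝ) := by exact_mod_cast hk
    have e1 := racahBplus_mul_difference hn hm hG0 hG1 (G' := G') hk M ha rfl
    have e2 := racahBminus_mul_difference hn hm hG0 hG1 (G' := G') hk M ha rfl
    have e3 := trig_odd_part (a * (G 0 + k)) (a * G 1) (a * (G' 0 + 1 / 2)) (a * (G' 1 + 1 / 2))
      (a * (G 0 + M))
    have e4 := awBasis_succ a (G 0) M (G 0 + k)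
    have hsum : a * G 1 + a * (G' 0 + 1 / 2) + a * (G' 1 + 1 / 2) + a * (G 0 + M) =
        alpha n m 1 G * halfSum G G' + a * (M + 1) := by
      rw [ha]; unfold halfSum; ring
    have e5 : trigRoot n m G G' (M + 1) = 2 * Real.cos (alpha n m 1 G * halfSum G G') -
        4 * Real.sin (a * (M + 1)) * Real.sin (alpha n m 1 G * halfSum G G' + a * (M + 1)) := by
      rw [trigRoot, show alpha n m 1 G * (halfSum G G' + ((M + 1 : ℕ) : ℝ)) =
        (alpha n m 1 G * halfSum G G' + a * (M + 1)) + a * (M + 1) by rw [ha]; push_cast; ring]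
      have : Real.cos (alpha n m 1 G * halfSum G G') =
        Real.cos ((alpha n m 1 G * halfSum G G' + a * (M + 1)) - a * (M + 1)) := by
        congr 1; ring
      rw [this, Real.cos_add, Real.cos_sub]
      ring
    have s1 : Real.sin (a * (G 0 + k)) ≠ 0 :=
      (sin_alpha_pos hn hm hG0 hG1 (by linarith) (by linarith)).ne'
    have c1 : Real.cos (a * (G 0 + k)) ≠ 0 :=
      (cos_alpha_pos hn hm hG0 hG1 (by linarith) (by linarith)).ne'
    rw [hsum] at e3
    rw [if_neg (by omega), Nat.add_sub_cancel, e5]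
    push_cast
    rw [add_sub_cancel_right]
    rw [show a * (G 0 + M + (G 0 + k)) = a * (G 0 + M) + a * (G 0 + k) by ring,
      show a * (G 0 + M - (G 0 + k)) = a * (G 0 + M) - a * (G 0 + k) by ring] at e4
    refine mul_right_cancel₀ (mul_ne_zero s1 c1) ?_
    rw [e4] at e1 e2 ⊢
    linear_combination e1 + e2 - (2 * Real.sin (a * (M + 1)) * awBasis a (G 0) M (G 0 + k)) * e3

/-- On the sites, `(E - J) φ = φ U` with `φ` triangular and invertible and `U` upper bidiagonal. The
`l`-th diagonal entry of `U` is zero, hence `det (E - J) = 0`. -/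
theorem racahP_eval_trigRoot {l : ℕ} (hl : l < n + m) :
    (racahP n m 0 G G' (n + m)).eval (trigRoot n m G G' l) = 0 := by
  obtain ⟨d, hd⟩ := exists_bidiagonal hn hm hG0 hG1 (G' := G')
  have hp : |(0 : ℝ)| < 1 := by simp
  have hT0 := halfPeriod_one n m G
  set N := n + m with hN
  set φ : Matrix (Fin N) (Fin N) ℝ :=
    Matrix.of fun k i => awBasis (alpha n m 1 G / 2) (G 0) i (G 0 + (k : ℕ)) with hφ
  set E := trigRoot n m G G' l with hE
  set U : Matrix (Fin N) (Fin N) ℝ := fun i j =>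
    if i = j then E - trigRoot n m G G' j else if (i : ℕ) + 1 = j then -d j else 0 with hU
  have hdet : φ.det ≠ 0 := by
    rw [Matrix.det_of_isLowerTriangular φ (fun i j hij =>
      awBasis_node_eq_zero _ _ (OrderDual.toDual_lt_toDual.1 hij))]
    refine Finset.prod_ne_zero_iff.2 fun k _ => ?_
    show awBasis _ _ _ _ ≠ 0
    refine Finset.prod_ne_zero_iff.2 fun i hi => ?_
    have hik : (i : ℝ) + 1 ≤ (k : ℕ) := by exact_mod_cast Finset.mem_range.1 hi
    have hk : ((k : ℕ) : ℝ) + 1 ≤ (N : ℝ) := by exact_mod_cast k.isLt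
    have hi0 : (0 : ℝ) ≤ i := i.cast_nonneg
    refine mul_ne_zero (sin_alpha_pos hn hm hG0 hG1 (by linarith) (by linarith)).ne' ?_
    have := sin_alpha_pos hn hm hG0 hG1 (z := -(G 0 + i - (G 0 + (k : ℕ)))) (by linarith)
      (by linarith)
    rw [mul_neg, Real.sin_neg] at this
    linarith
  have hmul : (Matrix.scalar (Fin N) E - jacobiMatrix n m 0 G G' N) * φ = φ * U := by
    ext k j
    have h1 := tridiag_mulVec (racahA n m 0 G G') (racahBplus n m 0 G G')
      (racahBminus n m 0 G G') (fun i => awBasis (alpha n m 1 G / 2) (G 0) j (G 0 + (i : ℕ))) k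
      (fun h => racahBplus_last hn hm hp hG0 hG1 h) (fun _ => racahBminus_zero _ _ _ _ _)
    have h2 : racahBminus n m 0 G G' k *
        awBasis (alpha n m 1 G / 2) (G 0) j (G 0 + ((k - 1 : ℕ) : ℝ)) =
        racahBminus n m 0 G G' k *
        awBasis (alpha n m 1 G / 2) (G 0) j (G 0 + ((k : ℕ) : ℝ) - 1) := by
      by_cases hk : (k : ℕ) = 0
      · rw [hk, racahBminus_zero]; ring
      · rw [Nat.cast_sub (by omega)]; push_cast; rw [add_sub_assoc]
    have h3 := hd k k.isLt j
    have h4 : ∑ i, φ k i * U i j = (E - trigRoot n m G G' j) * φ k j -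
        (if (j : ℕ) = 0 then 0 else
          d j * awBasis (alpha n m 1 G / 2) (G 0) (j - 1) (G 0 + (k : ℕ))) := by
      have h5 : ∀ i : Fin N, φ k i * U i j =
          (if i = j then (E - trigRoot n m G G' j) * φ k j else 0) -
          (if (i : ℕ) + 1 = j then
            d j * awBasis (alpha n m 1 G / 2) (G 0) (j - 1) (G 0 + (k : ℕ)) else 0) := fun i => by
        simp only [hU, hφ, Matrix.of_apply]
        by_cases e1 : i = j
        · subst e1; simp; ring
        · by_cases e2 : (i : ℕ) + 1 = j
          · have e3 : (j : ℕ) - 1 = i := by omega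
            simp [e1, e2, e3]; ring
          · simp [e1, e2]
      simp_rw [h5]
      rw [Finset.sum_sub_distrib, Fin.sum_univ_eq_sum_range (fun i => if i + 1 = (j : ℕ) then
        d j * awBasis (alpha n m 1 G / 2) (G 0) (j - 1) (G 0 + (k : ℕ)) else 0)]
      congr 1
      · simp
      · by_cases h : (j : ℕ) = 0
        · simp [h]
        · obtain ⟨i, hi⟩ : ∃ i, (j : ℕ) = i + 1 := ⟨j - 1, by omega⟩
          have := j.isLt
          simp only [hi, Nat.add_right_cancel_iff]
          simp
          intro h'; omega
    rw [sub_mul, Matrix.sub_apply, Matrix.mul_apply, Matrix.mul_apply, Matrix.mul_apply, h4]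
    have h6 : ∑ i, Matrix.scalar (Fin N) E k i * φ i j = E * φ k j := by
      simp [Matrix.scalar_apply, Matrix.diagonal_apply]
    rw [h6]
    have h7 : ∑ i, jacobiMatrix n m 0 G G' N k i * φ i j = _ := h1
    rw [h7, h2]
    simp only [hφ, Matrix.of_apply, Nat.cast_add, Nat.cast_one]
    rw [← add_assoc (G 0)]
    linear_combination -h3
  have hUdet : U.det = 0 := by
    rw [Matrix.det_of_isUpperTriangular (fun i j hij => ?_)]
    · exact Finset.prod_eq_zero (Finset.mem_univ ⟨l, hl⟩) (by simp [hU, hE])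
    · have h1 : j < i := hij
      have h2 : i ≠ j := h1.ne'
      have h3 : ¬((i : ℕ) + 1 = j) := by
        have : (j : ℕ) < i := h1
        omega
      simp [hU, h2, h3]
  have h := congrArg Matrix.det hmul
  rw [Matrix.det_mul, Matrix.det_mul, hUdet, mul_zero] at h
  rw [racahP, Matrix.eval_charpoly]
  exact (mul_eq_zero.1 h).resolve_right hdet

/-- The difference of cosines is a product of two sines. The bounds on `g'_1`, `g'_2` put `g_1 + g_2
+ g'_1 + g'_2 + k + l` strictly between `0` and `2T`. -/
theorem trigRoot_lt (hG0' : |G' 0| < G 0 + 1 / 2) (hG1' : |G' 1| < G 1 + 1 / 2) {k l : ℕ}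
    (hkl : k < l) (hl : l < n + m) : trigRoot n m G G' l < trigRoot n m G G' k := by
  have h0 := abs_lt.1 hG0'
  have h1 := abs_lt.1 hG1'
  have hT0 := halfPeriod_one n m G
  have hkl' : (k : ℝ) + 1 ≤ l := by exact_mod_cast hkl
  have hl' : (l : ℝ) + 1 ≤ ((n + m : ℕ) : ℝ) := by exact_mod_cast hl
  have hk0 : (0 : ℝ) ≤ k := k.cast_nonneg
  have hs : 2 * halfSum G G' = G 0 + G 1 + G' 0 + G' 1 := by unfold halfSum; ring
  have s1 := sin_alpha_pos hn hm hG0 hG1 (z := 2 * halfSum G G' + k + l) (by linarith)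
    (by linarith)
  have s2 := sin_alpha_pos hn hm hG0 hG1 (z := (l : ℝ) - k) (by linarith) (by linarith)
  have h : trigRoot n m G G' k - trigRoot n m G G' l =
      4 * (Real.sin (alpha n m 1 G / 2 * (2 * halfSum G G' + k + l)) *
        Real.sin (alpha n m 1 G / 2 * ((l : ℝ) - k))) := by
    rw [trigRoot, trigRoot, ← mul_sub, Real.cos_sub_cos]
    rw [show (alpha n m 1 G * (halfSum G G' + k) + alpha n m 1 G * (halfSum G G' + l)) / 2 =
      alpha n m 1 G / 2 * (2 * halfSum G G' + k + l) by ring,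
      show (alpha n m 1 G * (halfSum G G' + k) - alpha n m 1 G * (halfSum G G' + l)) / 2 =
      -(alpha n m 1 G / 2 * ((l : ℝ) - k)) by ring, Real.sin_neg]
    ring
  have := mul_pos s1 s2
  linarith

theorem racahRoot_nome_zero (hG0' : |G' 0| < G 0 + 1 / 2) (hG1' : |G' 1| < G 1 + 1 / 2) {l : ℕ}
    (hl : l < n + m) : racahRoot n m 0 G G' l = trigRoot n m G G' l := by
  rw [racahRoot_eq]
  exact sortedRoot_eq_of_strictAnti (Matrix.charpoly_monic _).ne_zero
    (natDegree_charpoly_tridiag _ _ _ _)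
    (fun _ _ hkl hl => trigRoot_lt hn hm hG0 hG1 hG0' hG1' hkl hl)
    (fun _ hl => racahP_eval_trigRoot hn hm hG0 hG1 hl) hl

end


/-! ### Determinantal identities -/

open Classical in
/-- Cauchy–Binet formula, summed over strictly decreasing index functions. -/
theorem _root_.Matrix.sum_det_mul_det_strictAnti {R : Type*} [CommRing R] {n N : ℕ}
    (A B : Fin N → Fin n → R) :
    ∑ g ∈ Finset.univ.filter (fun g : Fin n → Fin N => StrictAnti g),
      (Matrix.of fun i j => A (g i) j).det * (Matrix.of fun i j => B (g i) j).det =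
    (Matrix.of fun i j => ∑ k, A k i * B k j).det := by
  -- Multilinearity in the rows expands over all index functions `f`, injective or not.
  have h1 : (Matrix.of fun i j => ∑ k, A k i * B k j).det =
      ∑ f : Fin n → Fin N, (∏ i, A (f i) i) * (Matrix.of fun i j => B (f i) j).det := by
    have h := (Matrix.detRowAlternating (n := Fin n) (R := R)).toMultilinearMap.map_sum
      (fun (i : Fin n) (k : Fin N) => A k i • B k)
    have e1 : (Matrix.of fun i j => ∑ k, A k i * B k j) = fun i => ∑ k, A k i • B k := by
      ext i j; simp
    rw [e1]
    refine h.trans (Finset.sum_congr rfl fun f _ => ?_)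
    exact (Matrix.detRowAlternating (n := Fin n) (R := R)).toMultilinearMap.map_smul_univ
      (fun i => A (f i) i) (fun i => B (f i))
  rw [h1]
  -- Non-injective `f` contribute a determinant with equal rows; an injective `f` is uniquely a
  -- strictly decreasing function composed with a permutation.
  have h2 : ∑ x ∈ (Finset.univ.filter (fun g : Fin n → Fin N => StrictAnti g)) ×ˢ
        (Finset.univ : Finset (Equiv.Perm (Fin n))),
      (∏ i, A (x.1 (x.2 i)) i) * (Matrix.of fun i j => B (x.1 (x.2 i)) j).det =
      ∑ f : Fin n → Fin N, (∏ i, A (f i) i) * (Matrix.of fun i j => B (f i) j).det := by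
    refine Finset.sum_of_injOn (fun x => x.1 ∘ x.2) ?_ (fun _ _ => Finset.mem_univ _) ?_
      (fun _ _ => rfl)
    · rintro ⟨g, σ⟩ hx ⟨g', σ'⟩ hx' h
      simp only [Finset.coe_product, Set.mem_prod, Finset.mem_coe, Finset.mem_filter,
        Finset.mem_univ, true_and] at hx hx'
      simp only at h
      have hg : g = g' := by
        have hr : Set.range g = Set.range g' := by
          have := congrArg Set.range h
          rwa [σ.surjective.range_comp, σ'.surjective.range_comp] at this
        have h3 : StrictMono (g ∘ Fin.rev) := fun i j hij => hx.1 (Fin.rev_lt_rev.2 hij)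
        have h4 : StrictMono (g' ∘ Fin.rev) := fun i j hij => hx'.1 (Fin.rev_lt_rev.2 hij)
        have h5 : g ∘ Fin.rev = g' ∘ Fin.rev := by
          refine (StrictMono.range_inj h3 h4).1 ?_
          rw [Fin.rev_surjective.range_comp, Fin.rev_surjective.range_comp, hr]
        ext1 i
        have := congrFun h5 i.rev
        simpa using this
      subst hg
      refine Prod.ext rfl (Equiv.ext fun i => hx.1.injective (congrFun h i))
    · intro f _ hf
      have hni : ¬Function.Injective f := fun hinj => hf <| by
        refine ⟨(f ∘ Tuple.sort f ∘ Fin.rev, ((Tuple.sort f).symm.trans Fin.revPerm)), ?_, ?_⟩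
        · simp only [Finset.coe_product, Set.mem_prod, Finset.mem_coe, Finset.mem_filter,
            Finset.mem_univ, true_and, and_true]
          have hs : StrictMono (f ∘ Tuple.sort f) :=
            (Tuple.monotone_sort f).strictMono_of_injective
              (hinj.comp (Tuple.sort f).injective)
          exact fun i j hij => hs (Fin.rev_lt_rev.2 hij)
        · ext1 i
          simp
      obtain ⟨i, j, hij, hne⟩ : ∃ i j, f i = f j ∧ i ≠ j := by
        simpa [Function.Injective, not_forall] using hni
      rw [Matrix.det_zero_of_row_eq hne (by ext k; simp [hij]), mul_zero]
  rw [← h2, Finset.sum_product]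
  refine Finset.sum_congr rfl fun g _ => ?_
  rw [Matrix.det_apply' (Matrix.of fun i j => A (g i) j), Finset.sum_mul]
  refine Finset.sum_congr rfl fun σ _ => ?_
  have : (Matrix.of fun i j => B (g (σ i)) j) =
      (Matrix.of fun i j => B (g i) j).submatrix σ id := rfl
  rw [this, Matrix.det_permute]
  simp only [Matrix.of_apply]
  ring

/-- The derivation `diag E` acting on a determinant. -/
theorem _root_.Matrix.sum_det_updateRow_mul {R : Type*} [CommRing R] {n : ℕ}
    (M : Matrix (Fin n) (Fin n) R) (E : Fin n → R) :
    ∑ j, (M.updateRow j fun i => M j i * E i).det = (∑ i, E i) * M.det := by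
  -- Cofactor expansion along row `j`. Summed over `j`, the coefficient of `E i` is a diagonal entry
  -- of `adjugate M * M`.
  have h : ∀ j, (M.updateRow j fun i => M j i * E i).det =
      ∑ i, E i * (M.adjugate i j * M j i) := fun j => by
    have h0 : (fun i => M j i * E i) = ∑ i, (M j i * E i) • (Pi.single i 1 : Fin n → R) := by
      ext i
      simp [Finset.sum_apply, Pi.single_apply]
    rw [h0]
    have h1 := (Matrix.detRowAlternating (n := Fin n) (R := R)).toMultilinearMap.map_update_sum
      Finset.univ j (fun i => (M j i * E i) • (Pi.single i 1 : Fin n → R)) M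
    refine h1.trans (Finset.sum_congr rfl fun i _ => ?_)
    have h2 : (M.updateRow j ((M j i * E i) • (Pi.single i 1 : Fin n → R))).det = _ :=
      Matrix.det_updateRow_smul M j (M j i * E i) (Pi.single i 1)
    refine h2.trans ?_
    rw [Matrix.adjugate_apply]
    ring
  simp_rw [h]
  rw [Finset.sum_comm, Finset.sum_mul]
  refine Finset.sum_congr rfl fun i _ => ?_
  rw [← Finset.mul_sum]
  have := congrFun (congrFun (Matrix.adjugate_mul M) i) i
  rw [Matrix.mul_apply] at this
  rw [this]
  simp

/-! ### Partitions as strictly decreasing sequences -/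

/-- The integer `n - j + λ_j`. -/
def intNode (n : ℕ) (l : Fin n → ℤ) (j : Fin n) : ℤ := (n : ℤ) - 1 - j + l j

theorem add_sub_le_of_strictAnti {n : ℕ} {f : Fin n → ℤ} (hf : StrictAnti f) :
    ∀ (d : ℕ) (i j : Fin n), (j : ℕ) = i + d → f j + d ≤ f i := by
  intro d
  induction d with
  | zero =>
    intro i j h
    have : i = j := Fin.ext (by omega)
    simp [this]
  | succ d ih =>
    intro i j h
    have hj := j.isLt
    have h1 := ih i ⟨i + d, by omega⟩ rfl
    have h2 : f j < f ⟨i + d, by omega⟩ := hf (by rw [Fin.lt_def]; simp; omega)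
    push_cast
    omega

/-- Partitions in the `n × m` box correspond to `n`-element subsets of `n + m` sites. The bounds on
the parts come back from the end sites, since the sequence drops by at least one at each step. -/
theorem mem_Lam_iff_intNode {n m : ℕ} {l : Fin n → ℤ} :
    l ∈ Lam n m ↔ StrictAnti (intNode n l) ∧
      ∀ j, 0 ≤ intNode n l j ∧ intNode n l j < n + m := by
  rw [mem_Lam]
  constructor
  · rintro ⟨h1, h2⟩
    refine ⟨fun i j hij => ?_, fun j => ?_⟩
    · have := h2 hij.le
      have : (i : ℕ) < j := hij
      unfold intNode; omega
    · have := h1 j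
      have := j.isLt
      unfold intNode; omega
  · rintro ⟨h1, h2⟩
    refine ⟨fun j => ?_, fun i j hij => ?_⟩
    · have hj := j.isLt
      have e1 := add_sub_le_of_strictAnti h1 (n - 1 - j) j ⟨n - 1, by omega⟩ (by simp; omega)
      have e2 := add_sub_le_of_strictAnti h1 j ⟨0, by omega⟩ j (by simp)
      have e3 := (h2 ⟨n - 1, by omega⟩).1
      have e4 := (h2 ⟨0, by omega⟩).2
      simp only [intNode] at e1 e2 e3 e4
      push_cast at e1 e2 e3 e4
      omega
    · have hij' : (i : ℕ) ≤ j := hij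
      have e1 := add_sub_le_of_strictAnti h1 (j - i) i j (by omega)
      simp only [intNode] at e1
      omega

theorem node_eq_intNode {n m : ℕ} {l : Fin n → ℤ} (hl : l ∈ Lam n m) (j : Fin n) :
    (node n l j : ℤ) = intNode n l j := node_int ((mem_Lam.1 hl).1 j).1

theorem node_strictAnti {n m : ℕ} {l : Fin n → ℤ} (hl : l ∈ Lam n m) :
    StrictAnti (node n l) := fun i j hij => by
  have := (mem_Lam_iff_intNode.1 hl).1 hij
  rw [← node_eq_intNode hl, ← node_eq_intNode hl] at this
  exact_mod_cast this

/-- The node of a partition, as an element of `Fin (n + m)`. -/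
def nodeFin {n m : ℕ} (l : ↥(Lam n m)) (j : Fin n) : Fin (n + m) := ⟨node n l j, node_lt l.2 j⟩

open Classical in
theorem sum_Lam_eq_sum_strictAnti {n m : ℕ} (F : (Fin n → Fin (n + m)) → ℝ) :
    ∑ l : ↥(Lam n m), F (nodeFin l) =
      ∑ g ∈ Finset.univ.filter (fun g : Fin n → Fin (n + m) => StrictAnti g), F g := by
  refine Finset.sum_bij (fun l _ => nodeFin l) (fun l _ => ?_) (fun l _ l' _ h => ?_)
    (fun g hg => ?_) (fun _ _ => rfl)
  · exact Finset.mem_filter.2 ⟨Finset.mem_univ _, fun i j hij => node_strictAnti l.2 hij⟩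
  · refine Subtype.ext (funext fun j => ?_)
    have h1 : node n l j = node n l' j := congrArg Fin.val (congrFun h j)
    have h2 := node_eq_intNode l.2 j
    have h3 := node_eq_intNode l'.2 j
    rw [h1] at h2
    unfold intNode at h2 h3
    omega
  · have hg' : StrictAnti g := (Finset.mem_filter.1 hg).2
    have hmem : (fun j : Fin n => ((g j : ℕ) : ℤ) - ((n : ℤ) - 1 - j)) ∈ Lam n m := by
      have he : intNode n (fun j : Fin n => ((g j : ℕ) : ℤ) - ((n : ℤ) - 1 - j)) =
          fun j => ((g j : ℕ) : ℤ) := by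
        ext j; unfold intNode; ring
      rw [mem_Lam_iff_intNode, he]
      refine ⟨fun i j hij => ?_, fun j => ⟨by positivity, ?_⟩⟩
      · have : (g j : ℕ) < g i := hg' hij
        show ((g j : ℕ) : ℤ) < ((g i : ℕ) : ℤ)
        exact_mod_cast this
      · have := (g j).isLt
        show ((g j : ℕ) : ℤ) < n + m
        omega
    refine ⟨⟨_, hmem⟩, Finset.mem_univ _, funext fun j => Fin.ext ?_⟩
    have := node_eq_intNode hmem j
    simp only [intNode, add_sub_cancel] at this
    exact_mod_cast this

theorem nodeFin_injective {n m : ℕ} : Function.Injective (nodeFin : ↥(Lam n m) → _) :=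
  fun l l' h => Subtype.ext <| funext fun j => by
    have h1 : node n l j = node n l' j := congrArg Fin.val (congrFun h j)
    have h2 := node_eq_intNode l.2 j
    have h3 := node_eq_intNode l'.2 j
    rw [h1] at h2
    unfold intNode at h2 h3
    omega


/-! ### The elliptic Vandermonde product -/

/-- Moving particle `j` changes only the pairs containing `j`; symmetry lets each of them be written
with `j` in the leading place. -/
theorem _root_.Finset.prod_prod_Ioi_eq_of_symm {M : Type*} [CommMonoid M] {n : ℕ}
    (R : Fin n → Fin n → M) (j : Fin n) (hs : ∀ i k, R i k = R k i)
    (h1 : ∀ i k, i ≠ j → k ≠ j → R i k = 1) :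
    ∏ i, ∏ k ∈ Finset.Ioi i, R i k = ∏ k ∈ Finset.univ.erase j, R j k := by
  have e1 : ∀ i, ∏ k ∈ Finset.Ioi i, R i k = ∏ k, if i < k then R i k else 1 := fun i => by
    rw [← Finset.prod_filter]
    congr 1
    ext k; simp
  simp_rw [e1]
  rw [← Finset.mul_prod_erase _ _ (Finset.mem_univ j),
    ← Finset.mul_prod_erase _ _ (Finset.mem_univ j), if_neg (lt_irrefl j), one_mul,
    ← Finset.prod_mul_distrib]
  refine Finset.prod_congr rfl fun i hi => ?_
  have hij : i ≠ j := Finset.ne_of_mem_erase hi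
  rw [Finset.prod_eq_single j]
  · rcases lt_or_gt_of_ne hij with h | h
    · simp [h, h.not_gt, hs]
    · simp [h, h.not_gt]
  · intro k _ hk
    simp [h1 i k hij hk]
  · simp

/-- `∏_{j<k} [y_j + y_k]_1 [y_j - y_k]_1`. -/
def vandProd {n : ℕ} (α p : ℝ) (y : Fin n → ℝ) : ℝ :=
  ∏ j, ∏ k ∈ Finset.Ioi j, br α p 0 (y j + y k) * br α p 0 (y j - y k)

theorem prod_sign_pair (f : ℤ → ℝ) : ∏ δ ∈ ({1, -1} : Finset ℤ), f δ = f 1 * f (-1) :=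
  Finset.prod_pair (by decide)

theorem vand_eq {n m : ℕ} (p : ℝ) (G : Fin 4 → ℝ) (l : Fin n → ℤ) :
    vand n m p G l = vandProd (alpha n m 1 G) p (fun j => rho n 1 G j + l j) /
      vandProd (alpha n m 1 G) p (rho n 1 G) := by
  simp only [vand, vandProd, prod_sign_pair, ← Finset.prod_div_distrib]
  refine Finset.prod_congr rfl fun j _ => Finset.prod_congr rfl fun k _ => ?_
  rw [mul_div_mul_comm]
  push_cast
  congr 3
  · ring
  · ring
  · ring
  · ring

/-- The pair ratios are symmetric because `[·]_1` is odd and the sign cancels between numerator and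
denominator. The resulting product is the interaction factor of `B_λ` at `g = 1`. -/
theorem vandProd_update {n : ℕ} {α p : ℝ} {y y' : Fin n → ℝ} {j : Fin n} (ε : ℝ)
    (hj : y' j = y j + ε) (hk : ∀ k ≠ j, y' k = y k)
    (hy : vandProd α p y ≠ 0) :
    vandProd α p y' = vandProd α p y * ∏ k ∈ Finset.univ.erase j,
      (br α p 0 (y j + y k + ε) / br α p 0 (y j + y k) *
        (br α p 0 (y j - y k + ε) / br α p 0 (y j - y k))) := by
  set R : Fin n → Fin n → ℝ := fun i k => if i = k then 1 else
    (br α p 0 (y' i + y' k) * br α p 0 (y' i - y' k)) /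
      (br α p 0 (y i + y k) * br α p 0 (y i - y k)) with hR
  have hne : ∀ i k, i ≠ k → br α p 0 (y i + y k) * br α p 0 (y i - y k) ≠ 0 := fun i k hik => by
    have h2 : ∀ i k, i < k → br α p 0 (y i + y k) * br α p 0 (y i - y k) ≠ 0 := fun i k hik =>
      Finset.prod_ne_zero_iff.1 (Finset.prod_ne_zero_iff.1 hy i (Finset.mem_univ _)) k
        (Finset.mem_Ioi.2 hik)
    rcases lt_or_gt_of_ne hik with h | h
    · exact h2 i k h
    · have := h2 k i h
      rw [add_comm (y i), ← neg_sub (y k), br_zero_neg]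
      simpa using this
  have hprod := Finset.prod_prod_Ioi_eq_of_symm R j (fun i k => by
      simp only [hR]
      by_cases h : i = k
      · simp [h]
      · rw [if_neg h, if_neg (Ne.symm h), add_comm (y' i), add_comm (y i), ← neg_sub (y' k),
          ← neg_sub (y k), br_zero_neg, br_zero_neg, mul_neg, mul_neg, neg_div_neg_eq])
    (fun i k hi hk' => by
      simp only [hR]
      by_cases h : i = k
      · simp [h]
      · rw [if_neg h, hk i hi, hk k hk', div_self (hne i k h)])
  have h1 : vandProd α p y' / vandProd α p y = ∏ i, ∏ k ∈ Finset.Ioi i, R i k := by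
    simp only [vandProd, ← Finset.prod_div_distrib]
    refine Finset.prod_congr rfl fun i _ => Finset.prod_congr rfl fun k hk => ?_
    rw [hR]
    simp only
    rw [if_neg (Finset.mem_Ioi.1 hk).ne]
  rw [eq_comm, mul_comm, ← eq_div_iff hy, h1, hprod]
  refine Finset.prod_congr rfl fun k hk' => ?_
  have hkj := Finset.ne_of_mem_erase hk'
  simp only [hR]
  rw [if_neg hkj.symm, hj, hk k hkj, mul_div_mul_comm]
  congr 3
  · ring
  · ring

section
variable {p : ℝ} (hp : |p| < 1) {n m : ℕ} (hn : 1 ≤ n) (hm : 1 ≤ m) {G : Fin 4 → ℝ}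
  (hG0 : 0 < G 0) (hG1 : 0 < G 1)
include hn hm hG0 hG1

omit hn hm in
theorem rho_add_bounds {l : Fin n → ℤ} (hl : l ∈ Lam n m) (j : Fin n) :
    0 < rho n 1 G j + l j ∧ rho n 1 G j + l j < halfPeriod n m 1 G := by
  have h1 : (node n l j : ℝ) + 1 ≤ ((n + m : ℕ) : ℝ) := by exact_mod_cast node_lt hl j
  have h2 : (0 : ℝ) ≤ node n l j := Nat.cast_nonneg _
  rw [rho_one_add G ((mem_Lam.1 hl).1 j).1, halfPeriod_one]
  constructor <;> linarith

omit hn hm hG0 hG1 in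
theorem rho_add_lt {l : Fin n → ℤ} (hl : l ∈ Lam n m) {j k : Fin n} (hjk : j < k) :
    rho n 1 G k + l k < rho n 1 G j + l j := by
  rw [rho_one_add G ((mem_Lam.1 hl).1 j).1, rho_one_add G ((mem_Lam.1 hl).1 k).1]
  have : (node n l k : ℝ) < node n l j := by exact_mod_cast node_strictAnti hl hjk
  linarith

include hp

theorem vandProd_pos {l : Fin n → ℤ} (hl : l ∈ Lam n m) :
    0 < vandProd (alpha n m 1 G) p (fun j => rho n 1 G j + l j) := by
  have hT := one_lt_halfPeriod hn hm hG0 hG1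
  refine Finset.prod_pos fun j _ => Finset.prod_pos fun k hk => ?_
  have h1 := rho_add_bounds hG0 hG1 hl j
  have h2 := rho_add_bounds hG0 hG1 hl k
  have h3 := rho_add_lt (G := G) hl (Finset.mem_Ioi.1 hk)
  exact mul_pos (br_zero_pos hp hT (by linarith) (by linarith))
    (br_zero_pos hp hT (by linarith) (by linarith))

theorem vandProd_rho_pos : 0 < vandProd (alpha n m 1 G) p (rho n 1 G) := by
  simpa using vandProd_pos hp hn hm hG0 hG1 (zero_mem_Lam n m)

theorem vand_pos {l : Fin n → ℤ} (hl : l ∈ Lam n m) : 0 < vand n m p G l := by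
  rw [vand_eq]
  exact div_pos (vandProd_pos hp hn hm hG0 hG1 hl) (vandProd_rho_pos hp hn hm hG0 hG1)

theorem vand_zero : vand n m p G 0 = 1 := by
  rw [vand_eq]
  simpa using div_self (vandProd_rho_pos hp hn hm hG0 hG1).ne'

end

/-! ### Weights -/

theorem brFact_add (α p : ℝ) (r : Fin 4) (z : ℝ) (d l : ℕ) :
    brFact α p r z (d + l) = brFact α p r z d * brFact α p r (z + d) l := by
  simp only [brFact]
  rw [Finset.prod_range_add]
  congr 1
  refine Finset.prod_congr rfl fun i _ => ?_
  push_cast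
  rw [add_assoc]

theorem brFact_succ (α p : ℝ) (r : Fin 4) (z : ℝ) (k : ℕ) :
    brFact α p r z (k + 1) = brFact α p r z k * br α p r (z + k) :=
  Finset.prod_range_succ _ _

theorem brFact_succ' (α p : ℝ) (r : Fin 4) (z : ℝ) (k : ℕ) :
    brFact α p r z (k + 1) = br α p r z * brFact α p r (z + 1) k := by
  rw [add_comm k 1, brFact_add]
  simp [brFact]

theorem alpha_one {n m : ℕ} (hn : 1 ≤ n) (G : Fin 4 → ℝ) :
    alpha 1 (n + m - 1) 1 G = alpha n m 1 G := by
  unfold alpha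
  rw [Nat.cast_sub (by omega)]
  push_cast
  congr 1
  ring

/-- The one-particle weight as a product of quotients of elliptic factorials. -/
theorem weightOne_eq {n m : ℕ} (hn : 1 ≤ n) (p : ℝ) (G G' : Fin 4 → ℝ) (k : ℕ) :
    weightOne n m p G G' k = ∏ r : Fin 4,
      (brFact (alpha n m 1 G) p r (G 0 + 1) k * brFact (alpha n m 1 G) p r (G 0 + G r) k *
        brFact (alpha n m 1 G) p r (G 0 + G' r + 1 / 2) k) /
      (brFact (alpha n m 1 G) p r (G 0) k * brFact (alpha n m 1 G) p r (G 0 + 1 - G r) k *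
        brFact (alpha n m 1 G) p r (G 0 - G' r + 1 / 2) k) := by
  have hr : ∀ j : Fin 1, rho 1 1 G j = G 0 := fun j => by
    simp [rho]
  simp only [weightOne, weight, alpha_one hn, hr, Finset.univ_unique, Fin.default_eq_zero,
    Finset.prod_singleton, Int.toNat_natCast]
  rw [show Finset.Ioi (0 : Fin 1) = ∅ from rfl, Finset.prod_empty, mul_one]

theorem weightOne_zero {n m : ℕ} (hn : 1 ≤ n) (p : ℝ) (G G' : Fin 4 → ℝ) :
    weightOne n m p G G' 0 = 1 := by
  rw [weightOne_eq hn]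
  simp [brFact]

theorem weightOne_add {n m : ℕ} (hn : 1 ≤ n) (p : ℝ) (G G' : Fin 4 → ℝ) (d k : ℕ) :
    weightOne n m p G G' (d + k) = weightOne n m p G G' d * ∏ r : Fin 4,
      (brFact (alpha n m 1 G) p r (G 0 + d + 1) k * brFact (alpha n m 1 G) p r (G 0 + d + G r) k *
        brFact (alpha n m 1 G) p r (G 0 + d + G' r + 1 / 2) k) /
      (brFact (alpha n m 1 G) p r (G 0 + d) k * brFact (alpha n m 1 G) p r (G 0 + d + 1 - G r) k *
        brFact (alpha n m 1 G) p r (G 0 + d - G' r + 1 / 2) k) := by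
  rw [weightOne_eq hn, weightOne_eq hn, ← Finset.prod_mul_distrib]
  refine Finset.prod_congr rfl fun r _ => ?_
  simp only [brFact_add]
  rw [show G 0 + 1 + (d : ℝ) = G 0 + d + 1 by ring, show G 0 + G r + (d : ℝ) = G 0 + d + G r by ring,
    show G 0 + G' r + 1 / 2 + (d : ℝ) = G 0 + d + G' r + 1 / 2 by ring,
    show G 0 + 1 - G r + (d : ℝ) = G 0 + d + 1 - G r by ring,
    show G 0 - G' r + 1 / 2 + (d : ℝ) = G 0 + d - G' r + 1 / 2 by ring, ← mul_div_mul_comm]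
  congr 1 <;> ring

section
variable {p : ℝ} (hp : |p| < 1) {n m : ℕ} (hn : 1 ≤ n) (hm : 1 ≤ m) {G G' : Fin 4 → ℝ}
  (hG0 : 0 < G 0) (hG1 : 0 < G 1)
include hp hn hm hG0 hG1

/-- Detailed balance between neighbouring sites. The half-step factor `[g_1 + k + 1/2]_r` is common
to `b_k^+` and `b_{k+1}^-` and cancels. -/
theorem weightOne_succ {k : ℕ} (hk : k + 1 < n + m) :
    weightOne n m p G G' (k + 1) =
      weightOne n m p G G' k * (racahBplus n m p G G' k / racahBminus n m p G G' (k + 1)) := by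
  have hT := one_lt_halfPeriod hn hm hG0 hG1
  have hT0 := halfPeriod_one n m G
  have hk' : (k : ℝ) + 2 ≤ ((n + m : ℕ) : ℝ) := by exact_mod_cast hk
  have hk0 : (0 : ℝ) ≤ k := k.cast_nonneg
  rw [weightOne_add hn, racahBplus, racahBminus, ← Finset.prod_div_distrib]
  congr 1
  refine Finset.prod_congr rfl fun r _ => ?_
  have h1 : br (alpha n m 1 G) p r (G 0 + 1 / 2 + k) ≠ 0 :=
    (br_pos hp hT (by linarith) (by linarith) r).ne'
  simp only [brFact, Finset.prod_range_one, Nat.cast_zero, add_zero, Nat.cast_add, Nat.cast_one]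
  rw [show G 0 + (k : ℝ) + G r = G 0 + G r + k by ring,
    show G 0 + (k : ℝ) + G' r + 1 / 2 = G 0 + G' r + 1 / 2 + k by ring,
    show G 0 - 1 / 2 + ((k : ℝ) + 1) = G 0 + 1 / 2 + k by ring,
    show G 0 - G r + ((k : ℝ) + 1) = G 0 + k + 1 - G r by ring,
    show G 0 - G' r - 1 / 2 + ((k : ℝ) + 1) = G 0 + k - G' r + 1 / 2 by ring,
    show G 0 + ((k : ℝ) + 1) = G 0 + k + 1 by ring, div_div_div_eq]
  generalize br (alpha n m 1 G) p r (G 0 + 1 / 2 + k) = v at *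
  rw [show ∀ a b c d e f : ℝ, a * b * (c * v) / (d * v * (e * f)) =
    (c * a * b * v) / (d * e * f * v) by intros; congr 1 <;> ring, mul_div_mul_right _ _ h1]

variable (hG0' : |G' 0| < G 0 + 1 / 2) (hG1' : |G' 1| < G 1 + 1 / 2)
include hG0' hG1'

theorem weightOne_pos {k : ℕ} (hk : k < n + m) : 0 < weightOne n m p G G' k := by
  induction k with
  | zero => rw [weightOne_zero hn]; exact one_pos
  | succ k ih =>
    rw [weightOne_succ hp hn hm hG0 hG1 hk]
    exact mul_pos (ih (by omega)) (div_pos (racahBplus_pos hp hn hm hG0 hG1 hG0' hG1' hk)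
      (racahBminus_pos hp hn hm hG0 hG1 hG0' hG1' (by omega) hk))

theorem racahC_pos {k : ℕ} (hk : k < n + m) : 0 < racahC n m p G G' k :=
  Finset.prod_pos fun i hi => inv_pos.2 (racahBplus_pos hp hn hm hG0 hG1 hG0' hG1'
    (by have := Finset.mem_range.1 hi; omega))

theorem racahC_succ_mul {k : ℕ} (hk : k + 1 < n + m) :
    racahBplus n m p G G' k * racahC n m p G G' (k + 1) = racahC n m p G G' k := by
  have := (racahBplus_pos hp hn hm hG0 hG1 hG0' hG1' hk).ne'
  rw [racahC, Finset.prod_range_succ, ← racahC]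
  field_simp

/-- By detailed balance `c_k² Δ_k` is the weight natural for the monic `P_k`, which links `Δ` to the
Christoffel–Darboux sums. -/
theorem racahC_sq_mul_weightOne {k : ℕ} (hk : k < n + m) :
    racahC n m p G G' k ^ 2 * weightOne n m p G G' k *
      ∏ s ∈ Finset.range k, (racahBplus n m p G G' s * racahBminus n m p G G' (s + 1)) = 1 := by
  induction k with
  | zero => simp [racahC, weightOne_zero hn]
  | succ k ih =>
    have h1 := (racahBplus_pos hp hn hm hG0 hG1 hG0' hG1' hk).ne'
    have h2 := (racahBminus_pos hp hn hm hG0 hG1 hG0' hG1' (by omega : 1 ≤ k + 1) hk).ne'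
    have h3 := racahC_succ_mul hp hn hm hG0 hG1 hG0' hG1' hk
    have h4 := ih (by omega)
    rw [Finset.prod_range_succ, weightOne_succ hp hn hm hG0 hG1 hk]
    rw [← h3] at h4
    rw [← h4]
    field_simp

/-- The weights factor through one-particle weights. -/
theorem weight_eq {l : Fin n → ℤ} (hl : l ∈ Lam n m) :
    weight n m p 1 G G' l = vand n m p G l ^ 2 * ∏ j : Fin n,
      (weightOne n m p G G' (node n l j) / weightOne n m p G G' (n - 1 - (j : ℕ))) := by
  have hT := one_lt_halfPeriod hn hm hG0 hG1
  rw [mul_comm]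
  simp only [weight]
  congr 1
  · refine Finset.prod_congr rfl fun j _ => ?_
    have hj := j.isLt
    have hd : rho n 1 G j = G 0 + ((n - 1 - (j : ℕ) : ℕ) : ℝ) := by
      rw [rho, Nat.cast_sub (by omega), Nat.cast_sub hn]; push_cast; ring
    have hw := (weightOne_pos hp hn hm hG0 hG1 hG0' hG1' (k := n - 1 - (j : ℕ)) (by omega)).ne'
    rw [node, weightOne_add hn, mul_div_cancel_left₀ _ hw, hd]
  · rw [vand, ← Finset.prod_pow]
    refine Finset.prod_congr rfl fun j _ => ?_
    rw [← Finset.prod_pow]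
    refine Finset.prod_congr rfl fun k hk => ?_
    have hjk := Finset.mem_Ioi.1 hk
    rw [← Finset.prod_pow]
    refine Finset.prod_congr rfl fun δ hδ => ?_
    have hl1 := (mem_Lam.1 hl).1 j
    have hl2 := (mem_Lam.1 hl).1 k
    have hl3 := (mem_Lam.1 hl).2 hjk.le
    have b1 := rho_add_bounds hG0 hG1 hl j
    have b2 := rho_add_bounds hG0 hG1 hl k
    have c1 := rho_add_bounds hG0 hG1 (zero_mem_Lam n m) j
    have c2 := rho_add_bounds hG0 hG1 (zero_mem_Lam n m) k
    have b3 := rho_add_lt (G := G) hl hjk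
    have b4 := rho_add_lt (G := G) (zero_mem_Lam n m) hjk
    simp only [Pi.zero_apply, Int.cast_zero, add_zero] at c1 c2 b4
    -- At `g = 1` both quotients of factorials telescope to `[z+L]_1 / [z]_1`; this is the origin of
    -- the square of `V_λ`.
    have key : ∀ (z : ℝ) (L : ℕ), 0 < z → z + L < 2 * halfPeriod n m 1 G →
        (brFact (alpha n m 1 G) p 0 (z + 1) L * brFact (alpha n m 1 G) p 0 (z + 1) L) /
        (brFact (alpha n m 1 G) p 0 z L * brFact (alpha n m 1 G) p 0 (z + 1 - 1) L) =
        (br (alpha n m 1 G) p 0 (z + L) / br (alpha n m 1 G) p 0 z) ^ 2 := by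
      intro z L hz hzL
      have n1 : br (alpha n m 1 G) p 0 z ≠ 0 := by
        have : (0 : ℝ) ≤ L := L.cast_nonneg
        exact (br_zero_pos hp hT hz (by linarith)).ne'
      have n2 : brFact (alpha n m 1 G) p 0 z L ≠ 0 := by
        refine Finset.prod_ne_zero_iff.2 fun i hi => ?_
        have : (i : ℝ) < L := by exact_mod_cast Finset.mem_range.1 hi
        have : (0 : ℝ) ≤ i := i.cast_nonneg
        exact (br_zero_pos hp hT (by linarith) (by linarith)).ne'
      have e := (brFact_succ' (alpha n m 1 G) p 0 z L).symm.trans (brFact_succ _ _ _ _ _)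
      rw [add_sub_cancel_right, ← sq, ← sq, ← div_pow]
      congr 1
      rw [div_eq_div_iff n2 n1]
      linarith
    have hδ' : δ = 1 ∨ δ = -1 := by simpa using hδ
    have hL : (((l j + δ * l k).toNat : ℕ) : ℝ) = l j + δ * l k := by
      have : (((l j + δ * l k).toNat : ℕ) : ℤ) = l j + δ * l k :=
        Int.toNat_of_nonneg (by rcases hδ' with rfl | rfl <;> omega)
      have := congrArg (Int.cast : ℤ → ℝ) this
      push_cast at this
      exact this
    rw [key]
    · rw [hL, ← add_assoc]
    · rcases hδ' with rfl | rfl <;> push_cast <;> linarith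
    · rw [hL]
      rcases hδ' with rfl | rfl <;> push_cast <;> linarith

theorem weight_pos {l : Fin n → ℤ} (hl : l ∈ Lam n m) : 0 < weight n m p 1 G G' l := by
  rw [weight_eq hp hn hm hG0 hG1 hG0' hG1' hl]
  refine mul_pos (pow_pos (vand_pos hp hn hm hG0 hG1 hl) 2) (Finset.prod_pos fun j _ => ?_)
  exact div_pos (weightOne_pos hp hn hm hG0 hG1 hG0' hG1' (node_lt hl j))
    (weightOne_pos hp hn hm hG0 hG1 hG0' hG1' (by have := j.isLt; omega))

/-- The factorials multiply `1 / b_k^+` over the sites crossed by particle `j` from its ground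
position to its present one. -/
theorem prefC_eq {l : Fin n → ℤ} : prefC n m p G G' l =
    1 / vand n m p G l * ∏ j : Fin n,
      (racahC n m p G G' (node n l j) / racahC n m p G G' (n - 1 - (j : ℕ))) := by
  simp only [prefC]
  congr 1
  refine Finset.prod_congr rfl fun j _ => ?_
  have hj := j.isLt
  have hd : rho n 1 G j = G 0 + ((n - 1 - (j : ℕ) : ℕ) : ℝ) := by
    rw [rho, Nat.cast_sub (by omega), Nat.cast_sub hn]; push_cast; ring
  have hw := (racahC_pos hp hn hm hG0 hG1 hG0' hG1' (k := n - 1 - (j : ℕ)) (by omega)).ne'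
  rw [racahC, node, Finset.prod_range_add, ← racahC, mul_div_cancel_left₀ _ hw, hd]
  simp only [brFact, ← Finset.prod_mul_distrib, ← Finset.prod_div_distrib]
  rw [Finset.prod_comm]
  refine Finset.prod_congr rfl fun i _ => ?_
  rw [racahBplus, ← Finset.prod_inv_distrib]
  refine Finset.prod_congr rfl fun r _ => ?_
  rw [inv_div]
  push_cast
  congr 3 <;> ring_nf

theorem prefC_zero : prefC n m p G G' 0 = 1 := by
  rw [prefC_eq hp hn hm hG0 hG1 hG0' hG1', vand_zero hp hn hm hG0 hG1, one_div_one, one_mul]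
  refine Finset.prod_eq_one fun j _ => ?_
  have := (racahC_pos hp hn hm hG0 hG1 hG0' hG1' (k := n - 1 - (j : ℕ))
    (by have := j.isLt; omega)).ne'
  simp [node, this]

end


/-! ### The Slater determinant eigenvalue equation -/

theorem intNode_add_single {n : ℕ} (l : Fin n → ℤ) (j : Fin n) (ε : ℤ) (i : Fin n) :
    intNode n (l + Pi.single j ε) i = intNode n l i + if i = j then ε else 0 := by
  simp only [intNode, Pi.add_apply, Pi.single_apply]
  ring

/-- A move leaving `Λ` steps off an end of the chain or onto an occupied site. Each of these kills
the corresponding determinant term. -/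
theorem exists_of_add_single_notMem {n m : ℕ} {l : Fin n → ℤ} (hl : l ∈ Lam n m) {j : Fin n}
    {ε : ℤ} (hε : ε = 1 ∨ ε = -1) (hj : l + Pi.single j ε ∉ Lam n m) :
    (ε = -1 ∧ node n l j = 0) ∨ (ε = 1 ∧ node n l j + 1 = n + m) ∨
      ∃ i ≠ j, (node n l i : ℤ) = node n l j + ε := by
  by_contra! h
  obtain ⟨h1, h2, h3⟩ := h
  refine hj (mem_Lam_iff_intNode.2 ⟨fun i i' hii => ?_, fun i => ?_⟩)
  · have h4 : node n l i' < node n l i := node_strictAnti hl hii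
    rw [intNode_add_single, intNode_add_single, ← node_eq_intNode hl, ← node_eq_intNode hl]
    by_cases e1 : i = j
    · subst e1
      have h5 := h3 i' hii.ne'
      rw [if_neg hii.ne', if_pos rfl]
      omega
    · by_cases e2 : i' = j
      · subst e2
        have h5 := h3 i hii.ne
        rw [if_neg hii.ne, if_pos rfl]
        omega
      · rw [if_neg e1, if_neg e2]
        omega
  · have h4 := node_lt hl i
    rw [intNode_add_single, ← node_eq_intNode hl]
    by_cases e1 : i = j
    · subst e1
      rw [if_pos rfl]
      omega
    · rw [if_neg e1]
      omega

/-- The polynomials `P_k` in the normalization of the difference equation. -/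
def racahPhi (n m : ℕ) (p : ℝ) (G G' : Fin 4 → ℝ) (k : ℕ) (x : ℝ) : ℝ :=
  racahC n m p G G' k * (racahP n m p G G' k).eval x

/-- The Slater determinants of the one-particle eigenfunctions. -/
def slaterDet (n m : ℕ) (p : ℝ) (G G' : Fin 4 → ℝ) (ν l : Fin n → ℤ) : ℝ :=
  (Matrix.of fun i j : Fin n =>
    racahPhi n m p G G' (node n l i) (racahRoot n m p G G' (node n ν j))).det

theorem slaterDet_eq (n m : ℕ) (p : ℝ) (G G' : Fin 4 → ℝ) (ν l : Fin n → ℤ) :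
    slaterDet n m p G G' ν l = (∏ j, racahC n m p G G' (node n l j)) * altA n m p G G' ν l :=
  Matrix.det_mul_column (fun i => racahC n m p G G' (node n l i)) _

section
variable {p : ℝ} (hp : |p| < 1) {n m : ℕ} (hn : 1 ≤ n) (hm : 1 ≤ m) {G G' : Fin 4 → ℝ}
  (hG0 : 0 < G 0) (hG1 : 0 < G 1)
include hp hn hm hG0 hG1

/-- The interaction at `g = 1` is a pure gauge factor; conjugation by `V_λ` leaves independent
one-particle hopping. -/
theorem coeffB_eq {l : Fin n → ℤ} (hl : l ∈ Lam n m) {ε : ℤ} (hε : ε = 1 ∨ ε = -1) (j : Fin n) :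
    coeffB n m p 1 G G' l ε j =
      (if ε = 1 then racahBplus n m p G G' (node n l j) else racahBminus n m p G G' (node n l j)) *
        (vand n m p G (l + Pi.single j ε) / vand n m p G l) := by
  have hv := vandProd_pos hp hn hm hG0 hG1 hl
  have hr := vandProd_rho_pos hp hn hm hG0 hG1
  rw [vand_eq, vand_eq, div_div_div_cancel_right₀ hr.ne',
    vandProd_update (y := fun j => rho n 1 G j + l j) (j := j) (ε : ℝ) (by simp; ring)
      (fun k hk => by simp [hk]) hv.ne', mul_div_cancel_left₀ _ hv.ne']
  simp only [coeffB, prod_sign_pair]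
  have hx := rho_one_add G ((mem_Lam.1 hl).1 j).1
  congr 1
  · rw [hx]
    rcases hε with rfl | rfl
    · rw [if_pos rfl, racahBplus]
      refine Finset.prod_congr rfl fun r _ => ?_
      push_cast
      congr 3 <;> ring
    · rw [if_neg (by decide), racahBminus]
      refine Finset.prod_congr rfl fun r _ => ?_
      push_cast
      congr 3 <;> ring
  · refine Finset.prod_congr rfl fun k _ => ?_
    push_cast
    simp only [one_mul, neg_mul, mul_one, ← sub_eq_add_neg]

/-- An allowed move gives the Slater determinant of the neighbouring partition. A forbidden one
gives zero, by a vanishing end coefficient or two equal rows. The value of `toNat` at a negative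
site is irrelevant since it occurs with `b_0^- = 0`. -/
theorem coeff_mul_det_updateRow (ν : Fin n → ℤ) {l : Fin n → ℤ} (hl : l ∈ Lam n m) {ε : ℤ}
    (hε : ε = 1 ∨ ε = -1) (j : Fin n) {k : ℕ} (hk : k = (node n l j + ε).toNat) :
    (if ε = 1 then racahBplus n m p G G' (node n l j) else racahBminus n m p G G' (node n l j)) *
      ((Matrix.of fun i j : Fin n =>
        racahPhi n m p G G' (node n l i) (racahRoot n m p G G' (node n ν j))).updateRow j
          fun i => racahPhi n m p G G' k (racahRoot n m p G G' (node n ν i))).det =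
    vand n m p G l * (coeffB n m p 1 G G' l ε j * if l + Pi.single j ε ∈ Lam n m then
      slaterDet n m p G G' ν (l + Pi.single j ε) / vand n m p G (l + Pi.single j ε) else 0) := by
  have hv := (vand_pos hp hn hm hG0 hG1 hl).ne'
  by_cases hj : l + Pi.single j ε ∈ Lam n m
  · have hv' := (vand_pos hp hn hm hG0 hG1 hj).ne'
    have hd : slaterDet n m p G G' ν (l + Pi.single j ε) = ((Matrix.of fun i j : Fin n =>
        racahPhi n m p G G' (node n l i) (racahRoot n m p G G' (node n ν j))).updateRow j
          fun i => racahPhi n m p G G' k (racahRoot n m p G G' (node n ν i))).det := by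
      rw [slaterDet]
      congr 1
      ext i i'
      have h1 := node_eq_intNode hj i
      rw [intNode_add_single, ← node_eq_intNode hl] at h1
      by_cases hij : i = j
      · subst hij
        rw [if_pos rfl] at h1
        rw [Matrix.updateRow_self, Matrix.of_apply, show node n (l + Pi.single i ε) i = k by omega]
      · rw [if_neg hij] at h1
        rw [Matrix.updateRow_ne hij, Matrix.of_apply, Matrix.of_apply,
          show node n (l + Pi.single j ε) i = node n l i by omega]
    rw [if_pos hj, coeffB_eq hp hn hm hG0 hG1 hl hε, hd]
    field_simp
  · rw [if_neg hj, mul_zero, mul_zero]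
    rcases exists_of_add_single_notMem hl hε hj with ⟨rfl, h0⟩ | ⟨rfl, hN⟩ | ⟨i, hij, hi⟩
    · rw [if_neg (by decide), h0, racahBminus_zero, zero_mul]
    · rw [if_pos rfl, racahBplus_last hn hm hp hG0 hG1 hN, zero_mul]
    · rw [Matrix.det_zero_of_row_eq hij, mul_zero]
      rw [Matrix.updateRow_self, Matrix.updateRow_ne hij]
      ext i'
      rw [Matrix.of_apply, show node n l i = k by omega]

variable (hG0' : |G' 0| < G 0 + 1 / 2) (hG1' : |G' 1| < G 1 + 1 / 2)
include hG0' hG1'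

theorem racahPhi_recurrence {k l : ℕ} (hk : k < n + m) (hl : l < n + m) :
    racahPhi n m p G G' k (racahRoot n m p G G' l) * racahRoot n m p G G' l =
      racahA n m p G G' k * racahPhi n m p G G' k (racahRoot n m p G G' l) +
      racahBplus n m p G G' k * racahPhi n m p G G' (k + 1) (racahRoot n m p G G' l) +
      racahBminus n m p G G' k * racahPhi n m p G G' (k - 1) (racahRoot n m p G G' l) := by
  set E := racahRoot n m p G G' l
  have h1 : racahBplus n m p G G' k * racahPhi n m p G G' (k + 1) E =
      racahC n m p G G' k * (racahP n m p G G' (k + 1)).eval E := by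
    -- At the last site the recurrence closes because `P_{n+m}` vanishes at its root.
    by_cases hkN : k + 1 = n + m
    · rw [racahPhi, hkN, racahP_eval_racahRoot hp hn hm hG0 hG1 hG0' hG1' hl]
      ring
    · rw [racahPhi, ← racahC_succ_mul hp hn hm hG0 hG1 hG0' hG1' (by omega : k + 1 < n + m)]
      ring
  rw [h1]
  simp only [racahPhi, racahP_eval]
  rcases k with _ | k
  · rw [racahBminus_zero, zero_add, triP_one, triP_zero]
    ring
  · rw [Nat.add_sub_cancel, triP_add_two,
      ← racahC_succ_mul hp hn hm hG0 hG1 hG0' hG1' hk]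
    ring

/-- Scaling the columns of row `j` by their eigenvalues and summing over `j` multiplies the
determinant by `∑ E_i`. The one-particle recurrence rewrites each scaled row as hops of particle
`j`. -/
theorem slaterDet_eigen {ν l : Fin n → ℤ} (hν : ν ∈ Lam n m) (hl : l ∈ Lam n m) :
    (∑ j, racahA n m p G G' (node n l j)) * (slaterDet n m p G G' ν l / vand n m p G l) +
      ∑ j : Fin n, ∑ ε ∈ ({1, -1} : Finset ℤ), coeffB n m p 1 G G' l ε j *
        (if l + Pi.single j ε ∈ Lam n m then
          slaterDet n m p G G' ν (l + Pi.single j ε) / vand n m p G (l + Pi.single j ε) else 0) =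
    eigenvalue n m p G G' ν * (slaterDet n m p G G' ν l / vand n m p G l) := by
  have hv := (vand_pos hp hn hm hG0 hG1 hl).ne'
  have h := Matrix.sum_det_updateRow_mul (Matrix.of fun i j : Fin n =>
    racahPhi n m p G G' (node n l i) (racahRoot n m p G G' (node n ν j)))
    (fun i => racahRoot n m p G G' (node n ν i))
  have hrow : ∀ j : Fin n, ((Matrix.of fun i j : Fin n =>
      racahPhi n m p G G' (node n l i) (racahRoot n m p G G' (node n ν j))).updateRow j
      fun i => (Matrix.of fun i j : Fin n =>
        racahPhi n m p G G' (node n l i) (racahRoot n m p G G' (node n ν j))) j i *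
        racahRoot n m p G G' (node n ν i)).det =
      racahA n m p G G' (node n l j) * slaterDet n m p G G' ν l +
      vand n m p G l * ∑ ε ∈ ({1, -1} : Finset ℤ), coeffB n m p 1 G G' l ε j *
        (if l + Pi.single j ε ∈ Lam n m then
          slaterDet n m p G G' ν (l + Pi.single j ε) / vand n m p G (l + Pi.single j ε)
          else 0) := fun j => by
    have e : (fun i => (Matrix.of fun i j : Fin n =>
        racahPhi n m p G G' (node n l i) (racahRoot n m p G G' (node n ν j))) j i *
        racahRoot n m p G G' (node n ν i)) =
        (racahA n m p G G' (node n l j) • (Matrix.of fun i j : Fin n =>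
          racahPhi n m p G G' (node n l i) (racahRoot n m p G G' (node n ν j))) j +
        racahBplus n m p G G' (node n l j) •
          fun i => racahPhi n m p G G' (node n l j + 1) (racahRoot n m p G G' (node n ν i))) +
        racahBminus n m p G G' (node n l j) •
          fun i => racahPhi n m p G G' (node n l j - 1) (racahRoot n m p G G' (node n ν i)) := by
      ext i
      simp only [Matrix.of_apply, Pi.add_apply, Pi.smul_apply, smul_eq_mul]
      exact racahPhi_recurrence hp hn hm hG0 hG1 hG0' hG1' (node_lt hl j) (node_lt hν i)
    rw [e, Matrix.det_updateRow_add, Matrix.det_updateRow_add, Matrix.det_updateRow_smul,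
      Matrix.det_updateRow_smul, Matrix.det_updateRow_smul, Matrix.updateRow_eq_self]
    have h1 := coeff_mul_det_updateRow hp hn hm hG0 hG1 ν hl (Or.inl rfl) j
      (G' := G') (k := node n l j + 1) (by omega)
    have h2 := coeff_mul_det_updateRow hp hn hm hG0 hG1 ν hl (Or.inr rfl) j
      (G' := G') (k := node n l j - 1) (by omega)
    rw [if_pos rfl] at h1
    rw [if_neg (by decide)] at h2
    rw [h1, h2, Finset.sum_pair (by decide), mul_add, add_assoc]
    rfl
  simp_rw [hrow] at h
  rw [Finset.sum_add_distrib, ← Finset.sum_mul, ← Finset.mul_sum] at h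
  change _ = eigenvalue n m p G G' ν * slaterDet n m p G G' ν l at h
  rw [← mul_div_assoc, ← mul_div_assoc, ← h]
  field_simp

/-- The constant does not depend on `l`, so the claimed eigenfunctions are multiples of `slaterDet /
vand`. -/
theorem prefC_mul_altA (ν l : Fin n → ℤ) : prefC n m p G G' l * altA n m p G G' ν l =
    (∏ j : Fin n, racahC n m p G G' (n - 1 - (j : ℕ)))⁻¹ *
      (slaterDet n m p G G' ν l / vand n m p G l) := by
  rw [prefC_eq hp hn hm hG0 hG1 hG0' hG1', slaterDet_eq, Finset.prod_div_distrib]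
  ring

end


/-! ### Orthogonality -/

section
variable {p : ℝ} (hp : |p| < 1) {n m : ℕ} (hn : 1 ≤ n) (hm : 1 ≤ m) {G G' : Fin 4 → ℝ}
  (hG0 : 0 < G 0) (hG1 : 0 < G 1)
  (hG0' : |G' 0| < G 0 + 1 / 2) (hG1' : |G' 1| < G 1 + 1 / 2)
include hp hn hm hG0 hG1 hG0' hG1'

theorem prod_range_racahB_pos : 0 < ∏ s ∈ Finset.range (n + m - 1),
    (racahBplus n m p G G' s * racahBminus n m p G G' (s + 1)) :=
  Finset.prod_pos fun s hs => racahB_mul_pos hp hn hm hG0 hG1 hG0' hG1'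
    (by have := Finset.mem_range.1 hs; omega)

/-- Rewrites the Christoffel–Darboux weights as a fixed positive constant times `c_k² Δ_k`. -/
theorem prod_Ico_racahB {k : ℕ} (hk : k < n + m) :
    ∏ s ∈ Finset.Ico k (n + m - 1),
      (racahBplus n m p G G' s * racahBminus n m p G G' (s + 1)) =
    (∏ s ∈ Finset.range (n + m - 1),
      (racahBplus n m p G G' s * racahBminus n m p G G' (s + 1))) *
      (racahC n m p G G' k ^ 2 * weightOne n m p G G' k) := by
  have h1 := racahC_sq_mul_weightOne hp hn hm hG0 hG1 hG0' hG1' hk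
  rw [← Finset.prod_range_mul_prod_Ico _ (by omega : k ≤ n + m - 1)]
  linear_combination -(∏ s ∈ Finset.Ico k (n + m - 1),
      (racahBplus n m p G G' s * racahBminus n m p G G' (s + 1))) * h1

/-- Christoffel–Darboux at two roots of `P_{n+m}`: the left side vanishes and `E_i ≠ E_j`. -/
theorem racah_orthogonality {i j : ℕ} (hi : i < n + m) (hj : j < n + m) (hij : i ≠ j) :
    ∑ k ∈ Finset.range (n + m), racahC n m p G G' k ^ 2 * weightOne n m p G G' k *
      ((racahP n m p G G' k).eval (racahRoot n m p G G' i) *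
        (racahP n m p G G' k).eval (racahRoot n m p G G' j)) = 0 := by
  have hW := prod_range_racahB_pos hp hn hm hG0 hG1 hG0' hG1'
  have h := christoffel_darboux (racahA n m p G G') (racahBplus n m p G G')
    (racahBminus n m p G G') (racahRoot n m p G G' i) (racahRoot n m p G G' j) (n + m - 1)
  rw [Nat.sub_add_cancel (by omega)] at h
  simp only [← racahP_eval] at h
  rw [racahP_eval_racahRoot hp hn hm hG0 hG1 hG0' hG1' hi,
    racahP_eval_racahRoot hp hn hm hG0 hG1 hG0' hG1' hj, zero_mul, mul_zero, sub_zero, eq_comm,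
    mul_eq_zero] at h
  have hne : racahRoot n m p G G' i - racahRoot n m p G G' j ≠ 0 := sub_ne_zero.2 fun he =>
    hij (racahRoot_injOn hp hn hm hG0 hG1 hG0' hG1' hi hj he)
  have h2 := h.resolve_left hne
  rw [← mul_right_inj' hW.ne', mul_zero, ← h2, Finset.mul_sum]
  refine Finset.sum_congr rfl fun k hk => ?_
  rw [prod_Ico_racahB hp hn hm hG0 hG1 hG0' hG1' (Finset.mem_range.1 hk)]
  ring

/-- The confluent identity at a root, where the derivative of `P_{n+m}` is the product of the
differences `E_l - E_j`. So `n_l` is a squared norm. -/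
theorem racahN_eq_sum {l : ℕ} (hl : l < n + m) : racahN n m p G G' l =
    ∑ k ∈ Finset.range (n + m), racahC n m p G G' k ^ 2 * weightOne n m p G G' k *
      (racahP n m p G G' k).eval (racahRoot n m p G G' l) ^ 2 := by
  have hW := prod_range_racahB_pos hp hn hm hG0 hG1 hG0' hG1'
  have h := christoffel_darboux_deriv (racahA n m p G G') (racahBplus n m p G G')
    (racahBminus n m p G G') (racahRoot n m p G G' l) (n + m - 1)
  rw [Nat.sub_add_cancel (by omega)] at h
  simp only [← racahP_eval, ← jacobiMatrix_eq] at h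
  rw [racahP_eval_racahRoot hp hn hm hG0 hG1 hG0' hG1' hl, zero_mul, sub_zero] at h
  have hd : (jacobiMatrix n m p G G' (n + m)).charpoly.derivative.eval (racahRoot n m p G G' l) =
      ∏ j ∈ (Finset.range (n + m)).erase l,
        (racahRoot n m p G G' l - racahRoot n m p G G' j) := by
    have h1 := racahP_eq_prod hp hn hm hG0 hG1 hG0' hG1'
    rw [racahP] at h1
    rw [h1, ← Finset.mul_prod_erase _ _ (Finset.mem_range.2 hl), derivative_mul]
    simp [eval_prod]
  have hI : ∏ k ∈ Finset.Ico 1 (n + m), racahBplus n m p G G' (k - 1) * racahBminus n m p G G' k =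
      ∏ s ∈ Finset.range (n + m - 1),
      (racahBplus n m p G G' s * racahBminus n m p G G' (s + 1)) := by
    rw [Finset.prod_Ico_eq_prod_range]
    refine Finset.prod_congr rfl fun s _ => ?_
    rw [Nat.add_sub_cancel_left, add_comm 1 s]
  rw [racahN, hI, ← hd, div_mul_eq_mul_div, div_eq_iff hW.ne', mul_comm (eval _ _), h,
    Finset.sum_mul]
  refine Finset.sum_congr rfl fun k hk => ?_
  rw [prod_Ico_racahB hp hn hm hG0 hG1 hG0' hG1' (Finset.mem_range.1 hk)]
  ring

theorem racahN_pos {l : ℕ} (hl : l < n + m) : 0 < racahN n m p G G' l := by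
  rw [racahN_eq_sum hp hn hm hG0 hG1 hG0' hG1' hl]
  refine Finset.sum_pos' (fun k hk => ?_) ⟨0, Finset.mem_range.2 (by omega), ?_⟩
  · have := weightOne_pos hp hn hm hG0 hG1 hG0' hG1' (Finset.mem_range.1 hk)
    positivity
  · have h1 := weightOne_pos hp hn hm hG0 hG1 hG0' hG1' (k := 0) (by omega)
    have h2 := racahC_pos hp hn hm hG0 hG1 hG0' hG1' (k := 0) (by omega)
    rw [racahP_eval, triP_zero]
    positivity

/-- `V_λ` cancels between the squared prefactor and the weight. Cauchy–Binet then gives the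
determinant of one-particle inner products, evaluated by orthogonality. -/
theorem sum_prefC_altA (ν μ : ↥(Lam n m)) :
    ∑ l : ↥(Lam n m), prefC n m p G G' l ^ 2 * (altA n m p G G' ν l * altA n m p G G' μ l) *
      weight n m p 1 G G' l =
    (∏ j : Fin n, (weightOne n m p G G' (n - 1 - (j : ℕ)) *
      racahC n m p G G' (n - 1 - (j : ℕ)) ^ 2))⁻¹ *
    (Matrix.of fun i j : Fin n => if node n ν i = node n μ j then
      racahN n m p G G' (node n ν i) else 0).det := by
  classical
  have h1 : ∀ l : ↥(Lam n m), prefC n m p G G' l ^ 2 *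
      (altA n m p G G' ν l * altA n m p G G' μ l) * weight n m p 1 G G' l =
      (∏ j : Fin n, (weightOne n m p G G' (n - 1 - (j : ℕ)) *
        racahC n m p G G' (n - 1 - (j : ℕ)) ^ 2))⁻¹ *
      ((Matrix.of fun i j : Fin n => (fun (k : Fin (n + m)) (j : Fin n) =>
        (racahC n m p G G' k ^ 2 * weightOne n m p G G' k) *
          (racahP n m p G G' k).eval (racahRoot n m p G G' (node n ν j))) (nodeFin l i) j).det *
      (Matrix.of fun i j : Fin n => (fun (k : Fin (n + m)) (j : Fin n) =>
          (racahP n m p G G' k).eval (racahRoot n m p G G' (node n μ j))) (nodeFin l i) j).det) :=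
      fun l => by
    have e1 : (Matrix.of fun i j : Fin n => (fun (k : Fin (n + m)) (j : Fin n) =>
        (racahC n m p G G' k ^ 2 * weightOne n m p G G' k) *
          (racahP n m p G G' k).eval (racahRoot n m p G G' (node n ν j))) (nodeFin l i) j).det =
        (∏ j, (racahC n m p G G' (node n l j) ^ 2 * weightOne n m p G G' (node n l j))) *
          altA n m p G G' ν l :=
      Matrix.det_mul_column (fun i => racahC n m p G G' (node n l i) ^ 2 *
        weightOne n m p G G' (node n l i)) _
    have e2 : (Matrix.of fun i j : Fin n => (fun (k : Fin (n + m)) (j : Fin n) =>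
          (racahP n m p G G' k).eval (racahRoot n m p G G' (node n μ j))) (nodeFin l i) j).det =
        altA n m p G G' μ l := rfl
    have hv := (vand_pos hp hn hm hG0 hG1 l.2).ne'
    rw [e1, e2, prefC_eq hp hn hm hG0 hG1 hG0' hG1', weight_eq hp hn hm hG0 hG1 hG0' hG1' l.2]
    simp only [Finset.prod_mul_distrib, Finset.prod_div_distrib, Finset.prod_pow, mul_inv]
    field_simp
  simp_rw [h1]
  rw [← Finset.mul_sum]
  congr 1
  refine (sum_Lam_eq_sum_strictAnti (fun g => (Matrix.of fun i j : Fin n =>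
      (fun (k : Fin (n + m)) (j : Fin n) =>
        (racahC n m p G G' k ^ 2 * weightOne n m p G G' k) *
          (racahP n m p G G' k).eval (racahRoot n m p G G' (node n ν j))) (g i) j).det *
      (Matrix.of fun i j : Fin n => (fun (k : Fin (n + m)) (j : Fin n) =>
          (racahP n m p G G' k).eval (racahRoot n m p G G' (node n μ j))) (g i) j).det)).trans ?_
  refine (Matrix.sum_det_mul_det_strictAnti (fun (k : Fin (n + m)) (j : Fin n) =>
        (racahC n m p G G' k ^ 2 * weightOne n m p G G' k) *
          (racahP n m p G G' k).eval (racahRoot n m p G G' (node n ν j)))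
      (fun (k : Fin (n + m)) (j : Fin n) =>
        (racahP n m p G G' k).eval (racahRoot n m p G G' (node n μ j)))).trans ?_
  congr 1
  ext i j
  simp only [Matrix.of_apply]
  rw [Fin.sum_univ_eq_sum_range (fun k => racahC n m p G G' k ^ 2 * weightOne n m p G G' k *
    (racahP n m p G G' k).eval (racahRoot n m p G G' (node n ν i)) *
    (racahP n m p G G' k).eval (racahRoot n m p G G' (node n μ j)))]
  by_cases h : node n ν i = node n μ j
  · rw [if_pos h, ← h, racahN_eq_sum hp hn hm hG0 hG1 hG0' hG1' (node_lt ν.2 i)]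
    exact Finset.sum_congr rfl fun k _ => by ring
  · rw [if_neg h, ← racah_orthogonality hp hn hm hG0 hG1 hG0' hG1' (node_lt ν.2 i)
      (node_lt μ.2 j) h]
    exact Finset.sum_congr rfl fun k _ => by ring

theorem sum_prefC_altA_self (ν : ↥(Lam n m)) :
    ∑ l : ↥(Lam n m), prefC n m p G G' l ^ 2 * (altA n m p G G' ν l * altA n m p G G' ν l) *
      weight n m p 1 G G' l =
    ∏ j : Fin n, racahN n m p G G' (node n ν j) / (weightOne n m p G G' (n - 1 - (j : ℕ)) *
      racahC n m p G G' (n - 1 - (j : ℕ)) ^ 2) := by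
  rw [sum_prefC_altA hp hn hm hG0 hG1 hG0' hG1']
  have : (Matrix.of fun i j : Fin n => if node n ν i = node n ν j then
      racahN n m p G G' (node n ν i) else 0) =
      Matrix.diagonal fun i => racahN n m p G G' (node n ν i) := by
    ext i j
    simp only [Matrix.of_apply, Matrix.diagonal_apply, (node_strictAnti ν.2).injective.eq_iff]
  rw [this, Matrix.det_diagonal, Finset.prod_div_distrib, div_eq_inv_mul]

theorem sum_prefC_altA_of_ne {ν μ : ↥(Lam n m)} (h : ν ≠ μ) :
    ∑ l : ↥(Lam n m), prefC n m p G G' l ^ 2 * (altA n m p G G' ν l * altA n m p G G' μ l) *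
      weight n m p 1 G G' l = 0 := by
  rw [sum_prefC_altA hp hn hm hG0 hG1 hG0' hG1']
  -- If every site of `ν` were one of `μ`, the matching would be an increasing bijection of `Fin n`,
  -- hence the identity, forcing `ν = μ`. So the Gram matrix has a zero row.
  obtain ⟨i, hi⟩ : ∃ i, ∀ j, node n ν i ≠ node n μ j := by
    by_contra! hc
    choose τ hτ using hc
    have hτi : Function.Injective τ := fun i i' hii =>
      (node_strictAnti ν.2).injective (by rw [hτ, hτ, hii])
    have hτm : StrictMono τ := fun i i' hii => by
      have h1 : node n ν i' < node n ν i := node_strictAnti ν.2 hii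
      rw [hτ, hτ] at h1
      exact (node_strictAnti μ.2).lt_iff_gt.1 h1
    have hid : τ = id := (StrictMono.range_inj hτm strictMono_id).1 (by
      rw [(Finite.surjective_of_injective hτi).range_eq, Set.range_id])
    refine h (nodeFin_injective (funext fun i => Fin.ext ?_))
    have := hτ i
    rwa [hid] at this
  rw [Matrix.det_eq_zero_of_row_eq_zero i (fun j => by simp [hi j]), mul_zero]

/-- For the zero partition the rows are monic polynomials of degrees `n - 1, …, 0`, which give up to
sign the Vandermonde determinant of distinct roots. -/
theorem altA_zero_ne_zero (ν : ↥(Lam n m)) : altA n m p G G' ν 0 ≠ 0 := by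
  set E : Fin n → ℝ := fun j => racahRoot n m p G G' (node n ν j)
  have hE : Function.Injective E := fun i j hij => (node_strictAnti ν.2).injective
    (racahRoot_injOn hp hn hm hG0 hG1 hG0' hG1' (node_lt ν.2 i) (node_lt ν.2 j) hij)
  have hdeg : ∀ i : Fin n, (racahP n m p G G' i).natDegree = i :=
    fun i => natDegree_charpoly_tridiag _ _ _ _
  have h := Matrix.det_eval_matrixOfPolynomials_eq_det_vandermonde E
    (fun i : Fin n => racahP n m p G G' i) hdeg (fun i => Matrix.charpoly_monic _)
  have h0 := Matrix.det_vandermonde_ne_zero_iff.2 hE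
  rw [h, ← Matrix.det_transpose] at h0
  have h2 : altA n m p G G' ν 0 = Equiv.Perm.sign (Fin.revPerm : Equiv.Perm (Fin n)) *
      (Matrix.of fun i j : Fin n => eval (E i) (racahP n m p G G' j)).transpose.det := by
    rw [← Matrix.det_permute, altA]
    congr 1
    ext i j
    simp only [Matrix.of_apply, Matrix.submatrix_apply, Matrix.transpose_apply, id,
      Fin.revPerm_apply, Fin.val_rev, node, Pi.zero_apply, Int.toNat_zero, add_zero]
    rw [show n - 1 - (i : ℕ) = n - (i + 1) by omega]
    rfl
  rw [h2]
  refine mul_ne_zero ?_ h0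
  rcases Int.units_eq_one_or (Equiv.Perm.sign (Fin.revPerm : Equiv.Perm (Fin n))) with h | h <;>
    simp [h]

theorem normN_eq (ν : ↥(Lam n m)) : normN n m p G G' ν = 1 / altA n m p G G' ν 0 ^ 2 *
    ∏ j : Fin n, racahN n m p G G' (node n ν j) / (weightOne n m p G G' (n - 1 - (j : ℕ)) *
      racahC n m p G G' (n - 1 - (j : ℕ)) ^ 2) := by
  rw [← sum_prefC_altA_self hp hn hm hG0 hG1 hG0' hG1', normN, Finset.mul_sum,
    ← Finset.sum_coe_sort (Lam n m)]
  refine Finset.sum_congr rfl fun l _ => ?_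
  rw [schurS]
  ring

theorem normN_pos (ν : ↥(Lam n m)) : 0 < normN n m p G G' ν := by
  rw [normN_eq hp hn hm hG0 hG1 hG0' hG1']
  have h0 := altA_zero_ne_zero hp hn hm hG0 hG1 hG0' hG1' ν
  refine mul_pos (by positivity) (Finset.prod_pos fun j _ => div_pos
    (racahN_pos hp hn hm hG0 hG1 hG0' hG1' (node_lt ν.2 j)) (mul_pos
      (weightOne_pos hp hn hm hG0 hG1 hG0' hG1' (by have := j.isLt; omega)) (pow_pos
        (racahC_pos hp hn hm hG0 hG1 hG0' hG1' (by have := j.isLt; omega)) 2)))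

/-! ### The eigenfunctions -/

theorem innerDelta_eigenfun (ν μ : ↥(Lam n m)) :
    innerDelta n m p G G' (eigenfun n m p G G' ν) (eigenfun n m p G G' μ) =
      if ν = μ then ((normN n m p G G' ν)⁻¹ : ℂ) else 0 := by
  have h : innerDelta n m p G G' (eigenfun n m p G G' ν) (eigenfun n m p G G' μ) =
      ((normN n m p G G' ν * altA n m p G G' ν 0 * (normN n m p G G' μ * altA n m p G G' μ 0))⁻¹ *
      ∑ l : ↥(Lam n m), prefC n m p G G' l ^ 2 *
        (altA n m p G G' ν l * altA n m p G G' μ l) * weight n m p 1 G G' l : ℝ) := by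
    rw [innerDelta, Finset.mul_sum, Complex.ofReal_sum]
    refine Finset.sum_congr rfl fun l _ => ?_
    rw [eigenfun, eigenfun, Complex.conj_ofReal, ← Complex.ofReal_mul, ← Complex.ofReal_mul,
      schurS, schurS, mul_inv, mul_inv, mul_inv]
    congr 1
    ring
  rw [h]
  split_ifs with hνμ
  · subst hνμ
    have h0 := altA_zero_ne_zero hp hn hm hG0 hG1 hG0' hG1' ν
    have h1 := (normN_pos hp hn hm hG0 hG1 hG0' hG1' ν).ne'
    have h2 := normN_eq hp hn hm hG0 hG1 hG0' hG1' ν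
    rw [← sum_prefC_altA_self hp hn hm hG0 hG1 hG0' hG1' ν] at h2
    rw [← Complex.ofReal_inv]
    congr 1
    field_simp at h2 ⊢
    linarith
  · rw [sum_prefC_altA_of_ne hp hn hm hG0 hG1 hG0' hG1' hνμ, mul_zero, Complex.ofReal_zero]

/-- Dividing by `n_ν`, not by its square root, is what makes this value equal the squared norm. -/
theorem eigenfun_zeroPart (ν : ↥(Lam n m)) :
    eigenfun n m p G G' ν (zeroPart n m) = ((normN n m p G G' ν)⁻¹ : ℂ) := by
  rw [eigenfun, zeroPart, prefC_zero hp hn hm hG0 hG1 hG0' hG1', schurS,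
    div_self (altA_zero_ne_zero hp hn hm hG0 hG1 hG0' hG1' ν)]
  push_cast
  ring

theorem linearIndependent_eigenfun :
    LinearIndependent ℂ fun ν : ↥(Lam n m) => eigenfun n m p G G' ν := by
  rw [Fintype.linearIndependent_iff]
  intro c hc μ
  have h1 : ∑ ν, c ν * innerDelta n m p G G' (eigenfun n m p G G' ν) (eigenfun n m p G G' μ) =
      innerDelta n m p G G' (∑ ν, c ν • eigenfun n m p G G' ν) (eigenfun n m p G G' μ) := by
    simp only [innerDelta, Finset.mul_sum, Finset.sum_apply, Pi.smul_apply, smul_eq_mul,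
      Finset.sum_mul]
    rw [Finset.sum_comm]
    exact Finset.sum_congr rfl fun _ _ => Finset.sum_congr rfl fun _ _ => by ring
  rw [hc] at h1
  simp only [innerDelta_eigenfun hp hn hm hG0 hG1 hG0' hG1', mul_ite, mul_zero,
    Finset.sum_ite_eq', Finset.mem_univ, if_true] at h1
  have h2 := (normN_pos hp hn hm hG0 hG1 hG0' hG1' μ).ne'
  have h3 : innerDelta n m p G G' 0 (eigenfun n m p G G' μ) = 0 := by simp [innerDelta]
  rw [h3] at h1
  exact (mul_eq_zero.1 h1).resolve_right (by simpa using h2)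

/-- The basis of eigenfunctions. -/
def eigenbasis : Module.Basis ↥(Lam n m) ℂ (↥(Lam n m) → ℂ) :=
  haveI : Nonempty ↥(Lam n m) := ⟨zeroPart n m⟩
  basisOfLinearIndependentOfCardEqFinrank
    (linearIndependent_eigenfun hp hn hm hG0 hG1 hG0' hG1') (by simp)

theorem eigenbasis_apply (ν : ↥(Lam n m)) :
    eigenbasis hp hn hm hG0 hG1 hG0' hG1' ν = eigenfun n m p G G' ν := by
  simp [eigenbasis]

end

/-! ### The limit operator -/

theorem extendZero_add {n m : ℕ} (f g : ↥(Lam n m) → ℂ) (μ : Fin n → ℤ) :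
    extendZero (f + g) μ = extendZero f μ + extendZero g μ := by
  unfold extendZero
  split_ifs <;> simp

theorem extendZero_smul {n m : ℕ} (c : ℂ) (f : ↥(Lam n m) → ℂ) (μ : Fin n → ℤ) :
    extendZero (c • f) μ = c * extendZero f μ := by
  unfold extendZero
  split_ifs <;> simp

/-- The limit of the difference operator for `g → 1`. -/
def limitHamiltonian (n m : ℕ) (p : ℝ) (G G' : Fin 4 → ℝ) :
    (↥(Lam n m) → ℂ) →ₗ[ℂ] (↥(Lam n m) → ℂ) where
  toFun f l := ((∑ j, racahA n m p G G' (node n l j) : ℝ) : ℂ) * f l +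
    ∑ j : Fin n, ∑ ε ∈ ({1, -1} : Finset ℤ),
      (coeffB n m p 1 G G' l.1 ε j : ℂ) * extendZero f (l.1 + Pi.single j ε)
  map_add' f g := by
    ext l
    simp only [Pi.add_apply, extendZero_add, mul_add, Finset.sum_add_distrib]
    ring
  map_smul' c f := by
    ext l
    simp only [Pi.smul_apply, extendZero_smul, smul_eq_mul, RingHom.id_apply, mul_add,
      Finset.mul_sum]
    congr 1
    · ring
    · exact Finset.sum_congr rfl fun _ _ => Finset.sum_congr rfl fun _ _ => by ring

section
variable {p : ℝ} (hp : |p| < 1) {n m : ℕ} (hn : 1 ≤ n) (hm : 1 ≤ m) {G G' : Fin 4 → ℝ}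
  (hG0 : 0 < G 0) (hG1 : 0 < G 1)
include hp hn hm hG0 hG1

/-- Coefficients of forbidden moves need not converge: `extendZero` removes them on both sides. -/
theorem tendsto_hamiltonian (f : ↥(Lam n m) → ℂ) (l : ↥(Lam n m)) :
    Tendsto (fun x : ℝ × (Fin 4 → ℝ) × (Fin 4 → ℝ) => hamiltonian n m p x.1 x.2.1 x.2.2 f l)
      (𝓝[regularParams] (1, G, G')) (𝓝 (limitHamiltonian n m p G G' f l)) := by
  refine Tendsto.add (((Complex.continuous_ofReal.tendsto _).comp
    (tendsto_coeffA hp hn hm hG0 hG1 l.2)).mul_const _)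
    (tendsto_finsetSum _ fun j _ => tendsto_finsetSum _ fun ε hε => ?_)
  by_cases hj : l.1 + Pi.single j ε ∈ Lam n m
  · exact ((Complex.continuous_ofReal.tendsto _).comp
      (tendsto_coeffB hp hn hm hG0 hG1 l.2 (by simpa using hε) hj)).mul_const _
  · have : extendZero f (l.1 + Pi.single j ε) = 0 := dif_neg hj
    simp only [this, mul_zero]
    exact tendsto_const_nhds

variable (hG0' : |G' 0| < G 0 + 1 / 2) (hG1' : |G' 1| < G 1 + 1 / 2)
include hG0' hG1'

theorem limitHamiltonian_eigenfun (ν : ↥(Lam n m)) :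
    limitHamiltonian n m p G G' (eigenfun n m p G G' ν) =
      ((eigenvalue n m p G G' ν : ℝ) : ℂ) • eigenfun n m p G G' ν := by
  set K : ℝ := (normN n m p G G' ν)⁻¹ * (altA n m p G G' ν 0)⁻¹ *
    (∏ j : Fin n, racahC n m p G G' (n - 1 - (j : ℕ)))⁻¹ with hK
  have hf : ∀ l : Fin n → ℤ, prefC n m p G G' l / normN n m p G G' ν * schurS n m p G G' ν l =
      K * (slaterDet n m p G G' ν l / vand n m p G l) := fun l => by
    rw [schurS, hK, mul_assoc, ← prefC_mul_altA hp hn hm hG0 hG1 hG0' hG1']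
    ring
  have he : ∀ μ : Fin n → ℤ, extendZero (eigenfun n m p G G' ν) μ =
      ((K * if μ ∈ Lam n m then slaterDet n m p G G' ν μ / vand n m p G μ else 0 : ℝ) : ℂ) :=
      fun μ => by
    by_cases h : μ ∈ Lam n m
    · rw [extendZero, dif_pos h, if_pos h, eigenfun, hf]
    · rw [extendZero, dif_neg h, if_neg h, mul_zero, Complex.ofReal_zero]
  ext l
  have h := slaterDet_eigen hp hn hm hG0 hG1 hG0' hG1' ν.2 l.2
  simp only [limitHamiltonian, LinearMap.coe_mk, AddHom.coe_mk, he, Pi.smul_apply, smul_eq_mul]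
  rw [eigenfun, hf]
  have h2 := congrArg (fun x : ℝ => (K : ℂ) * (x : ℂ)) h
  simp only [Complex.ofReal_add, Complex.ofReal_mul, Complex.ofReal_sum] at h2 ⊢
  rw [mul_left_comm (eigenvalue n m p G G' ν : ℂ), ← h2, mul_add, Finset.mul_sum]
  congr 1
  · ring
  · refine Finset.sum_congr rfl fun j _ => ?_
    rw [Finset.mul_sum]
    exact Finset.sum_congr rfl fun ε _ => mul_left_comm _ _ _

/-- In the eigenbasis the operator is diagonal, which counts multiplicities even if different `ν`
share a value `E_ν`. -/
theorem charpoly_limitHamiltonian : (limitHamiltonian n m p G G').charpoly =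
    ∏ ν : ↥(Lam n m), (X - C ((eigenvalue n m p G G' ν : ℝ) : ℂ)) := by
  classical
  have hb := eigenbasis_apply hp hn hm hG0 hG1 hG0' hG1'
  set b := eigenbasis hp hn hm hG0 hG1 hG0' hG1'
  have hM : LinearMap.toMatrix b b (limitHamiltonian n m p G G') =
      Matrix.diagonal fun ν : ↥(Lam n m) => ((eigenvalue n m p G G' ν : ℝ) : ℂ) := by
    ext μ ν
    rw [LinearMap.toMatrix_apply, hb, limitHamiltonian_eigenfun hp hn hm hG0 hG1 hG0' hG1',
      ← hb, map_smul, Module.Basis.repr_self, Finsupp.smul_apply, Finsupp.single_apply,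
      Matrix.diagonal_apply, smul_eq_mul]
    by_cases h : μ = ν
    · subst h; simp
    · rw [if_neg (Ne.symm h), if_neg h, mul_zero]
  rw [← LinearMap.charpoly_toMatrix _ b, hM, Matrix.charpoly_diagonal]

end

end
end EllipticRacah

/-! ### The diagonalization theorem -/

theorem mainTheorem3 (n m : ℕ) (hn : 1 ≤ n) (hm : 1 ≤ m) (G G' : Fin 4 → ℝ)
    (hG0 : 0 < G 0) (hG1 : 0 < G 1)
    (hG0' : |G' 0| < G 0 + 1 / 2) (hG1' : |G' 1| < G 1 + 1 / 2) :
    -- the labels: `E_ν` is real-analytic in `p`, with the trigonometric value at `p = 0`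
    (∀ ν : ↥(Lam n m),
      AnalyticOnNhd ℝ (fun p : ℝ => eigenvalue n m p G G' ν) (Set.Ioo (-1) 1) ∧
      eigenvalue n m 0 G G' ν =
        2 * ∑ j : Fin n, Real.cos (alpha n m 1 G *
          (((n : ℝ) - 1 - (j : ℕ)) + (G 0 + G 1 + G' 0 + G' 1) / 2 + (ν : Fin n → ℤ) j))) ∧
    ∀ p : ℝ, -1 < p → p < 1 →
      -- the coefficients `a_k` are well defined
      (∀ k < n + m, Tendsto (fun H => racahAFormula n m p H G' k)
        (𝓝[{H : Fin 4 → ℝ | H 0 ≠ 1 / 2 ∧ H 1 ≠ 1 / 2}] G) (𝓝 (racahA n m p G G' k))) ∧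
      -- the roots `E_0 > E_1 > ⋯ > E_{n+m-1}` of `P_{n+m}`
      (∀ k l : ℕ, k < l → l < n + m → racahRoot n m p G G' l < racahRoot n m p G G' k) ∧
      racahP n m p G G' (n + m) =
        ∏ l ∈ Finset.range (n + m), (X - C (racahRoot n m p G G' l)) ∧
      -- the weights are positive, the denominators in the eigenfunctions do not vanish
      (∀ l : ↥(Lam n m), 0 < weight n m p 1 G G' l) ∧
      (∀ ν : ↥(Lam n m), altA n m p G G' ν 0 ≠ 0 ∧ 0 < normN n m p G G' ν) ∧
      -- the limit `H₁` of `H` for `g → 1`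
      ∃ H₁ : (↥(Lam n m) → ℂ) →ₗ[ℂ] (↥(Lam n m) → ℂ),
        (∀ (f : ↥(Lam n m) → ℂ) (l : ↥(Lam n m)),
          Tendsto (fun x : ℝ × (Fin 4 → ℝ) × (Fin 4 → ℝ) =>
              hamiltonian n m p x.1 x.2.1 x.2.2 f l)
            (𝓝[{x | x.1 ≠ 1 ∧ x.2.1 0 ≠ 1 / 2 ∧ x.2.1 1 ≠ 1 / 2}] (1, G, G'))
            (𝓝 (H₁ f l))) ∧
        -- the eigenvalues, with multiplicities
        H₁.charpoly = ∏ ν : ↥(Lam n m), (X - C ((eigenvalue n m p G G' ν : ℝ) : ℂ)) ∧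
        -- the orthogonal eigenbasis and its normalization
        (∀ ν : ↥(Lam n m), H₁ (eigenfun n m p G G' ν) =
          ((eigenvalue n m p G G' ν : ℝ) : ℂ) • eigenfun n m p G G' ν) ∧
        (∃ b : Module.Basis ↥(Lam n m) ℂ (↥(Lam n m) → ℂ),
          ∀ ν : ↥(Lam n m), b ν = eigenfun n m p G G' ν) ∧
        (∀ ν μ : ↥(Lam n m), ν ≠ μ →
          innerDelta n m p G G' (eigenfun n m p G G' ν) (eigenfun n m p G G' μ) = 0) ∧
        (∀ ν : ↥(Lam n m), eigenfun n m p G G' ν (zeroPart n m) =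
          innerDelta n m p G G' (eigenfun n m p G G' ν) (eigenfun n m p G G' ν)) ∧
        (∀ ν : ↥(Lam n m), normN n m p G G' ν =
          1 / altA n m p G G' ν 0 ^ 2 *
            ∏ j : Fin n, racahN n m p G G' (node n ν j) /
              (weightOne n m p G G' (n - 1 - (j : ℕ)) *
                racahC n m p G G' (n - 1 - (j : ℕ)) ^ 2)) := by
  have hlt : ∀ (ν : ↥(Lam n m)) (j : Fin n), node n ν j < n + m := fun ν j => node_lt ν.2 j
  refine ⟨fun ν => ⟨?_, ?_⟩, fun p hp1 hp2 => ?_⟩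
  · exact Finset.analyticOnNhd_fun_sum _ fun j _ =>
      analyticOnNhd_racahRoot hn hm hG0 hG1 hG0' hG1' (hlt ν j)
  · rw [eigenvalue, Finset.mul_sum]
    refine Finset.sum_congr rfl fun j _ => ?_
    rw [racahRoot_nome_zero hn hm hG0 hG1 hG0' hG1' (hlt ν j), trigRoot, halfSum,
      node_real ((mem_Lam.1 ν.2).1 j).1]
    ring_nf
  have hp : |p| < 1 := abs_lt.2 ⟨hp1, hp2⟩
  refine ⟨fun k hk => ?_, fun k l => racahRoot_lt hp hn hm hG0 hG1 hG0' hG1',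
    racahP_eq_prod hp hn hm hG0 hG1 hG0' hG1',
    fun l => weight_pos hp hn hm hG0 hG1 hG0' hG1' l.2,
    fun ν => ⟨altA_zero_ne_zero hp hn hm hG0 hG1 hG0' hG1' ν,
      normN_pos hp hn hm hG0 hG1 hG0' hG1' ν⟩,
    limitHamiltonian n m p G G', tendsto_hamiltonian hp hn hm hG0 hG1,
    charpoly_limitHamiltonian hp hn hm hG0 hG1 hG0' hG1',
    limitHamiltonian_eigenfun hp hn hm hG0 hG1 hG0' hG1',
    ⟨eigenbasis hp hn hm hG0 hG1 hG0' hG1', eigenbasis_apply hp hn hm hG0 hG1 hG0' hG1'⟩,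
    fun ν μ h => ?_, fun ν => ?_, normN_eq hp hn hm hG0 hG1 hG0' hG1'⟩
  · rw [racahA_eq hp hn hm hG0 hG1 hk]
    exact tendsto_racahAFormula hp hn hm hG0 hG1 hk
  · rw [innerDelta_eigenfun hp hn hm hG0 hG1 hG0' hG1', if_neg h]
  · rw [innerDelta_eigenfun hp hn hm hG0 hG1 hG0' hG1', if_pos rfl,
      eigenfun_zeroPart hp hn hm hG0 hG1 hG0' hG1']
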